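/- A \emph{unit interval} is a closed interval $[x,x+1]\subset\mathbb{R}$. For a finite set $P$ of points of $\mathbb{R}$ and a finite set $T$ of intervals, the \emph{code} of $p\in P$ with respect to $T$ is the set of members of $T$ that contain $p$; $T$ is a \emph{discriminating code} for $P$ if every point of $P$ has a non-empty code and distinct points of $P$ have distinct codes. In the problem \textsc{Discrete-G-Min-Disc-Code} with unit intervals in 1D, the input is a set $P$ of $n\ge 1$ points of $\mathbb{R}$ and a set $S$ of $m$ unit intervals that is itself a discriminating code for $P$ (so that a solution exists), and the task is to find a minimum-cardinality $T\subseteq S$ that is a discriminating code for $P$. In \textsc{Continuous-G-Min-Disc-Code} with unit intervals in 1D, only $P$ is given, and $T$ may be any finite set of unit intervals that is a discriminating code for $P$. An instance $(P,S)$ is called \emph{reduced} if every interval of $S$ contains a point of $P$ (no useless interval) and no two distinct intervals of $S$ contain the same points of $P$ (no redundant interval). Algorithms are programs for a real random access machine with unit-cost operations: integer (address and counter) memory with addition, subtraction and comparison, real memory with field operations and comparison, indirect addressing, rational constants, and no rounding. The points and the left endpoints of the intervals are given in arbitrary order. \textbf{Theorem.} Both problems have a PTAS. More precisely, there are constants $C,c$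 such that for every real $\varepsilon>0$ the following hold. 1. There is a program that, on every instance $(P,S)$ of the discrete problem, halts with a discriminating code $T\subseteq S$ for $P$ satisfying $|T|\le(1+\varepsilon)|T'|$ for every discriminating code $T'\subseteq S$ for $P$. It takes at most $C\,2^{c/\varepsilon^2}n^2$ steps if the instance is reduced, and at most $C\,2^{c/\varepsilon^2}n^2+C\,m(\lfloor\log_2 m\rfloor+1)$ steps in general. 2. There is a program that, on every instance $P$ of the continuous problem, halts with a finite set $T$ of unit intervals that is a discriminating code for $P$ and satisfies $|T|\le(1+\varepsilon)|T'|$ for every finite set $T'$ of unit intervals that is a discriminating code for $P$. It takes at most $C\,2^{c/\varepsilon^2}n^2$ steps. -/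

import Mathlib

/-! ### Discriminating codes -/

namespace DiscCode

/-- The code of the point `p` with respect to the family of objects `T`: the set of those
members of `T` that contain `p`. -/
def code {α : Type*} (T : Finset (Set α)) (p : α) : Set (Set α) :=
  {I | I ∈ T ∧ p ∈ I}

/-- `T` discriminates the point set `P`: every point of `P` is covered, and distinct points
have distinct codes. -/
def IsDiscCode {α : Type*} (P : Set α) (T : Finset (Set α)) : Prop :=
  (∀ p ∈ P, (code T p).Nonempty) ∧ ∀ p ∈ P, ∀ q ∈ P, p ≠ q → code T p ≠ code T q

/-- Feasible solutions of the discrete problem `(P, S)`. -/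
def IsDiscreteSolution {α : Type*} (P : Set α) (S T : Finset (Set α)) : Prop :=
  T ⊆ S ∧ IsDiscCode P T

/-- The closed interval of length one with left endpoint `x`. -/
def unitSegment (x : ℝ) : Set ℝ := Set.Icc x (x + 1)

/-- Feasible solutions of the continuous problem for `P`, with unit intervals of the line as
the allowed objects. -/
def IsContinuousSolution (P : Set ℝ) (T : Finset (Set ℝ)) : Prop :=
  (∀ I ∈ T, ∃ x : ℝ, I = unitSegment x) ∧ IsDiscCode P T

/-- `T` is feasible and its size is at most `ρ` times the size of every feasible solution,
in particular of a minimum one. -/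
def IsApproxSolution {α : Type*} (Feasible : Finset (Set α) → Prop) (ρ : ℝ)
    (T : Finset (Set α)) : Prop :=
  Feasible T ∧ ∀ T' : Finset (Set α), Feasible T' → (T.card : ℝ) ≤ ρ * (T'.card : ℝ)

/-- No object is useless (contains no point of `P`) and no two objects are redundant (contain
the same points of `P`). -/
def IsReduced {α : Type*} (P : Set α) (S : Finset (Set α)) : Prop :=
  (∀ I ∈ S, ∃ p ∈ P, p ∈ I) ∧
    ∀ I ∈ S, ∀ J ∈ S, (∀ p ∈ P, p ∈ I ↔ p ∈ J) → I = J

open Classical in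
/-- The unit intervals with left endpoints `s 0, …, s (m - 1)`. -/
noncomputable def unitSegments {m : ℕ} (s : Fin m → ℝ) : Finset (Set ℝ) :=
  Finset.univ.image fun j => unitSegment (s j)

end DiscCode

/-! ### A real random access machine with a step count

Programs are finite texts. The memory consists of natural-number variables, natural-number
arrays and real-number arrays, all unbounded. Every elementary operation costs one step: a
literal, a memory access, an arithmetic operation, a comparison, a Boolean connective, an
assignment, a branch. Natural numbers (used for addresses and counters) can only be added,
subtracted and compared; on real numbers there are the four field operations and comparison,
but neither rounding nor conversion to a natural number, and all literals are rational. -/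

namespace RealRAM

/-- The contents of the memory. -/
structure Store where
  /-- natural-number variables -/
  nvar : ℕ → ℕ
  /-- natural-number arrays: name, then index -/
  narr : ℕ → ℕ → ℕ
  /-- real-number arrays: name, then index -/
  rarr : ℕ → ℕ → ℝ

/-- Expressions with values in the natural numbers. -/
inductive NExp where
  | lit (k : ℕ)
  | var (x : ℕ)
  | get (a : ℕ) (i : NExp)
  | add (e f : NExp)
  | sub (e f : NExp)

/-- Real expressions. -/
inductive RExp where
  | lit (q : ℚ)
  | get (a : ℕ) (i : NExp)
  | add (e f : RExp)
  | sub (e f : RExp)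
  | mul (e f : RExp)
  | div (e f : RExp)

/-- Tests. -/
inductive BExp where
  | nle (e f : NExp)
  | rle (e f : RExp)
  | not (b : BExp)
  | and (b c : BExp)

/-- Programs. -/
inductive Prog where
  | skip
  | setVar (x : ℕ) (e : NExp)
  | setNat (a : ℕ) (i : NExp) (e : NExp)
  | setReal (a : ℕ) (i : NExp) (e : RExp)
  | seq (c d : Prog)
  | ite (b : BExp) (c d : Prog)
  | while (b : BExp) (c : Prog)

/-- Value; subtraction is truncated at zero. -/
def NExp.eval (σ : Store) : NExp → ℕ
  | .lit k => k
  | .var x => σ.nvar x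
  | .get a i => σ.narr a (i.eval σ)
  | .add e f => e.eval σ + f.eval σ
  | .sub e f => e.eval σ - f.eval σ

/-- Number of steps of an evaluation. -/
def NExp.cost : NExp → ℕ
  | .lit _ => 1
  | .var _ => 1
  | .get _ i => i.cost + 1
  | .add e f => e.cost + f.cost + 1
  | .sub e f => e.cost + f.cost + 1

/-- Value; a division by zero returns zero. -/
noncomputable def RExp.eval (σ : Store) : RExp → ℝ
  | .lit q => (q : ℝ)
  | .get a i => σ.rarr a (i.eval σ)
  | .add e f => e.eval σ + f.eval σ
  | .sub e f => e.eval σ - f.eval σ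
  | .mul e f => e.eval σ * f.eval σ
  | .div e f => e.eval σ / f.eval σ

/-- Number of steps of an evaluation. -/
def RExp.cost : RExp → ℕ
  | .lit _ => 1
  | .get _ i => i.cost + 1
  | .add e f => e.cost + f.cost + 1
  | .sub e f => e.cost + f.cost + 1
  | .mul e f => e.cost + f.cost + 1
  | .div e f => e.cost + f.cost + 1

/-- Truth of a test. -/
def BExp.Holds (σ : Store) : BExp → Prop
  | .nle e f => e.eval σ ≤ f.eval σ
  | .rle e f => e.eval σ ≤ f.eval σ
  | .not b => ¬ b.Holds σ
  | .and b c => b.Holds σ ∧ c.Holds σ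

/-- Number of steps of a test. -/
def BExp.cost : BExp → ℕ
  | .nle e f => e.cost + f.cost + 1
  | .rle e f => e.cost + f.cost + 1
  | .not b => b.cost + 1
  | .and b c => b.cost + c.cost + 1

/-- Assignment to a variable. -/
def Store.setVar (σ : Store) (x v : ℕ) : Store :=
  { σ with nvar := Function.update σ.nvar x v }

/-- Assignment to a cell of a natural-number array. -/
def Store.setNat (σ : Store) (a i v : ℕ) : Store :=
  { σ with narr := Function.update σ.narr a (Function.update (σ.narr a) i v) }

/-- Assignment to a cell of a real array. -/
noncomputable def Store.setReal (σ : Store) (a i : ℕ) (v : ℝ) : Store :=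
  { σ with rarr := Function.update σ.rarr a (Function.update (σ.rarr a) i v) }

/-- `Exec c σ t τ`: started on the memory `σ`, the program `c` halts after exactly `t` steps
with the memory `τ`. -/
inductive Exec : Prog → Store → ℕ → Store → Prop
  | skip (σ : Store) : Exec .skip σ 1 σ
  | setVar (σ : Store) (x : ℕ) (e : NExp) :
      Exec (.setVar x e) σ (e.cost + 1) (σ.setVar x (e.eval σ))
  | setNat (σ : Store) (a : ℕ) (i e : NExp) :
      Exec (.setNat a i e) σ (i.cost + e.cost + 1) (σ.setNat a (i.eval σ) (e.eval σ))
  | setReal (σ : Store) (a : ℕ) (i : NExp) (e : RExp) :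
      Exec (.setReal a i e) σ (i.cost + e.cost + 1) (σ.setReal a (i.eval σ) (e.eval σ))
  | seq {c d : Prog} {σ τ υ : Store} {t u : ℕ} :
      Exec c σ t τ → Exec d τ u υ → Exec (.seq c d) σ (t + u) υ
  | iteTrue {b : BExp} {c d : Prog} {σ τ : Store} {t : ℕ} :
      b.Holds σ → Exec c σ t τ → Exec (.ite b c d) σ (b.cost + 1 + t) τ
  | iteFalse {b : BExp} {c d : Prog} {σ τ : Store} {t : ℕ} :
      ¬ b.Holds σ → Exec d σ t τ → Exec (.ite b c d) σ (b.cost + 1 + t) τ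
  | whileFalse {b : BExp} {c : Prog} {σ : Store} :
      ¬ b.Holds σ → Exec (.while b c) σ (b.cost + 1) σ
  | whileTrue {b : BExp} {c : Prog} {σ τ υ : Store} {t u : ℕ} :
      b.Holds σ → Exec c σ t τ → Exec (.while b c) τ u υ →
        Exec (.while b c) σ (b.cost + 1 + t + u) υ

/-- The machine is deterministic, so the result and the number of steps are well defined. -/
theorem Exec.unique {c : Prog} {σ τ τ' : Store} {t t' : ℕ}
    (h : Exec c σ t τ) (h' : Exec c σ t' τ') : t = t' ∧ τ = τ' := by
  induction h generalizing t' τ' with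
  | skip | setVar | setNat | setReal => cases h'; exact ⟨rfl, rfl⟩
  | seq _ _ ih₁ ih₂ =>
    cases h' with
    | seq h₁ h₂ =>
      obtain ⟨rfl, rfl⟩ := ih₁ h₁
      obtain ⟨rfl, rfl⟩ := ih₂ h₂
      exact ⟨rfl, rfl⟩
  | iteTrue hb _ ih =>
    cases h' with
    | iteTrue _ h₁ => obtain ⟨rfl, rfl⟩ := ih h₁; exact ⟨rfl, rfl⟩
    | iteFalse hn _ => exact absurd hb hn
  | iteFalse hb _ ih =>
    cases h' with
    | iteTrue hn _ => exact absurd hn hb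
    | iteFalse _ h₁ => obtain ⟨rfl, rfl⟩ := ih h₁; exact ⟨rfl, rfl⟩
  | whileFalse hb =>
    cases h' with
    | whileFalse _ => exact ⟨rfl, rfl⟩
    | whileTrue hn _ _ => exact absurd hn hb
  | whileTrue hb _ _ ih₁ ih₂ =>
    cases h' with
    | whileFalse hn => exact absurd hb hn
    | whileTrue _ h₁ h₂ =>
      obtain ⟨rfl, rfl⟩ := ih₁ h₁
      obtain ⟨rfl, rfl⟩ := ih₂ h₂
      exact ⟨rfl, rfl⟩

/-- The list `v` as an initial segment of an array, followed by zeros. -/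
noncomputable def load {n : ℕ} (v : Fin n → ℝ) (i : ℕ) : ℝ :=
  if h : i < n then v ⟨i, h⟩ else 0

/-- The initial memory for two lists of reals: their lengths are in the variables `0` and `1`,
their entries in the real arrays `0` and `1`, and all other cells hold zero. -/
noncomputable def input {n m : ℕ} (p : Fin n → ℝ) (s : Fin m → ℝ) : Store where
  nvar x := if x = 0 then n else if x = 1 then m else 0
  narr _ _ := 0
  rarr a := if a = 0 then load p else if a = 1 then load s else fun _ => 0

/-- The family of unit intervals that a final memory describes: their number `k` (up to
repetitions) is in the variable `2`, their left endpoints are the first `k` entries of the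
real array `2`. -/
noncomputable def output (σ : Store) : Finset (Set ℝ) :=
  DiscCode.unitSegments fun j : Fin (σ.nvar 2) => σ.rarr 2 j

end RealRAM

/-! ### Counting expressions and their compilation -/

/-! Sort the points as q 0 < ... < q (n-1). A unit interval meets them in a block of indices [U, V),
so its endpoints lie in the gaps U and V among the gaps 0, ..., n. A family of unit intervals is a
discriminating code exactly when its members that contain a point cover all points and place an
endpoint in every gap (`exists_hit_of_isDiscCode`, `isDiscCode_of_hit`); sufficiency uses the common
length of the intervals. Hence a solution has at least (n+1)/2 members. Since U and V are monotone
in the left endpoint, the key U + V determines both, so there are at most 2n useful intervals up to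
redundancy; call a set of representatives E. As |E| is at most four times the optimum, an additive
error O(|E|/L) is a relative error O(1/L).

The set E is split into chunks of at most L^2 intervals. For each chunk an exhaustive search finds a
smallest subset hitting every gap and point that the chunk hits; the union of these subsets is a
solution. To bound its size, an arbitrary solution is restricted to each chunk and repaired by one
interval for each gap that may be lost, and a few for the points (`exists_covers_of_missed`). The
chunks arise in two stages.

Left endpoints are grouped greedily into windows of length one; consecutive windows are adjacent or
their left ends differ by at least two. A piece consists of L consecutive windows. A gap hit from
both sides of a boundary between pieces lies at one particular point or contains a left endpoint
from the first window after the boundary (`mem_cut`), so the loss is linear in the size of that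
window. By averaging, some offset makes the total of these sizes at most |E|/L.

Within a piece the intervals are sorted by residue, the distance from the left end of their window,
and cut into blocks of L^2. If two intervals with residues separated by r share a gap, this gap
adjoins one of boundedly many points determined by r and one of their windows (`shared_gap`). Thus a
block loses O(L) intervals, and only O(|F|/L^2) blocks occur in a piece F that needs cutting.
Altogether L times the output is at most L|T| + 44|E| for every solution T (`sum_all_chunks_le`),
which is at most (L + 176)|T| (`approx_of_chunks`).

The algorithm sorts the points by counting, finds the keys by binary search in O(m log n) steps, and
treats O(n) chunks in 2^(L^2) poly(L) n steps each. For the continuous problem, the trace of [x,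
x+1] on the points changes only at the positions p and p - 1, so these 2n positions and one position
right after each of them represent all useful intervals (`exists_candidate`), and the discrete
algorithm applies.

The programs are verified in a small program logic. Expressions with bounded sums are compiled to
loops (`CExp.comp_exec`); specifications bound the number of steps and ignore the registers and
bound variables of the compiled expressions. -/

namespace RealRAM

/-- Natural-number expressions with comparisons, conditionals and bounded sums. -/
inductive CExp where
  | lit (k : ℕ)
  | var (x : ℕ)
  | get (a : ℕ) (e : CExp)
  | add (e f : CExp)
  | sub (e f : CExp)
  | le (e f : CExp)
  | rle (r q : RExp)
  | ite (b e f : CExp)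
  | sum (x : ℕ) (N e : CExp)

open Classical in
/-- Value of a counting expression. -/
noncomputable def CExp.eval : CExp → Store → ℕ
  | .lit k, _ => k
  | .var x, σ => σ.nvar x
  | .get a e, σ => σ.narr a (e.eval σ)
  | .add e f, σ => e.eval σ + f.eval σ
  | .sub e f, σ => e.eval σ - f.eval σ
  | .le e f, σ => if e.eval σ ≤ f.eval σ then 1 else 0
  | .rle r q, σ => if r.eval σ ≤ q.eval σ then 1 else 0
  | .ite b e f, σ => if 1 ≤ b.eval σ then e.eval σ else f.eval σ
  | .sum x N e, σ => ∑ i ∈ Finset.range (N.eval σ), e.eval (σ.setVar x i)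

/-- Upper bound for the number of steps of the compiled expression. -/
noncomputable def CExp.cost : CExp → Store → ℕ
  | .lit _, _ => 2
  | .var _, _ => 2
  | .get _ e, σ => e.cost σ + 3
  | .add e f, σ => e.cost σ + f.cost σ + 4
  | .sub e f, σ => e.cost σ + f.cost σ + 4
  | .le e f, σ => e.cost σ + f.cost σ + 6
  | .rle r q, _ => r.cost + q.cost + 4
  | .ite b e f, σ => b.cost σ + e.cost σ + f.cost σ + 4
  | .sum x N e, σ =>
      N.cost σ + 10 + ∑ i ∈ Finset.range (N.eval σ), (e.cost (σ.setVar x i) + 14)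

/-- The program that leaves the value of an expression in the variable `d`, using the variables
from `d` on as registers. -/
def CExp.comp : CExp → ℕ → Prog
  | .lit k, d => .setVar d (.lit k)
  | .var x, d => .setVar d (.var x)
  | .get a e, d => .seq (e.comp d) (.setVar d (.get a (.var d)))
  | .add e f, d =>
      .seq (e.comp d) (.seq (f.comp (d + 1)) (.setVar d (.add (.var d) (.var (d + 1)))))
  | .sub e f, d =>
      .seq (e.comp d) (.seq (f.comp (d + 1)) (.setVar d (.sub (.var d) (.var (d + 1)))))
  | .le e f, d =>
      .seq (e.comp d) (.seq (f.comp (d + 1))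
        (.ite (.nle (.var d) (.var (d + 1))) (.setVar d (.lit 1)) (.setVar d (.lit 0))))
  | .rle r q, d => .ite (.rle r q) (.setVar d (.lit 1)) (.setVar d (.lit 0))
  | .ite b e f, d =>
      .seq (b.comp d) (.ite (.nle (.lit 1) (.var d)) (e.comp d) (f.comp d))
  | .sum x N e, d =>
      .seq (N.comp (d + 1)) (.seq (.setVar d (.lit 0)) (.seq (.setVar x (.lit 0))
        (.while (.nle (.add (.var x) (.lit 1)) (.var (d + 1)))
          (.seq (e.comp (d + 2)) (.seq (.setVar d (.add (.var d) (.var (d + 2))))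
            (.setVar x (.add (.var x) (.lit 1))))))))

/-- All variables that are read satisfy `V`. -/
def NExp.ok (V : ℕ → Bool) : NExp → Bool
  | .lit _ => true
  | .var x => V x
  | .get _ i => i.ok V
  | .add e f => e.ok V && f.ok V
  | .sub e f => e.ok V && f.ok V

/-- All variables that are read satisfy `V`. -/
def RExp.ok (V : ℕ → Bool) : RExp → Bool
  | .lit _ => true
  | .get _ i => i.ok V
  | .add e f => e.ok V && f.ok V
  | .sub e f => e.ok V && f.ok V
  | .mul e f => e.ok V && f.ok V
  | .div e f => e.ok V && f.ok V

/-- All free variables satisfy `V`; bound variables do not, and are less than `60`. -/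
def CExp.ok : CExp → (ℕ → Bool) → Bool
  | .lit _, _ => true
  | .var x, V => V x
  | .get _ e, V => e.ok V
  | .add e f, V => e.ok V && f.ok V
  | .sub e f, V => e.ok V && f.ok V
  | .le e f, V => e.ok V && f.ok V
  | .rle r q, V => r.ok V && q.ok V
  | .ite b e f, V => b.ok V && e.ok V && f.ok V
  | .sum x N e, V =>
      !(V x) && decide (x < 60) && N.ok V && e.ok (fun y => decide (y = x) || V y)

/-- The two memories have the same arrays and agree on the variables in `V`. -/
def Agree (V : ℕ → Bool) (σ τ : Store) : Prop :=
  (∀ y, V y = true → τ.nvar y = σ.nvar y) ∧ τ.narr = σ.narr ∧ τ.rarr = σ.rarr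

theorem Agree.refl (V : ℕ → Bool) (σ : Store) : Agree V σ σ := ⟨fun _ _ => rfl, rfl, rfl⟩

theorem Agree.trans {V : ℕ → Bool} {σ τ υ : Store} (h : Agree V σ τ) (h' : Agree V τ υ) :
    Agree V σ υ :=
  ⟨fun y hy => (h'.1 y hy).trans (h.1 y hy), h'.2.1.trans h.2.1, h'.2.2.trans h.2.2⟩

theorem Agree.setVar_right {V : ℕ → Bool} {σ τ : Store} {x v : ℕ} (h : Agree V σ τ)
    (hx : V x = false) : Agree V σ (τ.setVar x v) := by
  refine ⟨fun y hy => ?_, h.2.1, h.2.2⟩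
  have : y ≠ x := by rintro rfl; simp [hx] at hy
  simpa [Store.setVar, this] using h.1 y hy

theorem Agree.setVar {V : ℕ → Bool} {σ τ : Store} (x v : ℕ) (h : Agree V σ τ) :
    Agree V (σ.setVar x v) (τ.setVar x v) := by
  refine ⟨fun y hy => ?_, h.2.1, h.2.2⟩
  by_cases hyx : y = x
  · subst hyx; simp [Store.setVar]
  · simpa [Store.setVar, hyx] using h.1 y hy

theorem NExp.eval_congr {V : ℕ → Bool} {σ τ : Store} (h : Agree V σ τ) :
    ∀ {e : NExp}, e.ok V = true → e.eval τ = e.eval σ := by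
  intro e
  induction e with
  | lit k => intro _; rfl
  | var x => intro he; exact h.1 x he
  | get a i ih => intro he; simp only [NExp.eval, h.2.1, ih he]
  | add e f ihe ihf | sub e f ihe ihf =>
    intro he
    simp only [NExp.ok, Bool.and_eq_true] at he
    simp only [NExp.eval, ihe he.1, ihf he.2]

theorem RExp.eval_congr {V : ℕ → Bool} {σ τ : Store} (h : Agree V σ τ) :
    ∀ {e : RExp}, e.ok V = true → e.eval τ = e.eval σ := by
  intro e
  induction e with
  | lit k => intro _; rfl
  | get a i => intro he; simp only [RExp.eval, h.2.2, NExp.eval_congr h he]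
  | add e f ihe ihf | sub e f ihe ihf | mul e f ihe ihf | div e f ihe ihf =>
    intro he
    simp only [RExp.ok, Bool.and_eq_true] at he
    simp only [RExp.eval, ihe he.1, ihf he.2]

/-- The cost is included because it depends on the memory as well, through the bounds of the sums.
-/
theorem CExp.eval_congr (e : CExp) : ∀ {V : ℕ → Bool} {σ τ : Store}, Agree V σ τ →
    e.ok V = true → e.eval τ = e.eval σ ∧ e.cost τ = e.cost σ := by
  induction e with
  | lit k => intro V σ τ _ _; exact ⟨rfl, rfl⟩
  | var x => intro V σ τ h he; exact ⟨h.1 x he, rfl⟩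
  | get a e ih =>
    intro V σ τ h he
    have := ih h he
    simp only [CExp.eval, CExp.cost, h.2.1, this, and_self]
  | add e f ihe ihf | sub e f ihe ihf | le e f ihe ihf =>
    intro V σ τ h he
    simp only [CExp.ok, Bool.and_eq_true] at he
    have h1 := ihe h he.1
    have h2 := ihf h he.2
    simp only [CExp.eval, CExp.cost, h1, h2, and_self]
  | rle r q =>
    intro V σ τ h he
    simp only [CExp.ok, Bool.and_eq_true] at he
    simp only [CExp.eval, CExp.cost, RExp.eval_congr h he.1, RExp.eval_congr h he.2, and_self]
  | ite b e f ihb ihe ihf =>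
    intro V σ τ h he
    simp only [CExp.ok, Bool.and_eq_true] at he
    have h1 := ihb h he.1.1
    have h2 := ihe h he.1.2
    have h3 := ihf h he.2
    simp only [CExp.eval, CExp.cost, h1, h2, h3, and_self]
  | sum x N e ihN ihe =>
    intro V σ τ h he
    simp only [CExp.ok, Bool.and_eq_true] at he
    have h1 := ihN h he.1.2
    have h2 : ∀ i, _ := fun i => ihe (V := fun y => decide (y = x) || V y)
      (σ := σ.setVar x i) (τ := τ.setVar x i) (by
        refine ⟨fun y hy => ?_, h.2.1, h.2.2⟩
        by_cases hyx : y = x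
        · subst hyx; simp [Store.setVar]
        · simp only [hyx, decide_false, Bool.false_or] at hy
          simpa [Store.setVar, hyx] using h.1 y hy) he.2
    simp only [CExp.eval, CExp.cost, h1, h2, and_self]

/-- A counting `while` loop with invariant. -/
theorem exec_while {b : BExp} {c : Prog} (Inv : ℕ → Store → Prop) (N : ℕ) (cst : ℕ → ℕ)
    (hb : ∀ i τ, Inv i τ → (b.Holds τ ↔ i < N))
    (hstep : ∀ i < N, ∀ τ, Inv i τ → ∃ t ≤ cst i, ∃ τ', Exec c τ t τ' ∧ Inv (i + 1) τ') :
    ∀ r i, i + r = N → ∀ τ, Inv i τ →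
      ∃ t ≤ ∑ j ∈ Finset.range r, (cst (i + j) + b.cost + 1) + b.cost + 1,
        ∃ τ', Exec (.while b c) τ t τ' ∧ Inv N τ' := by
  intro r
  induction r with
  | zero =>
    intro i hi τ hτ
    have hi' : i = N := by omega
    subst hi'
    refine ⟨b.cost + 1, by simp, τ, .whileFalse (fun h => ?_), hτ⟩
    exact absurd ((hb _ _ hτ).1 h) (lt_irrefl _)
  | succ r ih =>
    intro i hi τ hτ
    have hlt : i < N := by omega
    obtain ⟨t, ht, τ', hx, hI⟩ := hstep i hlt τ hτ
    obtain ⟨u, hu, τ'', hx', hI'⟩ := ih (i + 1) (by omega) τ' hI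
    refine ⟨b.cost + 1 + t + u, ?_, τ'', .whileTrue ((hb _ _ hτ).2 hlt) hx hx', hI'⟩
    rw [Finset.sum_range_succ']
    have : ∀ j, i + 1 + j = i + (j + 1) := by intro j; omega
    simp only [this] at hu
    simp only [add_zero]
    omega

theorem setVar_nvar_self (σ : Store) (x v : ℕ) : (σ.setVar x v).nvar x = v := by
  simp [Store.setVar]

theorem setVar_nvar_of_ne (σ : Store) {x y : ℕ} (v : ℕ) (h : y ≠ x) :
    (σ.setVar x v).nvar y = σ.nvar y := by
  simp [Store.setVar, h]

/-- Correctness of the compilation. -/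
theorem CExp.comp_exec (e : CExp) : ∀ (V : ℕ → Bool) (d : ℕ) (σ : Store), e.ok V = true →
    60 ≤ d → (∀ y, V y = true → y < 60) →
    ∃ t ≤ e.cost σ, ∃ τ, Exec (e.comp d) σ t τ ∧ τ.nvar d = e.eval σ ∧ Agree V σ τ ∧
      ∀ y, 60 ≤ y → y < d → τ.nvar y = σ.nvar y := by
  have hV60 : ∀ {V : ℕ → Bool} {d : ℕ}, 60 ≤ d → (∀ y, V y = true → y < 60) →
      V d = false := by
    intro V d hd hV
    by_contra h
    have := hV d (by simpa using h)
    omega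
  induction e with
  | lit k =>
    intro V d σ he hd hV
    refine ⟨2, le_rfl, _, .setVar σ d _, setVar_nvar_self .., ?_, ?_⟩
    · exact (Agree.refl V σ).setVar_right (hV60 hd hV)
    · intro y _ hy; exact setVar_nvar_of_ne _ _ hy.ne
  | var x =>
    intro V d σ he hd hV
    refine ⟨2, le_rfl, _, .setVar σ d _, setVar_nvar_self .., ?_, ?_⟩
    · exact (Agree.refl V σ).setVar_right (hV60 hd hV)
    · intro y _ hy; exact setVar_nvar_of_ne _ _ hy.ne
  | get a e ih =>
    intro V d σ he hd hV
    obtain ⟨t, ht, τ, hx, hv, hA, hP⟩ := ih V d σ he hd hV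
    refine ⟨_, ?_, _, .seq hx (.setVar τ d _), ?_, hA.setVar_right (hV60 hd hV), ?_⟩
    · simp only [NExp.cost, CExp.cost]; omega
    · rw [setVar_nvar_self]; simp only [NExp.eval, CExp.eval, hv, hA.2.1]
    · intro y hy hy'; rw [setVar_nvar_of_ne _ _ hy'.ne]; exact hP y hy hy'
  | add e f ihe ihf | sub e f ihe ihf =>
    intro V d σ he hd hV
    simp only [CExp.ok, Bool.and_eq_true] at he
    obtain ⟨t, ht, τ, hx, hv, hA, hP⟩ := ihe V d σ he.1 hd hV
    obtain ⟨t', ht', τ', hx', hv', hA', hP'⟩ := ihf V (d + 1) τ he.2 (by omega) hV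
    have hc := f.eval_congr hA he.2
    refine ⟨_, ?_, _, .seq hx (.seq hx' (.setVar τ' d _)), ?_,
      (hA.trans hA').setVar_right (hV60 hd hV), ?_⟩
    · simp only [NExp.cost, CExp.cost]; omega
    · rw [setVar_nvar_self]
      simp only [NExp.eval, CExp.eval, hv', hP' d hd (by omega), hv, hc]
    · intro y hy hy'
      rw [setVar_nvar_of_ne _ _ hy'.ne, hP' y hy (by omega), hP y hy hy']
  | le e f ihe ihf =>
    intro V d σ he hd hV
    simp only [CExp.ok, Bool.and_eq_true] at he
    obtain ⟨t, ht, τ, hx, hv, hA, hP⟩ := ihe V d σ he.1 hd hV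
    obtain ⟨t', ht', τ', hx', hv', hA', hP'⟩ := ihf V (d + 1) τ he.2 (by omega) hV
    have hc := f.eval_congr hA he.2
    have hPP : ∀ v y, 60 ≤ y → y < d → (τ'.setVar d v).nvar y = σ.nvar y := by
      intro v y hy hy'
      rw [setVar_nvar_of_ne _ _ hy'.ne, hP' y hy (by omega), hP y hy hy']
    have hd' := hP' d hd (by omega)
    by_cases hle : e.eval σ ≤ f.eval σ
    · refine ⟨_, ?_, _, .seq hx (.seq hx' (.iteTrue ?_ (.setVar τ' d _))), ?_,
        (hA.trans hA').setVar_right (hV60 hd hV), hPP _⟩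
      · simp only [NExp.cost, BExp.cost, CExp.cost]; omega
      · simpa only [BExp.Holds, NExp.eval, hv', hd', hv, hc] using hle
      · rw [setVar_nvar_self]; simp only [NExp.eval, CExp.eval, hle, if_true]
    · refine ⟨_, ?_, _, .seq hx (.seq hx' (.iteFalse ?_ (.setVar τ' d _))), ?_,
        (hA.trans hA').setVar_right (hV60 hd hV), hPP _⟩
      · simp only [NExp.cost, BExp.cost, CExp.cost]; omega
      · simpa only [BExp.Holds, NExp.eval, hv', hd', hv, hc] using hle
      · rw [setVar_nvar_self]; simp only [NExp.eval, CExp.eval, hle, if_false]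
  | rle r q =>
    intro V d σ he hd hV
    have hPP : ∀ v y, 60 ≤ y → y < d → (σ.setVar d v).nvar y = σ.nvar y := by
      intro v y hy hy'
      rw [setVar_nvar_of_ne _ _ hy'.ne]
    by_cases hle : r.eval σ ≤ q.eval σ
    · refine ⟨_, ?_, _, .iteTrue ?_ (.setVar σ d _), ?_,
        (Agree.refl V σ).setVar_right (hV60 hd hV), hPP _⟩
      · simp only [NExp.cost, BExp.cost, CExp.cost]; omega
      · exact hle
      · rw [setVar_nvar_self]; simp only [NExp.eval, CExp.eval, hle, if_true]
    · refine ⟨_, ?_, _, .iteFalse ?_ (.setVar σ d _), ?_,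
        (Agree.refl V σ).setVar_right (hV60 hd hV), hPP _⟩
      · simp only [NExp.cost, BExp.cost, CExp.cost]; omega
      · exact hle
      · rw [setVar_nvar_self]; simp only [NExp.eval, CExp.eval, hle, if_false]
  | ite b e f ihb ihe ihf =>
    intro V d σ he hd hV
    simp only [CExp.ok, Bool.and_eq_true] at he
    obtain ⟨t, ht, τ, hx, hv, hA, hP⟩ := ihb V d σ he.1.1 hd hV
    have hc := e.eval_congr hA he.1.2
    have hc' := f.eval_congr hA he.2
    by_cases hle : 1 ≤ b.eval σ
    · obtain ⟨t', ht', τ', hx', hv', hA', hP'⟩ := ihe V d τ he.1.2 hd hV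
      refine ⟨_, ?_, _, .seq hx (.iteTrue ?_ hx'), ?_, hA.trans hA',
        fun y hy hy' => (hP' y hy hy').trans (hP y hy hy')⟩
      · simp only [NExp.cost, BExp.cost, CExp.cost]; omega
      · simpa only [BExp.Holds, NExp.eval, hv] using hle
      · simp only [CExp.eval, hle, if_true, hv', hc]
    · obtain ⟨t', ht', τ', hx', hv', hA', hP'⟩ := ihf V d τ he.2 hd hV
      refine ⟨_, ?_, _, .seq hx (.iteFalse ?_ hx'), ?_, hA.trans hA',
        fun y hy hy' => (hP' y hy hy').trans (hP y hy hy')⟩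
      · simp only [NExp.cost, BExp.cost, CExp.cost]; omega
      · simpa only [BExp.Holds, NExp.eval, hv] using hle
      · simp only [CExp.eval, hle, if_false, hv', hc']
  | sum x N e ihN ihe =>
    intro V d σ he hd hV
    simp only [CExp.ok, Bool.and_eq_true, Bool.not_eq_true', decide_eq_true_eq] at he
    obtain ⟨⟨⟨hxV, hx60⟩, heN⟩, hee⟩ := he
    obtain ⟨t, ht, τ, hxN, hv, hA, hP⟩ := ihN V (d + 1) σ heN (by omega) hV
    set Inv : ℕ → Store → Prop := fun i υ =>
      υ.nvar x = i ∧ υ.nvar (d + 1) = N.eval σ ∧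
      υ.nvar d = ∑ j ∈ Finset.range i, e.eval (σ.setVar x j) ∧ Agree V σ υ ∧
      ∀ y, 60 ≤ y → y < d → υ.nvar y = σ.nvar y with hInv
    have key := exec_while (b := .nle (.add (.var x) (.lit 1)) (.var (d + 1)))
      (c := .seq (e.comp (d + 2)) (.seq (.setVar d (.add (.var d) (.var (d + 2))))
            (.setVar x (.add (.var x) (.lit 1))))) Inv (N.eval σ)
      -- The two assignments after the body cost 4 steps each. Together with the loop test, 5 steps
      -- and a branch, this gives the 14 in `CExp.cost`.
      (fun i => e.cost (σ.setVar x i) + 8) (by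
        rintro i υ ⟨h1, h2, -⟩
        simp only [BExp.Holds, NExp.eval, h1, h2]; omega) (by
        rintro i hi υ ⟨h1, h2, h3, h4, h5⟩
        -- The body is evaluated with the protected set enlarged by x, whose current value is the
        -- index. The invariant itself protects only V, because x is about to be incremented.
        have hAx : Agree (fun y => decide (y = x) || V y) (σ.setVar x i) υ := by
          refine ⟨fun y hy => ?_, h4.2.1, h4.2.2⟩
          by_cases hyx : y = x
          · subst hyx; rw [setVar_nvar_self, h1]
          · simp only [hyx, decide_false, Bool.false_or] at hy
            rw [setVar_nvar_of_ne _ _ hyx]; exact h4.1 y hy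
        have hV' : ∀ y, (decide (y = x) || V y) = true → y < 60 := by
          intro y hy
          simp only [Bool.or_eq_true, decide_eq_true_eq] at hy
          rcases hy with rfl | hy
          · exact hx60
          · exact hV y hy
        obtain ⟨t', ht', τ', hx', hv', hA', hP'⟩ := ihe _ (d + 2) υ hee (by omega) hV'
        obtain ⟨hc, hc'⟩ := e.eval_congr hAx hee
        refine ⟨_, ?_, _, .seq hx' (.seq (.setVar _ d _) (.setVar _ x _)), ?_⟩
        · simp only [NExp.cost]; omega
        · have hxd : x ≠ d := by omega
          have hxd1 : d + 1 ≠ x := by omega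
          have hτx : τ'.nvar x = i := by
            rw [hA'.1 x (by simp), h1]
          refine ⟨?_, ?_, ?_, ?_, ?_⟩
          · rw [setVar_nvar_self]
            simp only [NExp.eval]
            rw [setVar_nvar_of_ne _ _ hxd, hτx]
          · rw [setVar_nvar_of_ne _ _ hxd1, setVar_nvar_of_ne _ _ (by omega),
              hP' _ (by omega) (by omega), h2]
          · rw [setVar_nvar_of_ne _ _ hxd.symm, setVar_nvar_self, Finset.sum_range_succ]
            simp only [NExp.eval]
            rw [hv', hc, hP' _ hd (by omega), h3]
          · refine Agree.setVar_right (Agree.setVar_right (h4.trans ?_) (hV60 hd hV)) hxV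
            exact ⟨fun y hy => hA'.1 y (by simp [hy]), hA'.2.1, hA'.2.2⟩
          · intro y hy hy'
            rw [setVar_nvar_of_ne _ _ (by omega), setVar_nvar_of_ne _ _ hy'.ne,
              hP' _ hy (by omega), h5 y hy hy'])
      (N.eval σ) 0 (by omega) ((τ.setVar d 0).setVar x 0) (by
        refine ⟨setVar_nvar_self .., ?_, ?_, ?_, ?_⟩
        · rw [setVar_nvar_of_ne _ _ (by omega), setVar_nvar_of_ne _ _ (by omega), hv]
        · rw [setVar_nvar_of_ne _ _ (by omega), setVar_nvar_self]; simp
        · exact (hA.setVar_right (hV60 hd hV)).setVar_right hxV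
        · intro y hy hy'
          rw [setVar_nvar_of_ne _ _ (by omega), setVar_nvar_of_ne _ _ hy'.ne,
            hP y hy (by omega)])
    obtain ⟨u, hu, υ, hxu, hI⟩ := key
    refine ⟨_, ?_, υ, .seq hxN (.seq (.setVar _ d _) (.seq (.setVar _ x _) hxu)), ?_, hI.2.2.2.1,
      hI.2.2.2.2⟩
    · simp only [NExp.cost, BExp.cost, zero_add] at hu ⊢
      simp only [CExp.cost]
      have : ∑ j ∈ Finset.range (N.eval σ), (e.cost (σ.setVar x j) + 8 + (1 + 1 + 1 + 1 + 1) + 1)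
          = ∑ j ∈ Finset.range (N.eval σ), (e.cost (σ.setVar x j) + 14) := rfl
      omega
    · exact hI.2.2.1

end RealRAM

/-! ### Program logic -/

namespace RealRAM

/-- The program variables: those that are neither bound variables nor registers of counting
expressions. -/
def isProgVar (y : ℕ) : Bool := decide (y < 40)

theorem isProgVar_lt {y : ℕ} (h : isProgVar y = true) : y < 60 := by
  simp only [isProgVar, decide_eq_true_eq] at h; omega

/-- Up to bound variables and registers, `c` transforms `σ` into `τ` in at most `t` steps. -/
def Runs (c : Prog) (t : ℕ) (σ τ : Store) : Prop :=
  ∀ σ', Agree isProgVar σ σ' → ∃ t' ≤ t, ∃ τ', Exec c σ' t' τ' ∧ Agree isProgVar τ τ'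

/-- `c`, started on `σ`, halts in at most `t` steps with a memory satisfying `Q`. -/
def WP (c : Prog) (t : ℕ) (σ : Store) (Q : Store → Prop) : Prop :=
  ∃ τ, Runs c t σ τ ∧ Q τ

theorem WP.mono {c : Prog} {t t' : ℕ} {σ : Store} {Q Q' : Store → Prop} (h : WP c t σ Q)
    (ht : t ≤ t') (hQ : ∀ τ, Q τ → Q' τ) : WP c t' σ Q' := by
  obtain ⟨τ, hr, hq⟩ := h
  refine ⟨τ, fun σ' hσ' => ?_, hQ τ hq⟩
  obtain ⟨u, hu, r⟩ := hr σ' hσ'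
  exact ⟨u, hu.trans ht, r⟩

theorem WP.skip {σ : Store} {Q : Store → Prop} {t : ℕ} (h : Q σ) (ht : 1 ≤ t) :
    WP .skip t σ Q :=
  ⟨σ, fun σ' hσ' => ⟨1, ht, σ', .skip σ', hσ'⟩, h⟩

theorem WP.seq {c d : Prog} {t u : ℕ} {σ : Store} {Q : Store → Prop}
    (h : WP c t σ fun τ => WP d u τ Q) : WP (.seq c d) (t + u) σ Q := by
  obtain ⟨τ, hr, υ, hr', hq⟩ := h
  refine ⟨υ, fun σ' hσ' => ?_, hq⟩
  obtain ⟨t', ht', τ', hx, hA⟩ := hr σ' hσ'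
  obtain ⟨u', hu', υ', hx', hA'⟩ := hr' τ' hA
  exact ⟨t' + u', by omega, υ', .seq hx hx', hA'⟩

theorem WP.seq_le {c d : Prog} {T : ℕ} {σ : Store} {Q : Store → Prop} (t u : ℕ)
    (hT : t + u ≤ T) (h : WP c t σ fun τ => WP d u τ Q) : WP (.seq c d) T σ Q :=
  (WP.seq h).mono hT fun _ h => h

/-- Assignment of a counting expression to a variable. -/
def asg (x : ℕ) (e : CExp) : Prog := .seq (e.comp 60) (.setVar x (.var 60))

/-- Assignment of a counting expression to a cell of a natural-number array. -/
def stN (a : ℕ) (i e : CExp) : Prog :=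
  .seq (i.comp 60) (.seq (e.comp 61) (.setNat a (.var 60) (.var 61)))

/-- Assignment to a cell of a real array. -/
def stR (a : ℕ) (i : CExp) (r : RExp) : Prog :=
  .seq (i.comp 60) (.setReal a (.var 60) r)

/-- Conditional. -/
def ifX (b : CExp) (c d : Prog) : Prog :=
  .seq (b.comp 60) (.ite (.nle (.lit 1) (.var 60)) c d)

/-- Counting loop. -/
def forX (x : ℕ) (e : NExp) (c : Prog) : Prog :=
  .seq (.setVar x (.lit 0)) (.while (.nle (.add (.var x) (.lit 1)) e)
    (.seq c (.setVar x (.add (.var x) (.lit 1)))))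

/-- The memory handed to the postcondition changes only at x. The traces left by the compiled
expression in registers and bound variables are absorbed by `Agree`. -/
theorem WP.asg {x : ℕ} {e : CExp} {t : ℕ} {σ : Store} {Q : Store → Prop}
    (he : e.ok isProgVar = true) (h : Q (σ.setVar x (e.eval σ))) (ht : e.cost σ + 2 ≤ t) :
    WP (asg x e) t σ Q := by
  refine ⟨_, fun σ' hσ' => ?_, h⟩
  obtain ⟨t', ht', τ', hx, hv, hA, -⟩ := e.comp_exec isProgVar 60 σ' he le_rfl
    fun _ => isProgVar_lt
  obtain ⟨hc, hc'⟩ := e.eval_congr hσ' he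
  refine ⟨_, ?_, _, .seq hx (.setVar τ' x _), ?_⟩
  · simp only [NExp.cost]; omega
  · simp only [NExp.eval, hv, hc]; exact (hσ'.trans hA).setVar _ _

theorem Agree.setNat {V : ℕ → Bool} {σ τ : Store} (a i v : ℕ) (h : Agree V σ τ) :
    Agree V (σ.setNat a i v) (τ.setNat a i v) := by
  refine ⟨h.1, ?_, h.2.2⟩
  simp only [Store.setNat, h.2.1]

theorem Agree.setReal {V : ℕ → Bool} {σ τ : Store} (a i : ℕ) (v : ℝ) (h : Agree V σ τ) :
    Agree V (σ.setReal a i v) (τ.setReal a i v) := by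
  refine ⟨h.1, h.2.1, ?_⟩
  simp only [Store.setReal, h.2.2]

theorem WP.stN {a : ℕ} {i e : CExp} {t : ℕ} {σ : Store} {Q : Store → Prop}
    (hi : i.ok isProgVar = true) (he : e.ok isProgVar = true)
    (h : Q (σ.setNat a (i.eval σ) (e.eval σ))) (ht : i.cost σ + e.cost σ + 3 ≤ t) :
    WP (stN a i e) t σ Q := by
  refine ⟨_, fun σ' hσ' => ?_, h⟩
  obtain ⟨t', ht', τ', hx, hv, hA, -⟩ := i.comp_exec isProgVar 60 σ' hi le_rfl
    fun _ => isProgVar_lt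
  obtain ⟨u', hu', υ', hy, hw, hB, hP⟩ := e.comp_exec isProgVar 61 τ' he (by norm_num)
    fun _ => isProgVar_lt
  obtain ⟨hc, hc'⟩ := i.eval_congr hσ' hi
  obtain ⟨hd, hd'⟩ := e.eval_congr (hσ'.trans hA) he
  refine ⟨_, ?_, _, .seq hx (.seq hy (.setNat υ' a _ _)), ?_⟩
  · simp only [NExp.cost]; omega
  · simp only [NExp.eval, hw, hd, hP 60 le_rfl (by norm_num), hv, hc]
    exact ((hσ'.trans hA).trans hB).setNat _ _ _

theorem WP.stR {a : ℕ} {i : CExp} {r : RExp} {t : ℕ} {σ : Store} {Q : Store → Prop}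
    (hi : i.ok isProgVar = true) (hr : r.ok isProgVar = true)
    (h : Q (σ.setReal a (i.eval σ) (r.eval σ))) (ht : i.cost σ + r.cost + 2 ≤ t) :
    WP (stR a i r) t σ Q := by
  refine ⟨_, fun σ' hσ' => ?_, h⟩
  obtain ⟨t', ht', τ', hx, hv, hA, -⟩ := i.comp_exec isProgVar 60 σ' hi le_rfl
    fun _ => isProgVar_lt
  obtain ⟨hc, hc'⟩ := i.eval_congr hσ' hi
  have hd := RExp.eval_congr (hσ'.trans hA) hr
  refine ⟨_, ?_, _, .seq hx (.setReal τ' a _ _), ?_⟩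
  · simp only [NExp.cost]; omega
  · simp only [NExp.eval, hd, hv, hc]
    exact (hσ'.trans hA).setReal _ _ _

theorem WP.ifX {b : CExp} {c d : Prog} {t u : ℕ} {σ : Store} {Q : Store → Prop}
    (hb : b.ok isProgVar = true) (h1 : 1 ≤ b.eval σ → WP c u σ Q)
    (h2 : ¬ 1 ≤ b.eval σ → WP d u σ Q) (ht : b.cost σ + u + 4 ≤ t) :
    WP (ifX b c d) t σ Q := by
  by_cases h : 1 ≤ b.eval σ
  · obtain ⟨υ, hr, hq⟩ := h1 h
    refine ⟨υ, fun σ' hσ' => ?_, hq⟩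
    obtain ⟨t', ht', τ', hx, hv, hA, -⟩ := b.comp_exec isProgVar 60 σ' hb le_rfl
      fun _ => isProgVar_lt
    obtain ⟨hc, hc'⟩ := b.eval_congr hσ' hb
    obtain ⟨u', hu', υ', hy, hB⟩ := hr τ' (hσ'.trans hA)
    refine ⟨_, ?_, υ', .seq hx (.iteTrue ?_ hy), hB⟩
    · simp only [BExp.cost, NExp.cost]; omega
    · simpa only [BExp.Holds, NExp.eval, hv, hc] using h
  · obtain ⟨υ, hr, hq⟩ := h2 h
    refine ⟨υ, fun σ' hσ' => ?_, hq⟩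
    obtain ⟨t', ht', τ', hx, hv, hA, -⟩ := b.comp_exec isProgVar 60 σ' hb le_rfl
      fun _ => isProgVar_lt
    obtain ⟨hc, hc'⟩ := b.eval_congr hσ' hb
    obtain ⟨u', hu', υ', hy, hB⟩ := hr τ' (hσ'.trans hA)
    refine ⟨_, ?_, υ', .seq hx (.iteFalse ?_ hy), hB⟩
    · simp only [BExp.cost, NExp.cost]; omega
    · simpa only [BExp.Holds, NExp.eval, hv, hc] using h

/-- A round consists of the test (e.cost + 5 with its branch), the body and the increment (4); the
last test and the initialization account for e.cost + 7. The body must leave the counter alone, and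
the next invariant is demanded after the increment. -/
theorem WP.forX {x : ℕ} {e : NExp} {c : Prog} {t : ℕ} {σ : Store} {Q : Store → Prop}
    (N tb : ℕ) (Inv : ℕ → Store → Prop)
    (hx : x < 40) (he : e.ok isProgVar = true) (h0 : Inv 0 (σ.setVar x 0))
    (hN : ∀ i τ, Inv i τ → τ.nvar x = i ∧ e.eval τ = N)
    (hb : ∀ i < N, ∀ τ, Inv i τ →
      WP c tb τ fun τ' => τ'.nvar x = i ∧ Inv (i + 1) (τ'.setVar x (i + 1)))
    (hQ : ∀ τ, Inv N τ → Q τ) (ht : N * (tb + e.cost + 9) + e.cost + 7 ≤ t) :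
    WP (forX x e c) t σ Q := by
  have hxV : isProgVar x = true := by simp [isProgVar, hx]
  have key : ∀ r i τ, i + r = N → Inv i τ →
      WP (.while (.nle (.add (.var x) (.lit 1)) e)
        (.seq c (.setVar x (.add (.var x) (.lit 1))))) (r * (tb + e.cost + 9) + e.cost + 5) τ
        (Inv N) := by
    intro r
    induction r with
    | zero =>
      intro i τ hi hI
      have hi' : i = N := by omega
      subst hi'
      refine ⟨τ, fun σ' hσ' => ?_, hI⟩
      refine ⟨_, ?_, σ', .whileFalse ?_, hσ'⟩
      · simp only [BExp.cost, NExp.cost]; omega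
      · simp only [BExp.Holds, NExp.eval, hσ'.1 x hxV, NExp.eval_congr hσ' he, (hN _ _ hI).1,
          (hN _ _ hI).2]
        omega
    | succ r ih =>
      intro i τ hi hI
      obtain ⟨τ₁, hr, hx1, hI1⟩ := hb i (by omega) τ hI
      obtain ⟨τ₂, hr2, hI2⟩ := ih (i + 1) _ (by omega) hI1
      refine ⟨τ₂, fun σ' hσ' => ?_, hI2⟩
      obtain ⟨t1, ht1, υ₁, hx₁, hA₁⟩ := hr σ' hσ'
      obtain ⟨t2, ht2, υ₂, hx₂, hA₂⟩ := hr2 (υ₁.setVar x (i + 1)) (hA₁.setVar _ _)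
      have hex := Exec.setVar υ₁ x (.add (.var x) (.lit 1))
      have hev : (NExp.add (.var x) (.lit 1)).eval υ₁ = i + 1 := by
        simp only [NExp.eval, hA₁.1 x hxV, hx1]
      rw [hev] at hex
      refine ⟨_, ?_, υ₂, .whileTrue ?_ (.seq hx₁ hex) hx₂, hA₂⟩
      · simp only [BExp.cost, NExp.cost]
        rw [Nat.succ_mul]; omega
      · simp only [BExp.Holds, NExp.eval, hσ'.1 x hxV, NExp.eval_congr hσ' he, (hN _ _ hI).1,
          (hN _ _ hI).2]
        omega
  obtain ⟨τ, hr, hI⟩ := key N 0 _ (by omega) h0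
  refine ⟨τ, fun σ' hσ' => ?_, hQ τ hI⟩
  obtain ⟨t', ht', τ', hx', hA⟩ := hr (σ'.setVar x 0) (hσ'.setVar _ _)
  refine ⟨_, ?_, τ', .seq (.setVar σ' x (.lit 0)) hx', hA⟩
  simp only [NExp.cost]; omega

/-! ### Memory access lemmas and frames -/

@[simp] theorem nvar_setVar (σ : Store) (x v y : ℕ) :
    (σ.setVar x v).nvar y = if y = x then v else σ.nvar y := by
  simp [Store.setVar, Function.update_apply]

@[simp] theorem narr_setVar (σ : Store) (x v : ℕ) : (σ.setVar x v).narr = σ.narr := rfl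

@[simp] theorem rarr_setVar (σ : Store) (x v : ℕ) : (σ.setVar x v).rarr = σ.rarr := rfl

@[simp] theorem nvar_setNat (σ : Store) (a i v : ℕ) : (σ.setNat a i v).nvar = σ.nvar := rfl

@[simp] theorem rarr_setNat (σ : Store) (a i v : ℕ) : (σ.setNat a i v).rarr = σ.rarr := rfl

theorem narr_setNat (σ : Store) (a i v b : ℕ) :
    (σ.setNat a i v).narr b = if b = a then Function.update (σ.narr a) i v else σ.narr b := by
  by_cases h : b = a
  · subst h; simp [Store.setNat]
  · simp [Store.setNat, h]

@[simp] theorem narr_setNat_apply (σ : Store) (a i v b j : ℕ) :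
    (σ.setNat a i v).narr b j = if b = a ∧ j = i then v else σ.narr b j := by
  by_cases h : b = a
  · subst h; simp [narr_setNat, Function.update_apply]
  · simp [narr_setNat, h]

@[simp] theorem nvar_setReal (σ : Store) (a i : ℕ) (v : ℝ) :
    (σ.setReal a i v).nvar = σ.nvar := rfl

@[simp] theorem narr_setReal (σ : Store) (a i : ℕ) (v : ℝ) :
    (σ.setReal a i v).narr = σ.narr := rfl

@[simp] theorem rarr_setReal_apply (σ : Store) (a i : ℕ) (v : ℝ) (b j : ℕ) :
    (σ.setReal a i v).rarr b j = if b = a ∧ j = i then v else σ.rarr b j := by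
  by_cases h : b = a
  · subst h; simp [Store.setReal, Function.update_apply]
  · simp [Store.setReal, h]

/-- The memories agree outside the given variables, natural-number arrays and real arrays. -/
structure Fr (v a r : List ℕ) (σ τ : Store) : Prop where
  nvar : ∀ y, y ∉ v → τ.nvar y = σ.nvar y
  narr : ∀ y, y ∉ a → τ.narr y = σ.narr y
  rarr : ∀ y, y ∉ r → τ.rarr y = σ.rarr y

theorem Fr.refl (v a r : List ℕ) (σ : Store) : Fr v a r σ σ :=
  ⟨fun _ _ => rfl, fun _ _ => rfl, fun _ _ => rfl⟩

theorem Fr.trans {v a r : List ℕ} {σ τ υ : Store} (h : Fr v a r σ τ) (h' : Fr v a r τ υ) :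
    Fr v a r σ υ :=
  ⟨fun y hy => (h'.nvar y hy).trans (h.nvar y hy), fun y hy => (h'.narr y hy).trans (h.narr y hy),
    fun y hy => (h'.rarr y hy).trans (h.rarr y hy)⟩

theorem Fr.mono {v a r v' a' r' : List ℕ} {σ τ : Store} (h : Fr v a r σ τ) (hv : v ⊆ v')
    (ha : a ⊆ a') (hr : r ⊆ r') : Fr v' a' r' σ τ :=
  ⟨fun y hy => h.nvar y fun h => hy (hv h), fun y hy => h.narr y fun h => hy (ha h),
    fun y hy => h.rarr y fun h => hy (hr h)⟩

theorem Fr.setVar {v a r : List ℕ} {σ τ : Store} (h : Fr v a r σ τ) {x : ℕ} (hx : x ∈ v)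
    (k : ℕ) : Fr v a r σ (τ.setVar x k) := by
  refine ⟨fun y hy => ?_, h.narr, h.rarr⟩
  have : y ≠ x := by rintro rfl; exact hy hx
  simpa [this] using h.nvar y hy

theorem Fr.setNat {v a r : List ℕ} {σ τ : Store} (h : Fr v a r σ τ) {x : ℕ} (hx : x ∈ a)
    (i k : ℕ) : Fr v a r σ (τ.setNat x i k) := by
  refine ⟨h.nvar, fun y hy => ?_, h.rarr⟩
  have : y ≠ x := by rintro rfl; exact hy hx
  simpa [narr_setNat, this] using h.narr y hy

theorem Fr.setReal {v a r : List ℕ} {σ τ : Store} (h : Fr v a r σ τ) {x : ℕ} (hx : x ∈ r)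
    (i : ℕ) (k : ℝ) : Fr v a r σ (τ.setReal x i k) := by
  refine ⟨h.nvar, h.narr, fun y hy => ?_⟩
  have : y ≠ x := by rintro rfl; exact hy hx
  simpa [Store.setReal, this] using h.rarr y hy

/-! ### Derived expressions -/

namespace CExp

/-- Strict inequality. -/
def lt (e f : CExp) : CExp := .le (.add e (.lit 1)) f

/-- Conjunction. -/
def and (b c : CExp) : CExp := .ite b c (.lit 0)

/-- Negation. -/
def not (b : CExp) : CExp := .le b (.lit 0)

/-- Equality. -/
def eq (e f : CExp) : CExp := .and (.le e f) (.le f e)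

@[simp] theorem eval_lit (k : ℕ) (σ : Store) : (lit k).eval σ = k := rfl
@[simp] theorem eval_var (k : ℕ) (σ : Store) : (var k).eval σ = σ.nvar k := rfl
@[simp] theorem eval_get (a : ℕ) (e : CExp) (σ : Store) :
    (get a e).eval σ = σ.narr a (e.eval σ) := rfl
@[simp] theorem eval_add (e f : CExp) (σ : Store) :
    (add e f).eval σ = e.eval σ + f.eval σ := rfl
@[simp] theorem eval_sub (e f : CExp) (σ : Store) :
    (sub e f).eval σ = e.eval σ - f.eval σ := rfl
@[simp] theorem eval_sum (x : ℕ) (e f : CExp) (σ : Store) :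
    (sum x e f).eval σ = ∑ i ∈ Finset.range (e.eval σ), f.eval (σ.setVar x i) := rfl

open Classical in
@[simp] theorem eval_le (e f : CExp) (σ : Store) :
    (le e f).eval σ = if e.eval σ ≤ f.eval σ then 1 else 0 := by
  simp only [eval]

open Classical in
@[simp] theorem eval_rle (e f : RExp) (σ : Store) :
    (rle e f).eval σ = if e.eval σ ≤ f.eval σ then 1 else 0 := rfl

open Classical in
@[simp] theorem eval_ite (b e f : CExp) (σ : Store) :
    (ite b e f).eval σ = if 1 ≤ b.eval σ then e.eval σ else f.eval σ := by
  simp only [eval]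

open Classical in
@[simp] theorem eval_lt (e f : CExp) (σ : Store) :
    (lt e f).eval σ = if e.eval σ < f.eval σ then 1 else 0 := by
  simp only [lt, eval_le, eval_add, eval_lit, Nat.succ_le_iff]

open Classical in
@[simp] theorem eval_and (b c : CExp) (σ : Store) :
    (and b c).eval σ = if 1 ≤ b.eval σ then c.eval σ else 0 := by
  simp only [and, eval_ite, eval_lit]

open Classical in
@[simp] theorem eval_not (b : CExp) (σ : Store) :
    (not b).eval σ = if 1 ≤ b.eval σ then 0 else 1 := by
  by_cases h : 1 ≤ b.eval σ
  · have h2 : ¬ b.eval σ ≤ (lit 0).eval σ := by rw [eval_lit]; omega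
    rw [not, eval_le, if_neg h2, if_pos h]
  · have h2 : b.eval σ ≤ (lit 0).eval σ := by rw [eval_lit]; omega
    rw [not, eval_le, if_pos h2, if_neg h]

open Classical in
@[simp] theorem eval_eq (e f : CExp) (σ : Store) :
    (eq e f).eval σ = if e.eval σ = f.eval σ then 1 else 0 := by
  simp only [eq, eval_and, eval_le]
  split_ifs <;> omega

@[simp] theorem one_le_ite {P : Prop} [Decidable P] :
    1 ≤ (if P then 1 else 0) ↔ P := by split_ifs <;> simp_all

@[simp] theorem one_le_ite_and {P : Prop} [Decidable P] {k : ℕ} :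
    1 ≤ (if P then k else 0) ↔ P ∧ 1 ≤ k := by split_ifs <;> simp_all

end CExp

/-- A loop that fills a natural-number array with values that do not depend on that array. -/
theorem WP.mapN {a x : ℕ} {e : CExp} {b : NExp} {t : ℕ} {σ : Store} {Q : Store → Prop}
    (N tb : ℕ) (f : ℕ → ℕ) (hx : x < 40) (hb : b.ok isProgVar = true)
    (he : e.ok isProgVar = true)
    (hN : ∀ τ, Fr [x] [a] [] σ τ → b.eval τ = N)
    (hf : ∀ τ, Fr [x] [a] [] σ τ → ∀ k < N, τ.nvar x = k → e.eval τ = f k ∧ e.cost τ ≤ tb)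
    (hQ : ∀ τ, Fr [x] [a] [] σ τ → (∀ k < N, τ.narr a k = f k) → Q τ)
    (ht : N * (tb + b.cost + 14) + b.cost + 7 ≤ t) :
    WP (RealRAM.forX x b (RealRAM.stN a (.var x) e)) t σ Q := by
  refine WP.forX N (tb + 5) (fun i τ => Fr [x] [a] [] σ τ ∧ τ.nvar x = i ∧
    ∀ k < i, τ.narr a k = f k) hx hb ⟨(Fr.refl ..).setVar (by simp) _, by simp, by simp⟩
    (fun i τ h => ⟨h.2.1, hN τ h.1⟩) ?_ (fun τ h => hQ τ h.1 h.2.2) (by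
      have : tb + 5 + b.cost + 9 = tb + b.cost + 14 := by omega
      rw [this]; exact ht)
  rintro i hi τ ⟨hF, hxi, hk⟩
  obtain ⟨hv, hc⟩ := hf τ hF i hi hxi
  refine WP.stN (by simpa [CExp.ok, isProgVar] using hx) he ?_ ?_
  · refine ⟨by simpa using hxi, ((hF.setNat (by simp) _ _).setVar (by simp) _), by simp, ?_⟩
    intro k hki
    simp only [CExp.eval_var, narr_setVar, narr_setNat_apply, true_and, hxi, hv]
    split_ifs with h
    · rw [h]
    · exact hk k (by omega)
  · simp only [CExp.cost]; omega

end RealRAM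

/-! ### Hitting gaps and points -/

namespace DiscCode

open Finset

/-- The number of points to the left of `x`. -/
noncomputable def cntLt (n : ℕ) (q : ℕ → ℝ) (x : ℝ) : ℕ := #{i ∈ range n | q i < x}

/-- The number of points up to `x`. -/
noncomputable def cntLe (n : ℕ) (q : ℕ → ℝ) (x : ℝ) : ℕ := #{i ∈ range n | q i ≤ x}

theorem cntLt_mono (n : ℕ) (q : ℕ → ℝ) {x y : ℝ} (h : x ≤ y) : cntLt n q x ≤ cntLt n q y :=
  card_le_card fun i hi => by
    simp only [mem_filter] at hi ⊢; exact ⟨hi.1, hi.2.trans_le h⟩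

theorem cntLe_mono (n : ℕ) (q : ℕ → ℝ) {x y : ℝ} (h : x ≤ y) : cntLe n q x ≤ cntLe n q y :=
  card_le_card fun i hi => by
    simp only [mem_filter] at hi ⊢; exact ⟨hi.1, hi.2.trans h⟩

theorem cntLt_le_cntLe (n : ℕ) (q : ℕ → ℝ) {x y : ℝ} (h : x ≤ y) : cntLt n q x ≤ cntLe n q y :=
  card_le_card fun i hi => by
    simp only [mem_filter] at hi ⊢; exact ⟨hi.1, (hi.2.trans_le h).le⟩

theorem cntLe_le (n : ℕ) (q : ℕ → ℝ) (x : ℝ) : cntLe n q x ≤ n :=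
  (card_filter_le _ _).trans (card_range n).le

theorem cntLt_le (n : ℕ) (q : ℕ → ℝ) (x : ℝ) : cntLt n q x ≤ n :=
  (card_filter_le _ _).trans (card_range n).le

/-- The interval `k` has an endpoint in the gap `g`. -/
def HitG (U V : ℕ → ℕ) (k g : ℕ) : Prop := U k = g ∨ V k = g

/-- The interval `k` contains the point `i`. -/
def HitP (U V : ℕ → ℕ) (k i : ℕ) : Prop := U k ≤ i ∧ i < V k

/-- The intervals in `R` hit all gaps and points that those in `B` hit. -/
def Covers (U V : ℕ → ℕ) (R B : Finset ℕ) : Prop :=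
  (∀ k ∈ B, ∀ g, HitG U V k g → ∃ k' ∈ R, HitG U V k' g) ∧
    ∀ k ∈ B, ∀ i, HitP U V k i → ∃ k' ∈ R, HitP U V k' i

theorem Covers.refl (U V : ℕ → ℕ) (B : Finset ℕ) : Covers U V B B :=
  ⟨fun k hk _ h => ⟨k, hk, h⟩, fun k hk _ h => ⟨k, hk, h⟩⟩

/-- A partial solution can be completed by one interval for each missed gap. -/
theorem exists_covers_of_missed {U V : ℕ → ℕ} {R B D Q : Finset ℕ} (hR : R ⊆ B) (hQ : Q ⊆ B)
    (hG : ∀ k ∈ B, ∀ g, HitG U V k g → (∃ k' ∈ R, HitG U V k' g) ∨ g ∈ D)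
    (hP : ∀ k ∈ B, ∀ i, HitP U V k i → (∃ k' ∈ R, HitP U V k' i) ∨ ∃ k' ∈ Q, HitP U V k' i) :
    ∃ T ⊆ B, Covers U V T B ∧ #T ≤ #R + #D + #Q := by
  classical
  have hc : ∀ g, ∃ k, (∃ k' ∈ B, HitG U V k' g) → k ∈ B ∧ HitG U V k g := by
    intro g
    by_cases h : ∃ k' ∈ B, HitG U V k' g
    · obtain ⟨k, hk, hg⟩ := h; exact ⟨k, fun _ => ⟨hk, hg⟩⟩
    -- A dummy value for gaps that no member of B hits; such gaps are filtered out below.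
    · exact ⟨0, fun h' => absurd h' h⟩
  choose f hf using hc
  refine ⟨R ∪ ({g ∈ D | ∃ k' ∈ B, HitG U V k' g}.image f) ∪ Q, ?_, ⟨?_, ?_⟩, ?_⟩
  · refine union_subset (union_subset hR ?_) hQ
    intro k hk
    simp only [mem_image, mem_filter] at hk
    obtain ⟨g, ⟨-, hg⟩, rfl⟩ := hk
    exact (hf g hg).1
  · intro k hk g hg
    rcases hG k hk g hg with ⟨k', hk', h⟩ | h
    · exact ⟨k', by simp [hk'], h⟩
    · have hex : ∃ k' ∈ B, HitG U V k' g := ⟨k, hk, hg⟩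
      exact ⟨f g, mem_union_left _ (mem_union_right _
        (mem_image_of_mem f (mem_filter.2 ⟨h, hex⟩))), (hf g hex).2⟩
  · intro k hk i hi
    rcases hP k hk i hi with ⟨k', hk', h⟩ | ⟨k', hk', h⟩
    · exact ⟨k', by simp [hk'], h⟩
    · exact ⟨k', by simp [hk'], h⟩
  · refine (card_union_le _ _).trans (Nat.add_le_add_right ((card_union_le _ _).trans ?_) _)
    exact Nat.add_le_add_left (card_image_le.trans (card_filter_le _ _)) _

/-! ### Windows of length one -/

section Partition

/-- The combinatorial data of the approximation: intervals `k ∈ E` with left endpoints `X k`,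
grouped into windows `w k` of length one with left endpoints `A (w k)`. -/
structure Windowing (n : ℕ) (q : ℕ → ℝ) (E : Finset ℕ) (X : ℕ → ℝ) (U V w : ℕ → ℕ)
    (A : ℕ → ℝ) : Prop where
  le_succ : ∀ x, cntLe n q x ≤ cntLt n q x + 1
  U_eq : ∀ k ∈ E, U k = cntLt n q (X k)
  V_eq : ∀ k ∈ E, V k = cntLe n q (X k + 1)
  A_le : ∀ k ∈ E, A (w k) ≤ X k
  lt_A : ∀ k ∈ E, X k < A (w k) + 1
  A_step : ∀ k ∈ E, ∀ k' ∈ E, w k < w k' → A (w k') = A (w k) + 1 ∨ A (w k) + 2 ≤ A (w k')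
  contig : ∀ b, (∃ k ∈ E, w k < b) → (∃ k ∈ E, b ≤ w k) → ∃ k ∈ E, w k = b

variable {n : ℕ} {q : ℕ → ℝ} {E : Finset ℕ} {X : ℕ → ℝ} {U V w : ℕ → ℕ} {A : ℕ → ℝ}

namespace Windowing

theorem A_lt (H : Windowing n q E X U V w A) {k k' : ℕ} (hk : k ∈ E) (hk' : k' ∈ E)
    (h : w k < w k') : A (w k) + 1 ≤ A (w k') := by
  rcases H.A_step k hk k' hk' h with h | h <;> linarith

theorem X_lt (H : Windowing n q E X U V w A) {k k' : ℕ} (hk : k ∈ E) (hk' : k' ∈ E)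
    (h : w k < w k') : X k < X k' :=
  (H.lt_A k hk).trans_le ((H.A_lt hk hk' h).trans (H.A_le k' hk'))

theorem U_mono (H : Windowing n q E X U V w A) {k k' : ℕ} (hk : k ∈ E) (hk' : k' ∈ E)
    (h : X k ≤ X k') : U k ≤ U k' := by
  rw [H.U_eq k hk, H.U_eq k' hk']; exact cntLt_mono _ _ h

theorem V_mono (H : Windowing n q E X U V w A) {k k' : ℕ} (hk : k ∈ E) (hk' : k' ∈ E)
    (h : X k ≤ X k') : V k ≤ V k' := by
  rw [H.V_eq k hk, H.V_eq k' hk']; exact cntLe_mono _ _ (by linarith)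

/-- An endpoint that coincides with a point adjoins two gaps, `cntLt` and `cntLe` there. A left
endpoint is assigned the lower and a right endpoint the upper one; the weaker two-sided bound treats
both alike. -/
theorem exists_endpoint (H : Windowing n q E X U V w A) {k g : ℕ} (hk : k ∈ E)
    (h : HitG U V k g) :
    ∃ i : ℝ, (i = 0 ∨ i = 1) ∧ cntLt n q (X k + i) ≤ g ∧ g ≤ cntLe n q (X k + i) := by
  rcases h with h | h
  · refine ⟨0, .inl rfl, ?_, ?_⟩ <;> rw [← h, H.U_eq k hk, add_zero]
    exact cntLt_le_cntLe _ _ le_rfl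
  · refine ⟨1, .inr rfl, ?_, ?_⟩ <;> rw [← h, H.V_eq k hk]
    exact cntLt_le_cntLe _ _ le_rfl

/-- A gap with endpoints on both sides of `z` is a gap at `z`. -/
theorem eq_or_eq_of_between (H : Windowing n q E X U V w A) {g : ℕ} {α β z : ℝ} (hα : α ≤ z)
    (hβ : z ≤ β) (h1 : g ≤ cntLe n q α) (h2 : cntLt n q β ≤ g) :
    g = cntLt n q z ∨ g = cntLe n q z := by
  have h3 := cntLe_mono n q hα
  have h4 := cntLt_mono n q hβ
  have h5 := H.le_succ z
  omega

/-- Both endpoints of an interval before window b lie left of A b + 1. An endpoint of an interval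
from window b on lies right of A b + 1, so that the shared gap adjoins A b + 1, unless it is a left
endpoint inside window b; the gap then belongs to the image under U. -/
theorem mem_cut (H : Windowing n q E X U V w A) {b k₀ k k' g : ℕ} (hk₀ : k₀ ∈ E)
    (hb : w k₀ = b) (hk : k ∈ E) (hk' : k' ∈ E) (hkb : w k < b) (hbk : b ≤ w k')
    (hg : HitG U V k g) (hg' : HitG U V k' g) :
    g ∈ [cntLt n q (A b + 1), cntLe n q (A b + 1)].toFinset ∪ {k ∈ E | w k = b}.image U := by
  subst hb
  have hz : X k < A (w k₀) := (H.lt_A k hk).trans_le (H.A_lt hk hk₀ hkb)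
  have hz' : A (w k₀) ≤ X k' := by
    rcases hbk.eq_or_lt with h | h
    · rw [h]; exact H.A_le k' hk'
    · linarith [H.A_lt hk₀ hk' h, H.A_le k' hk']
  obtain ⟨i, hi, h1, h2⟩ := H.exists_endpoint hk hg
  simp only [mem_union, List.mem_toFinset, List.mem_cons, List.not_mem_nil, or_false, mem_image,
    mem_filter]
  have hi1 : i ≤ 1 := by rcases hi with rfl | rfl <;> norm_num
  rcases hg' with h | h
  · by_cases hA : A (w k₀) + 1 ≤ X k'
    · left
      exact H.eq_or_eq_of_between (by linarith) hA h2 (by rw [← h, H.U_eq k' hk'])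
    · right
      refine ⟨k', ⟨hk', ?_⟩, h⟩
      by_contra hne
      have hlt : w k₀ < w k' := lt_of_le_of_ne hbk (Ne.symm hne)
      linarith [H.A_lt hk₀ hk' hlt, H.A_le k' hk']
  · left
    refine H.eq_or_eq_of_between (by linarith) (β := X k' + 1) (by linarith) h2 ?_
    rw [← h, H.V_eq k' hk']; exact cntLt_le_cntLe _ _ le_rfl

/-! ### Cutting at the boundaries of pieces -/

/-- The piece of an interval: `L` consecutive windows, with offset `s`. -/
def piece (w : ℕ → ℕ) (L s k : ℕ) : ℕ := (w k + (L - s)) / L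

/-- The intervals in the first window of the piece `t`. -/
def cut (E : Finset ℕ) (w : ℕ → ℕ) (L s t : ℕ) : Finset ℕ :=
  {k ∈ E | w k % L = s ∧ piece w L s k = t}

theorem lt_of_piece_lt {L s k k' : ℕ} (h : piece w L s k < piece w L s k') : w k < w k' := by
  by_contra hle
  have : piece w L s k' ≤ piece w L s k := Nat.div_le_div_right (by omega)
  omega

/-- By `mem_cut` a boundary is responsible for at most two gaps plus one per interval of the window
after it. That window is nonempty when there are intervals on both sides, so the two extra gaps are
absorbed in the factor 3. If one side is empty, nothing is shared and D is empty. -/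
theorem exists_cut_gaps (H : Windowing n q E X U V w A) {L s : ℕ} (hs : s < L) (t : ℕ) :
    ∃ D : Finset ℕ, #D ≤ 3 * #(cut E w L s t) ∧ ∀ k ∈ E, ∀ k' ∈ E, piece w L s k < t →
      t ≤ piece w L s k' → 1 ≤ #(cut E w L s t) ∧
        ∀ g, HitG U V k g → HitG U V k' g → g ∈ D := by
  have hL : 0 < L := by omega
  by_cases hex : (∃ k ∈ E, piece w L s k < t) ∧ ∃ k ∈ E, t ≤ piece w L s k
  · obtain ⟨⟨k₁, hk₁, ht₁⟩, k₂, hk₂, ht₂⟩ := hex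
    obtain ⟨t, rfl⟩ : ∃ t', t = t' + 1 := ⟨t - 1, by omega⟩
    have hlt : ∀ k, piece w L s k < t + 1 ↔ w k < t * L + s := by
      intro k
      rw [piece, Nat.div_lt_iff_lt_mul hL, Nat.succ_mul]; omega
    -- The first window of the piece t + 1 has the number t * L + s; it is nonempty because occupied
    -- window numbers form a contiguous range.
    obtain ⟨k₀, hk₀, hw₀⟩ := H.contig (t * L + s) ⟨k₁, hk₁, (hlt _).1 ht₁⟩
      ⟨k₂, hk₂, by by_contra h; exact absurd ((hlt k₂).2 (by omega)) (by omega)⟩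
    have hsub : {k ∈ E | w k = t * L + s} ⊆ cut E w L s (t + 1) := by
      intro k hk
      simp only [mem_filter, cut] at hk ⊢
      refine ⟨hk.1, ?_, ?_⟩
      · rw [hk.2, mul_comm, Nat.mul_add_mod, Nat.mod_eq_of_lt hs]
      · rw [piece, hk.2, show t * L + s + (L - s) = (t + 1) * L by rw [Nat.succ_mul]; omega,
          Nat.mul_div_cancel _ hL]
    have hpos : 1 ≤ #{k ∈ E | w k = t * L + s} :=
      card_pos.2 ⟨k₀, by simp [hk₀, hw₀]⟩
    have hcard := card_le_card hsub
    refine ⟨_, ?_, fun k hk k' hk' h h' => ⟨by omega, fun g hg hg' =>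
      H.mem_cut hk₀ hw₀ hk hk' ((hlt k).1 h) ?_ hg hg'⟩⟩
    · refine (card_union_le _ _).trans ?_
      have h1 := List.toFinset_card_le
        [cntLt n q (A (t * L + s) + 1), cntLe n q (A (t * L + s) + 1)]
      have h2 := card_image_le (s := {k ∈ E | w k = t * L + s}) (f := U)
      simp only [List.length_cons, List.length_nil] at h1
      omega
    · by_contra hc; exact absurd ((hlt k').2 (by omega)) (by omega)
  · refine ⟨∅, by simp, fun k hk k' hk' h h' => ?_⟩
    exact absurd ⟨⟨k, hk, h⟩, k', hk', h'⟩ hex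

/-- Restricting a solution to a piece. -/
theorem exists_piece_covers (H : Windowing n q E X U V w A) {L s : ℕ} (hs : s < L)
    {T : Finset ℕ} (hTE : T ⊆ E) (hT : Covers U V T E) (t : ℕ) :
    ∃ R ⊆ {k ∈ E | piece w L s k = t}, Covers U V R {k ∈ E | piece w L s k = t} ∧
      #R ≤ #{k ∈ T | piece w L s k = t} + 4 * #(cut E w L s t) + 4 * #(cut E w L s (t + 1)) := by
  classical
  rcases ({k ∈ E | piece w L s k = t} : Finset ℕ).eq_empty_or_nonempty with he | hne
  · rw [he]; exact ⟨∅, le_rfl, Covers.refl _ _ _, by simp⟩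
  obtain ⟨D₁, hD₁, h₁⟩ := H.exists_cut_gaps hs t
  obtain ⟨D₂, hD₂, h₂⟩ := H.exists_cut_gaps hs (t + 1)
  obtain ⟨k₁, hk₁, hmin⟩ := exists_min_image _ X hne
  obtain ⟨k₂, hk₂, hmax⟩ := exists_max_image _ X hne
  set F : Finset ℕ := {k ∈ E | piece w L s k = t} with hF
  have hFE : F ⊆ E := filter_subset _ _
  -- The leftmost interval of the piece covers every point shared with earlier pieces, and the
  -- rightmost one every point shared with later pieces. Each is charged to a nonempty first window,
  -- hence 3 + 1 = 4 in the conclusion.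
  have hQ₁ : ∃ Q ⊆ F, #Q ≤ #(cut E w L s t) ∧
      ((∃ k ∈ E, piece w L s k < t) → k₁ ∈ Q) := by
    by_cases h : ∃ k ∈ E, piece w L s k < t
    · obtain ⟨k, hk, hkt⟩ := h
      refine ⟨{k₁}, by simpa using hk₁, ?_, by simp⟩
      simpa using (h₁ k hk k₁ (hFE hk₁) hkt (mem_filter.1 hk₁).2.ge).1
    · exact ⟨∅, by simp, by simp, fun h' => absurd h' h⟩
  have hQ₂ : ∃ Q ⊆ F, #Q ≤ #(cut E w L s (t + 1)) ∧
      ((∃ k ∈ E, t < piece w L s k) → k₂ ∈ Q) := by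
    by_cases h : ∃ k ∈ E, t < piece w L s k
    · obtain ⟨k, hk, hkt⟩ := h
      refine ⟨{k₂}, by simpa using hk₂, ?_, by simp⟩
      simpa using (h₂ k₂ (hFE hk₂) k hk (by rw [(mem_filter.1 hk₂).2]; omega) hkt).1
    · exact ⟨∅, by simp, by simp, fun h' => absurd h' h⟩
  obtain ⟨Q₁, hQ₁F, hQ₁c, hQ₁⟩ := hQ₁
  obtain ⟨Q₂, hQ₂F, hQ₂c, hQ₂⟩ := hQ₂
  obtain ⟨R, hRF, hR, hRc⟩ := exists_covers_of_missed (U := U) (V := V)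
    (R := {k ∈ T | piece w L s k = t}) (B := F) (D := D₁ ∪ D₂) (Q := Q₁ ∪ Q₂)
    (filter_subset_filter _ hTE) (union_subset hQ₁F hQ₂F) (by
      intro k hk g hg
      have hkt := (mem_filter.1 hk).2
      obtain ⟨k', hk', hg'⟩ := hT.1 k (hFE hk) g hg
      rcases lt_trichotomy (piece w L s k') t with h | h | h
      · exact .inr (mem_union_left _ ((h₁ k' (hTE hk') k (hFE hk) h hkt.ge).2 g hg' hg))
      · exact .inl ⟨k', mem_filter.2 ⟨hk', h⟩, hg'⟩
      · exact .inr (mem_union_right _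
          ((h₂ k (hFE hk) k' (hTE hk') (by omega) h).2 g hg hg'))) (by
      intro k hk i hi
      have hkt := (mem_filter.1 hk).2
      obtain ⟨k', hk', hi'⟩ := hT.2 k (hFE hk) i hi
      rcases lt_trichotomy (piece w L s k') t with h | h | h
      · refine .inr ⟨k₁, mem_union_left _ (hQ₁ ⟨k', hTE hk', h⟩), ?_⟩
        -- The point is not left of k, hence not left of the leftmost interval k₁. It lies in k',
        -- which starts before k₁ and therefore also ends no later.
        have hX := H.X_lt (hTE hk') (hFE hk₁) (lt_of_piece_lt (L := L) (s := s)
          (by rw [(mem_filter.1 hk₁).2]; exact h))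
        exact ⟨(H.U_mono (hFE hk₁) (hFE hk) (hmin k hk)).trans hi.1,
          hi'.2.trans_le (H.V_mono (hTE hk') (hFE hk₁) hX.le)⟩
      · exact .inl ⟨k', mem_filter.2 ⟨hk', h⟩, hi'⟩
      · refine .inr ⟨k₂, mem_union_right _ (hQ₂ ⟨k', hTE hk', h⟩), ?_⟩
        have hX := H.X_lt (hFE hk₂) (hTE hk') (lt_of_piece_lt (L := L) (s := s)
          (by rw [(mem_filter.1 hk₂).2]; exact h))
        exact ⟨(H.U_mono (hFE hk₂) (hTE hk') hX.le).trans hi'.1,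
          hi.2.trans_le (H.V_mono (hFE hk) (hFE hk₂) (hmax k hk))⟩)
  refine ⟨R, hRF, hR, hRc.trans ?_⟩
  have h3 := card_union_le D₁ D₂
  have h4 := card_union_le Q₁ Q₂
  omega

/-! ### Cutting a piece into blocks by residue -/

/-- The position of an interval within its window. -/
def residue (X A : ℕ → ℝ) (w : ℕ → ℕ) (k : ℕ) : ℝ := X k - A (w k)

/-- The rank of an interval in `F` by residue. -/
noncomputable def rank (F : Finset ℕ) (ρ : ℕ → ℝ) (k : ℕ) : ℕ :=
  #{k' ∈ F | ρ k' < ρ k ∨ ρ k' ≤ ρ k ∧ k' < k}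

theorem rank_lt {F : Finset ℕ} {ρ : ℕ → ℝ} {k k' : ℕ} (hk' : k' ∈ F)
    (h : ρ k' < ρ k ∨ ρ k' ≤ ρ k ∧ k' < k) : rank F ρ k' < rank F ρ k := by
  refine card_lt_card (ssubset_iff_of_subset ?_ |>.2 ⟨k', by simp [hk', h], by simp⟩)
  intro x hx
  simp only [mem_filter] at hx ⊢
  refine ⟨hx.1, ?_⟩
  rcases hx.2 with h1 | ⟨h1, h1'⟩ <;> rcases h with h2 | ⟨h2, h2'⟩
  · exact .inl (h1.trans h2)
  · exact .inl (h1.trans_le h2)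
  · exact .inl (h1.trans_lt h2)
  · exact .inr ⟨h1.trans h2, h1'.trans h2'⟩

theorem rank_le_of_rank_le {F : Finset ℕ} {ρ : ℕ → ℝ} {k k' : ℕ} (hk : k ∈ F)
    (h : rank F ρ k' ≤ rank F ρ k) : ρ k' ≤ ρ k := by
  by_contra hlt
  exact absurd (rank_lt hk (.inl (not_le.1 hlt))) (by omega)

theorem rank_injOn (F : Finset ℕ) (ρ : ℕ → ℝ) : Set.InjOn (rank F ρ) F := by
  intro k hk k' hk' h
  by_contra hne
  rcases lt_or_gt_of_ne hne with hlt | hlt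
  · have h1 := rank_le_of_rank_le (ρ := ρ) hk' h.le
    exact absurd (rank_lt hk (.inr ⟨h1, hlt⟩)) (by omega)
  · have h1 := rank_le_of_rank_le (ρ := ρ) hk h.ge
    exact absurd (rank_lt hk' (.inr ⟨h1, hlt⟩)) (by omega)

theorem rank_lt_card {F : Finset ℕ} {ρ : ℕ → ℝ} {k : ℕ} (hk : k ∈ F) : rank F ρ k < #F :=
  card_lt_card (ssubset_iff_of_subset (filter_subset _ _) |>.2 ⟨k, hk, by simp⟩)

theorem card_chunk_le (F : Finset ℕ) (ρ : ℕ → ℝ) {W : ℕ} (hW : 0 < W) (c : ℕ) :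
    #{k ∈ F | rank F ρ k / W = c} ≤ W := by
  have : #(Ico (c * W) (c * W + W)) = W := by simp
  refine le_trans ?_ this.le
  refine card_le_card_of_injOn (rank F ρ) ?_ ((rank_injOn F ρ).mono (filter_subset _ _))
  intro k hk
  have h := (mem_filter.1 hk).2
  rw [Nat.div_eq_iff hW] at h
  simp only [coe_Ico, Set.mem_Ico]
  omega

/-- Intervals of one window overlap pairwise, as their left endpoints differ by less than one. So
the union of the leftmost and the rightmost of them has no hole and contains all the others. -/
theorem exists_window_points (H : Windowing n q E X U V w A) {B : Finset ℕ} (hBE : B ⊆ E)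
    (b : ℕ) : ∃ Q ⊆ B, #Q ≤ 2 ∧ ∀ k ∈ B, w k = b → ∀ i, HitP U V k i → ∃ k' ∈ Q, HitP U V k' i := by
  rcases ({k ∈ B | w k = b} : Finset ℕ).eq_empty_or_nonempty with he | hne
  · refine ⟨∅, by simp, by simp, fun k hk hb => ?_⟩
    have : k ∈ ({k ∈ B | w k = b} : Finset ℕ) := by simp [hk, hb]
    simp [he] at this
  obtain ⟨k₁, hk₁, hmin⟩ := exists_min_image _ X hne
  obtain ⟨k₂, hk₂, hmax⟩ := exists_max_image _ X hne
  simp only [mem_filter] at hk₁ hk₂ hmin hmax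
  refine ⟨{k₁, k₂}, ?_, card_le_two, ?_⟩
  · intro x hx
    simp only [mem_insert, mem_singleton] at hx
    rcases hx with rfl | rfl
    · exact hk₁.1
    · exact hk₂.1
  · intro k hk hb i hi
    by_cases h : i < V k₁
    · exact ⟨k₁, by simp, (H.U_mono (hBE hk₁.1) (hBE hk) (hmin k ⟨hk, hb⟩)).trans hi.1, h⟩
    · refine ⟨k₂, by simp, le_trans ?_ (not_lt.1 h),
        hi.2.trans_le (H.V_mono (hBE hk) (hBE hk₂.1) (hmax k ⟨hk, hb⟩))⟩
      rw [H.U_eq _ (hBE hk₂.1), H.V_eq _ (hBE hk₁.1)]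
      refine cntLt_le_cntLe _ _ ?_
      have h1 := H.A_le k₁ (hBE hk₁.1)
      have h2 := H.lt_A k₂ (hBE hk₂.1)
      rw [hk₁.2] at h1
      rw [hk₂.2] at h2
      linarith

/-- A gap shared by two intervals whose residues are separated by `r` is a gap at one of the
points of residue zero or `r`. -/
theorem shared_gap (H : Windowing n q E X U V w A) {k k' g : ℕ} {r : ℝ} (hk : k ∈ E)
    (hk' : k' ∈ E) (hr : residue X A w k ≤ r) (hr' : r ≤ residue X A w k')
    (hg : HitG U V k g) (hg' : HitG U V k' g) :
    ∃ b ∈ ({w k, w k'} : Finset ℕ), ∃ z ∈ [A b, A b + 1, A b + r, A b + 1 + r],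
      g = cntLt n q z ∨ g = cntLe n q z := by
  simp only [residue] at hr hr'
  obtain ⟨i, hi, h1, h2⟩ := H.exists_endpoint hk hg
  obtain ⟨j, hj, h3, h4⟩ := H.exists_endpoint hk' hg'
  have e1 := H.A_le k hk
  have e2 := H.lt_A k hk
  have e3 := H.A_le k' hk'
  have e4 := H.lt_A k' hk'
  -- An endpoint is a base A (w k) + i, with i = 0 or 1, plus a residue in [0, 1). Two bases are
  -- equal or at least one apart, because left ends of windows differ by exactly one or by at least
  -- two. Equal bases leave base + r between the two endpoints; otherwise the larger base lies
  -- between them.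
  have hdist : A (w k) + i = A (w k') + j ∨ A (w k) + i + 1 ≤ A (w k') + j ∨
      A (w k') + j + 1 ≤ A (w k) + i := by
    rcases lt_trichotomy (w k) (w k') with h | h | h
    · rcases H.A_step k hk k' hk' h with h' | h' <;> rcases hi with rfl | rfl <;>
        rcases hj with rfl | rfl <;> first | (left; linarith) | (right; left; linarith)
    · rw [h]
      rcases hi with rfl | rfl <;> rcases hj with rfl | rfl <;>
        first | exact .inl rfl | exact .inr (.inl (by linarith)) | exact .inr (.inr (by linarith))
    · rcases H.A_step k' hk' k hk h with h' | h' <;> rcases hi with rfl | rfl <;>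
        rcases hj with rfl | rfl <;>
        first | (left; linarith) | (right; left; linarith) | (right; right; linarith)
  have mem0 : ∀ (b : ℕ) (i : ℝ), i = 0 ∨ i = 1 → A b + i ∈ [A b, A b + 1, A b + r, A b + 1 + r] := by
    rintro b i (rfl | rfl) <;> simp
  have memr : ∀ (b : ℕ) (i : ℝ), i = 0 ∨ i = 1 →
      A b + i + r ∈ [A b, A b + 1, A b + r, A b + 1 + r] := by
    rintro b i (rfl | rfl) <;> simp
  rcases hdist with h | h | h
  · exact ⟨w k, by simp, _, memr _ i hi,
      H.eq_or_eq_of_between (by linarith) (by linarith) h2 h3⟩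
  · exact ⟨w k', by simp, _, mem0 _ j hj,
      H.eq_or_eq_of_between (by linarith) (by linarith) h2 h3⟩
  · exact ⟨w k, by simp, _, mem0 _ i hi,
      H.eq_or_eq_of_between (by linarith) (by linarith) h4 h1⟩

/-- Restricting a solution of a piece to a chunk. -/
theorem exists_chunk_covers (H : Windowing n q E X U V w A) {F R : Finset ℕ} (hF : F ⊆ E)
    (hRF : R ⊆ F) (hR : Covers U V R F) (W c : ℕ) :
    ∃ T ⊆ {k ∈ F | rank F (residue X A w) k / W = c},
      Covers U V T {k ∈ F | rank F (residue X A w) k / W = c} ∧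
      #T ≤ #{k ∈ R | rank F (residue X A w) k / W = c} + 18 * #(F.image w) := by
  set ρ := residue X A w with hρ
  set B : Finset ℕ := {k ∈ F | rank F ρ k / W = c} with hB
  have hBF : B ⊆ F := filter_subset _ _
  rcases B.eq_empty_or_nonempty with he | hne
  · rw [he]; exact ⟨∅, le_rfl, Covers.refl _ _ _, by simp⟩
  obtain ⟨k₁, hk₁, hmin⟩ := exists_min_image _ ρ hne
  obtain ⟨k₂, hk₂, hmax⟩ := exists_max_image _ ρ hne
  -- Points are repaired regardless of R, by two intervals for each window. Gaps are lost only to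
  -- blocks of smaller or larger residues, separated from this one by its least residue ρ k₁ or its
  -- greatest residue ρ k₂.
  choose Q hQB hQc hQ using H.exists_window_points (hBF.trans hF)
  set Z : ℝ → ℕ → List ℝ := fun r b => [A b, A b + 1, A b + r, A b + 1 + r] with hZ
  set G : ℕ → Finset ℕ := fun b => ((Z (ρ k₁) b ++ Z (ρ k₂) b).map (cntLt n q) ++
    (Z (ρ k₁) b ++ Z (ρ k₂) b).map (cntLe n q)).toFinset with hG
  -- Two separating residues, four positions for each, two gaps adjoining each position: 16 for each
  -- window. Together with the two intervals for the points this gives the 18 in the conclusion.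
  have hGc : ∀ b, #(G b) ≤ 16 := fun b => (List.toFinset_card_le _).trans (by simp [hZ])
  have hGm : ∀ b g z, z ∈ Z (ρ k₁) b ++ Z (ρ k₂) b → g = cntLt n q z ∨ g = cntLe n q z →
      g ∈ G b := by
    rintro b g z hz (rfl | rfl)
    · exact List.mem_toFinset.2 (List.mem_append_left _ (List.mem_map_of_mem hz))
    · exact List.mem_toFinset.2 (List.mem_append_right _ (List.mem_map_of_mem hz))
  obtain ⟨T, hTB, hT, hTc⟩ := exists_covers_of_missed (U := U) (V := V)
    (R := {k ∈ R | rank F ρ k / W = c}) (B := B) (D := (F.image w).biUnion G)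
    (Q := (F.image w).biUnion Q) (filter_subset_filter _ hRF)
    (biUnion_subset.2 fun b _ => hQB b) (by
      intro k hk g hg
      have hkF := hBF hk
      have hkc := (mem_filter.1 hk).2
      obtain ⟨k', hk', hg'⟩ := hR.1 k hkF g hg
      have hk'F := hRF hk'
      by_cases hc : rank F ρ k' / W = c
      · exact .inl ⟨k', mem_filter.2 ⟨hk', hc⟩, hg'⟩
      right
      rcases lt_or_gt_of_ne hc with hlt | hlt
      · have h1 : ρ k' ≤ ρ k₁ := by
          refine rank_le_of_rank_le (hBF hk₁) ?_
          by_contra h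
          have := Nat.div_le_div_right (c := W) (not_le.1 h).le
          rw [(mem_filter.1 hk₁).2] at this
          omega
        obtain ⟨b, hb, z, hz, hgz⟩ := H.shared_gap (hF hk'F) (hF hkF) h1 (hmin k hk) hg' hg
        refine mem_biUnion.2 ⟨b, ?_, hGm b g z (List.mem_append_left _ hz) hgz⟩
        simp only [mem_insert, mem_singleton] at hb
        rcases hb with rfl | rfl
        · exact mem_image_of_mem w hk'F
        · exact mem_image_of_mem w hkF
      · have h1 : ρ k₂ ≤ ρ k' := by
          refine rank_le_of_rank_le hk'F ?_
          by_contra h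
          have := Nat.div_le_div_right (c := W) (not_le.1 h).le
          rw [(mem_filter.1 hk₂).2] at this
          omega
        obtain ⟨b, hb, z, hz, hgz⟩ := H.shared_gap (hF hkF) (hF hk'F) (hmax k hk) h1 hg hg'
        refine mem_biUnion.2 ⟨b, ?_, hGm b g z (List.mem_append_right _ hz) hgz⟩
        simp only [mem_insert, mem_singleton] at hb
        rcases hb with rfl | rfl
        · exact mem_image_of_mem w hkF
        · exact mem_image_of_mem w hk'F) (by
      intro k hk i hi
      obtain ⟨k', hk', hi'⟩ := hQ (w k) k hk rfl i hi
      exact .inr ⟨k', mem_biUnion.2 ⟨w k, mem_image_of_mem w (hBF hk), hk'⟩, hi'⟩)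
  refine ⟨T, hTB, hT, hTc.trans ?_⟩
  have h1 := card_biUnion_le_card_mul (F.image w) G 16 fun b _ => hGc b
  have h2 := card_biUnion_le_card_mul (F.image w) Q 2 fun b _ => hQc b
  omega

theorem card_windows_le {L s t : ℕ} (hL : 0 < L) {F : Finset ℕ}
    (hF : ∀ k ∈ F, piece w L s k = t) : #(F.image w) ≤ L := by
  have : #(Ico (t * L) (t * L + L)) = L := by simp
  refine le_trans ?_ this.le
  refine card_le_card_of_injOn (fun b => b + (L - s)) ?_ fun a _ b _ h => Nat.add_right_cancel h
  intro b hb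
  simp only [coe_image, Set.mem_image, mem_coe] at hb
  obtain ⟨k, hk, rfl⟩ := hb
  have h := hF k hk
  rw [piece, Nat.div_eq_iff hL] at h
  simp only [coe_Ico, Set.mem_Ico]
  omega

theorem sum_card_fiber_le (S G : Finset ℕ) (f : ℕ → ℕ) : ∑ t ∈ S, #{k ∈ G | f k = t} ≤ #G := by
  rw [← card_biUnion (by
    intro a _ b _ hab
    refine disjoint_left.2 fun k hk hk' => hab ?_
    exact (mem_filter.1 hk).2.symm.trans (mem_filter.1 hk').2)]
  exact card_le_card (biUnion_subset.2 fun _ _ => filter_subset _ _)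

/-- Optimal solutions of the chunks of a piece together approximate a solution of the piece. -/
theorem sum_chunks_le (H : Windowing n q E X U V w A) {L s t : ℕ} (hL : 0 < L) {F R : Finset ℕ}
    (hFE : F ⊆ E) (hF : ∀ k ∈ F, piece w L s k = t) (hRF : R ⊆ F) (hR : Covers U V R F)
    (a : ℕ → ℕ) (ha : ∀ c, ∀ T ⊆ {k ∈ F | rank F (residue X A w) k / L ^ 2 = c},
      Covers U V T {k ∈ F | rank F (residue X A w) k / L ^ 2 = c} → a c ≤ #T) :
    L * ∑ c ∈ F.image (fun k => rank F (residue X A w) k / L ^ 2), a c ≤ L * #R + 36 * #F := by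
  set ρ := residue X A w with hρ
  have hW : 0 < L ^ 2 := by positivity
  -- A piece with at most L ^ 2 intervals is a single block and loses nothing.
  by_cases hsmall : #F ≤ L ^ 2
  · have h0 : ∀ k ∈ F, rank F ρ k / L ^ 2 = 0 := fun k hk =>
      Nat.div_eq_of_lt ((rank_lt_card hk).trans_le hsmall)
    have hfil : {k ∈ F | rank F ρ k / L ^ 2 = 0} = F := filter_true_of_mem h0
    have h1 := ha 0
    rw [hfil] at h1
    have hsub : F.image (fun k => rank F ρ k / L ^ 2) ⊆ {0} := by
      intro c hc
      obtain ⟨k, hk, rfl⟩ := mem_image.1 hc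
      simp [h0 k hk]
    have h2 : ∑ c ∈ F.image (fun k => rank F ρ k / L ^ 2), a c ≤ a 0 := by
      refine (sum_le_sum_of_subset hsub).trans ?_
      simp
    have h3 := h1 R hRF hR
    exact (Nat.mul_le_mul_left L (h2.trans h3)).trans (Nat.le_add_right _ _)
  · have hac : ∀ c, a c ≤ #{k ∈ R | rank F ρ k / L ^ 2 = c} + 18 * L := by
      intro c
      obtain ⟨T, hT, hTB, hc⟩ := H.exists_chunk_covers hFE hRF hR (L ^ 2) c
      have h1 := ha c T hT hTB
      have h2 := card_windows_le hL hF
      rw [← hρ] at hc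
      omega
    -- There are at most #F / L ^ 2 + 1 blocks. As #F exceeds L ^ 2, the last summand at most
    -- doubles the bound.
    have hn : L ^ 2 * #(F.image (fun k => rank F ρ k / L ^ 2)) ≤ 2 * #F := by
      have hsub : F.image (fun k => rank F ρ k / L ^ 2) ⊆ range (#F / L ^ 2 + 1) := by
        intro c hc
        obtain ⟨k, hk, rfl⟩ := mem_image.1 hc
        exact mem_range.2 (Nat.lt_succ_of_le (Nat.div_le_div_right (rank_lt_card hk).le))
      have h1 := card_le_card hsub
      rw [card_range] at h1
      have h2 := Nat.mul_le_mul_left (L ^ 2) h1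
      have h3 := Nat.mul_div_le (#F) (L ^ 2)
      rw [Nat.mul_add] at h2
      omega
    have hs : ∑ c ∈ F.image (fun k => rank F ρ k / L ^ 2), a c ≤
        #R + #(F.image (fun k => rank F ρ k / L ^ 2)) * (18 * L) := by
      refine (sum_le_sum fun c _ => hac c).trans ?_
      rw [sum_add_distrib, sum_const, smul_eq_mul]
      exact Nat.add_le_add_right (sum_card_fiber_le _ R _) _
    refine (Nat.mul_le_mul_left L hs).trans ?_
    rw [Nat.mul_add]
    refine Nat.add_le_add_left ?_ _
    calc L * (#(F.image (fun k => rank F ρ k / L ^ 2)) * (18 * L))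
        = 18 * (L ^ 2 * #(F.image (fun k => rank F ρ k / L ^ 2))) := by ring
      _ ≤ 18 * (2 * #F) := Nat.mul_le_mul_left _ hn
      _ = 36 * #F := by ring

/-! ### Adding up the losses over all chunks -/

/-- The chunk of an interval: its piece, and a number within the piece. -/
noncomputable def chunkId (E : Finset ℕ) (X A : ℕ → ℝ) (w : ℕ → ℕ) (L s k : ℕ) : ℕ × ℕ :=
  (piece w L s k,
    rank {k' ∈ E | piece w L s k' = piece w L s k} (residue X A w) k / L ^ 2)

/-- The intervals with a given chunk. -/
noncomputable def chunk (E : Finset ℕ) (X A : ℕ → ℝ) (w : ℕ → ℕ) (L s : ℕ) (c : ℕ × ℕ) :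
    Finset ℕ :=
  {k ∈ E | chunkId E X A w L s k = c}

theorem chunk_eq (t c : ℕ) (L s : ℕ) :
    chunk E X A w L s (t, c) = {k ∈ ({k ∈ E | piece w L s k = t} : Finset ℕ) |
      rank {k' ∈ E | piece w L s k' = t} (residue X A w) k / L ^ 2 = c} := by
  ext k
  simp only [chunk, chunkId, mem_filter, Prod.mk.injEq]
  constructor
  · rintro ⟨h1, h2, h3⟩
    rw [h2] at h3
    exact ⟨⟨h1, h2⟩, h3⟩
  · rintro ⟨⟨h1, h2⟩, h3⟩
    refine ⟨h1, h2, ?_⟩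
    rw [h2]; exact h3

theorem card_chunk_le_sq {L : ℕ} (hL : 0 < L) (s : ℕ) (c : ℕ × ℕ) :
    #(chunk E X A w L s c) ≤ L ^ 2 := by
  rw [← Prod.mk.eta (p := c), chunk_eq]
  exact card_chunk_le _ _ (by positivity) _

/-- Optimal solutions of the chunks together approximate every solution. -/
theorem sum_all_chunks_le (H : Windowing n q E X U V w A) {L s : ℕ} (hs : s < L)
    (hbest : L * #{k ∈ E | w k % L = s} ≤ #E) {T : Finset ℕ} (hTE : T ⊆ E)
    (hT : Covers U V T E) (a : ℕ × ℕ → ℕ)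
    (ha : ∀ c, ∀ R ⊆ chunk E X A w L s c, Covers U V R (chunk E X A w L s c) → a c ≤ #R) :
    L * ∑ c ∈ E.image (chunkId E X A w L s), a c ≤ L * #T + 44 * #E := by
  have hL : 0 < L := by omega
  set P : ℕ → Finset ℕ := fun t => {k ∈ E | piece w L s k = t} with hP
  have hsum : ∑ c ∈ E.image (chunkId E X A w L s), a c ≤
      ∑ t ∈ E.image (piece w L s),
        ∑ c ∈ (P t).image (fun k => rank (P t) (residue X A w) k / L ^ 2), a (t, c) := by
    rw [sum_sigma' (E.image (piece w L s))
      (fun t => (P t).image (fun k => rank (P t) (residue X A w) k / L ^ 2))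
      (fun t c => a (t, c))]
    refine le_of_eq (sum_bij' (fun c _ => ⟨c.1, c.2⟩) (fun c _ => (c.1, c.2)) ?_ ?_ ?_ ?_ ?_)
    · intro c hc
      obtain ⟨k, hk, rfl⟩ := mem_image.1 hc
      refine mem_sigma.2 ⟨mem_image_of_mem _ hk, mem_image.2 ⟨k, ?_, rfl⟩⟩
      simp [hP, chunkId, hk]
    · intro c hc
      obtain ⟨-, h2⟩ := mem_sigma.1 hc
      obtain ⟨k, hk, hkc⟩ := mem_image.1 h2
      simp only [hP, mem_filter] at hk
      refine mem_image.2 ⟨k, hk.1, ?_⟩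
      rw [← hkc]
      simp only [chunkId, hk.2, hP]
    · intro c _; rfl
    · intro c _; rfl
    · intro c _; rfl
  have hpiece : ∀ t, L * ∑ c ∈ (P t).image (fun k => rank (P t) (residue X A w) k / L ^ 2),
      a (t, c) ≤ L * #{k ∈ T | piece w L s k = t} + 4 * (L * #(cut E w L s t)) +
        4 * (L * #(cut E w L s (t + 1))) + 36 * #(P t) := by
    intro t
    obtain ⟨R, hRF, hR, hRc⟩ := H.exists_piece_covers hs hTE hT t
    have h1 := H.sum_chunks_le hL (filter_subset _ _) (fun k hk => (mem_filter.1 hk).2) hRF hR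
      (fun c => a (t, c)) (fun c R' hR' hRc' => by
        have := ha (t, c)
        rw [chunk_eq] at this
        exact this R' hR' hRc')
    refine h1.trans ?_
    have h2 := Nat.mul_le_mul_left L hRc
    rw [Nat.mul_add, Nat.mul_add, Nat.mul_left_comm L 4, Nat.mul_left_comm L 4] at h2
    simp only [hP]
    omega
  have hcut : ∑ t ∈ E.image (piece w L s), #(cut E w L s t) ≤ #{k ∈ E | w k % L = s} := by
    refine le_trans (le_of_eq (sum_congr rfl fun t _ => ?_))
      (sum_card_fiber_le (E.image (piece w L s)) {k ∈ E | w k % L = s} (piece w L s))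
    rw [cut, filter_filter]
  -- Each boundary is charged a second time, by the piece that ends there. The fibres of the shifted
  -- function keep this second sum below the size of the selected windows too.
  have hcut' : ∑ t ∈ E.image (piece w L s), #(cut E w L s (t + 1)) ≤
      #{k ∈ E | w k % L = s} := by
    refine le_trans (sum_le_sum fun t _ => ?_) (sum_card_fiber_le (E.image (piece w L s))
      {k ∈ E | w k % L = s} (fun k => piece w L s k - 1))
    refine card_le_card fun k hk => ?_
    simp only [cut, mem_filter] at hk ⊢
    exact ⟨⟨hk.1, hk.2.1⟩, by omega⟩
  have hTs := sum_card_fiber_le (E.image (piece w L s)) T (piece w L s)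
  have hEs := sum_card_fiber_le (E.image (piece w L s)) E (piece w L s)
  calc L * ∑ c ∈ E.image (chunkId E X A w L s), a c
      ≤ ∑ t ∈ E.image (piece w L s), (L * #{k ∈ T | piece w L s k = t} +
        4 * (L * #(cut E w L s t)) + 4 * (L * #(cut E w L s (t + 1))) + 36 * #(P t)) := by
        refine (Nat.mul_le_mul_left L hsum).trans ?_
        rw [mul_sum]
        exact sum_le_sum fun t _ => hpiece t
    -- Both sums over boundaries are at most the number of intervals in windows congruent to s,
    -- which `hbest` bounds by #E / L. The last term is the loss inside the pieces.
    _ ≤ L * #T + 4 * #E + 4 * #E + 36 * #E := by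
        rw [sum_add_distrib, sum_add_distrib, sum_add_distrib]
        simp only [← mul_sum]
        refine Nat.add_le_add (Nat.add_le_add (Nat.add_le_add ?_ ?_) ?_) ?_
        · exact Nat.mul_le_mul_left _ hTs
        · exact Nat.mul_le_mul_left _ ((Nat.mul_le_mul_left L hcut).trans hbest)
        · exact Nat.mul_le_mul_left _ ((Nat.mul_le_mul_left L hcut').trans hbest)
        · exact Nat.mul_le_mul_left _ hEs
    _ = L * #T + 44 * #E := by ring

end Windowing

end Partition

end DiscCode

/-! ### Discriminating codes on the line in terms of gaps -/

namespace DiscCode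

open Finset

section Sorted

variable {n : ℕ} {q : ℕ → ℝ}

theorem lt_iff_lt_cntLt (hq : ∀ i j, i < j → j < n → q i < q j) {i : ℕ} (hi : i < n) (x : ℝ) :
    q i < x ↔ i < cntLt n q x := by
  constructor
  · intro h
    have hsub : range (i + 1) ⊆ {j ∈ range n | q j < x} := by
      intro j hj
      simp only [mem_range] at hj
      refine mem_filter.2 ⟨mem_range.2 (by omega), ?_⟩
      rcases Nat.lt_succ_iff_lt_or_eq.1 hj with h' | rfl
      · exact (hq j i h' hi).trans h
      · exact h
    simpa [cntLt] using card_le_card hsub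
  · intro h
    by_contra hx
    have hsub : ({j ∈ range n | q j < x} : Finset ℕ) ⊆ range i := by
      intro j hj
      simp only [mem_filter, mem_range] at hj ⊢
      by_contra hij
      rcases (not_lt.1 hij).eq_or_lt with rfl | h'
      · exact hx hj.2
      · exact hx ((hq i j h' hj.1).trans hj.2)
    have := card_le_card hsub
    rw [card_range] at this
    exact absurd h (not_lt.2 this)

theorem le_iff_lt_cntLe (hq : ∀ i j, i < j → j < n → q i < q j) {i : ℕ} (hi : i < n) (x : ℝ) :
    q i ≤ x ↔ i < cntLe n q x := by
  constructor
  · intro h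
    have hsub : range (i + 1) ⊆ {j ∈ range n | q j ≤ x} := by
      intro j hj
      simp only [mem_range] at hj
      refine mem_filter.2 ⟨mem_range.2 (by omega), ?_⟩
      rcases Nat.lt_succ_iff_lt_or_eq.1 hj with h' | rfl
      · exact (hq j i h' hi).le.trans h
      · exact h
    simpa [cntLe] using card_le_card hsub
  · intro h
    by_contra hx
    have hsub : ({j ∈ range n | q j ≤ x} : Finset ℕ) ⊆ range i := by
      intro j hj
      simp only [mem_filter, mem_range] at hj ⊢
      by_contra hij
      rcases (not_lt.1 hij).eq_or_lt with rfl | h'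
      · exact hx hj.2
      · exact hx ((hq i j h' hj.1).le.trans hj.2)
    have := card_le_card hsub
    rw [card_range] at this
    exact absurd h (not_lt.2 this)

/-- At most one of the strictly increasing points equals x. -/
theorem cntLe_le_cntLt_succ (hq : ∀ i j, i < j → j < n → q i < q j) (x : ℝ) :
    cntLe n q x ≤ cntLt n q x + 1 := by
  by_contra h
  have hn := cntLe_le n q x
  have h1 := (le_iff_lt_cntLe hq (i := cntLt n q x + 1) (by omega) x).2 (by omega)
  have h2 := hq (cntLt n q x) _ (Nat.lt_succ_self _) (by omega)
  exact absurd ((lt_iff_lt_cntLt hq (by omega) x).1 (h2.trans_le h1)) (lt_irrefl _)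

theorem mem_unitSegment_iff (hq : ∀ i j, i < j → j < n → q i < q j) {i : ℕ} (hi : i < n) (x : ℝ) :
    q i ∈ unitSegment x ↔ cntLt n q x ≤ i ∧ i < cntLe n q (x + 1) := by
  rw [unitSegment, Set.mem_Icc, ← not_lt, lt_iff_lt_cntLt hq hi, le_iff_lt_cntLe hq hi, not_lt]

/-- The sum of the two counts determines both of them. -/
theorem cnt_eq_of_add_eq {x y : ℝ}
    (h : cntLt n q x + cntLe n q (x + 1) = cntLt n q y + cntLe n q (y + 1)) :
    cntLt n q x = cntLt n q y ∧ cntLe n q (x + 1) = cntLe n q (y + 1) := by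
  rcases le_total x y with hxy | hxy
  · have h1 := cntLt_mono n q hxy
    have h2 := cntLe_mono n q (add_le_add_left hxy 1)
    omega
  · have h1 := cntLt_mono n q hxy
    have h2 := cntLe_mono n q (add_le_add_left hxy 1)
    omega

theorem unitSegment_injective : Function.Injective unitSegment := by
  intro x y h
  have h1 : x ∈ unitSegment y := by rw [← h]; simp [unitSegment]
  have h2 : y ∈ unitSegment x := by rw [h]; simp [unitSegment]
  exact le_antisymm h2.1 h1.1

/-- An inner gap g separates two neighbouring points, whose codes differ in some interval; that
interval contains exactly one of them, so it has an endpoint in the gap. The outer gaps 0 and n are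
hit by any intervals covering the first and the last point. -/
theorem exists_hit_of_isDiscCode (hq : ∀ i j, i < j → j < n → q i < q j) (hn : 0 < n) {P : Set ℝ}
    (hP : ∀ y, y ∈ P ↔ ∃ i < n, q i = y) {T : Finset (Set ℝ)}
    (hT : ∀ I ∈ T, ∃ x, I = unitSegment x) (h : IsDiscCode P T) :
    (∀ g ≤ n, ∃ x, unitSegment x ∈ T ∧ cntLt n q x < cntLe n q (x + 1) ∧
      (cntLt n q x = g ∨ cntLe n q (x + 1) = g)) ∧
    ∀ i < n, ∃ x, unitSegment x ∈ T ∧ cntLt n q x ≤ i ∧ i < cntLe n q (x + 1) := by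
  have hpt : ∀ i < n, ∃ x, unitSegment x ∈ T ∧ cntLt n q x ≤ i ∧ i < cntLe n q (x + 1) := by
    intro i hi
    obtain ⟨I, hI, hiI⟩ := h.1 (q i) ((hP _).2 ⟨i, hi, rfl⟩)
    obtain ⟨x, rfl⟩ := hT I hI
    exact ⟨x, hI, (mem_unitSegment_iff hq hi x).1 hiI⟩
  refine ⟨fun g hg => ?_, hpt⟩
  rcases Nat.eq_zero_or_pos g with rfl | hg0
  · obtain ⟨x, hx, h1, h2⟩ := hpt 0 hn
    exact ⟨x, hx, by omega, by omega⟩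
  rcases hg.eq_or_lt with rfl | hgn
  · obtain ⟨x, hx, h1, h2⟩ := hpt (g - 1) (by omega)
    have := cntLe_le g q (x + 1)
    exact ⟨x, hx, by omega, by omega⟩
  have hne : q (g - 1) ≠ q g := (hq _ _ (by omega) hgn).ne
  have hcode := h.2 _ ((hP _).2 ⟨g - 1, by omega, rfl⟩) _ ((hP _).2 ⟨g, hgn, rfl⟩) hne
  obtain ⟨I, hI⟩ : ∃ I, ¬ (I ∈ code T (q (g - 1)) ↔ I ∈ code T (q g)) := by
    by_contra hcon
    push Not at hcon
    exact hcode (Set.ext hcon)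
  have hIT : I ∈ T := by
    by_contra hIT
    exact hI ⟨fun h => absurd h.1 hIT, fun h => absurd h.1 hIT⟩
  obtain ⟨x, rfl⟩ := hT I hIT
  refine ⟨x, hIT, ?_⟩
  have e1 : unitSegment x ∈ code T (q (g - 1)) ↔ q (g - 1) ∈ unitSegment x :=
    ⟨fun h => h.2, fun h => ⟨hIT, h⟩⟩
  have e2 : unitSegment x ∈ code T (q g) ↔ q g ∈ unitSegment x :=
    ⟨fun h => h.2, fun h => ⟨hIT, h⟩⟩
  rw [e1, e2, mem_unitSegment_iff hq (by omega), mem_unitSegment_iff hq hgn] at hI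
  omega

/-- Suppose the points i < j have equal codes, and take an interval hitting gap i + 1. If it ends
there, it contains i but not j. If it begins there, it misses i, hence j as well, so the two points
are more than one apart; but an interval covering i would contain both. -/
theorem isDiscCode_of_hit (hq : ∀ i j, i < j → j < n → q i < q j) {P : Set ℝ}
    (hP : ∀ y, y ∈ P ↔ ∃ i < n, q i = y) {T : Finset (Set ℝ)}
    (hG : ∀ g ≤ n, ∃ x, unitSegment x ∈ T ∧ cntLt n q x < cntLe n q (x + 1) ∧
      (cntLt n q x = g ∨ cntLe n q (x + 1) = g))
    (hpt : ∀ i < n, ∃ x, unitSegment x ∈ T ∧ cntLt n q x ≤ i ∧ i < cntLe n q (x + 1)) :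
    IsDiscCode P T := by
  have hmem : ∀ {x i}, unitSegment x ∈ T → i < n →
      (unitSegment x ∈ code T (q i) ↔ cntLt n q x ≤ i ∧ i < cntLe n q (x + 1)) := by
    intro x i hx hi
    rw [← mem_unitSegment_iff hq hi]
    exact ⟨fun h => h.2, fun h => ⟨hx, h⟩⟩
  have key : ∀ i j, i < j → j < n → code T (q i) ≠ code T (q j) := by
    intro i j hij hj hc
    have hi : i < n := by omega
    obtain ⟨x, hx, hlt, h⟩ := hG (i + 1) (by omega)
    have hxc := Set.ext_iff.1 hc (unitSegment x)
    rw [hmem hx hi, hmem hx hj] at hxc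
    obtain ⟨y, hy, hy1, hy2⟩ := hpt i hi
    have hyc := (Set.ext_iff.1 hc (unitSegment y)).1 ((hmem hy hi).2 ⟨hy1, hy2⟩)
    have h1 := (mem_unitSegment_iff hq hi y).2 ⟨hy1, hy2⟩
    have h2 := hyc.2
    -- In the first case the interval begins in gap i + 1; missing j, it lies strictly between the
    -- two points, which contradicts the interval y containing both. In the second case it ends in
    -- gap i + 1 and separates them directly.
    rcases h with h | h
    · have h3 : q i < x := (lt_iff_lt_cntLt hq hi x).2 (by omega)
      have h4 : ¬ q j ≤ x + 1 := by
        rw [le_iff_lt_cntLe hq hj]; omega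
      have h5 := h1.1
      have h6 := h2.2
      linarith
    · omega
  refine ⟨fun y hy => ?_, fun y hy z hz hne => ?_⟩
  · obtain ⟨i, hi, rfl⟩ := (hP y).1 hy
    obtain ⟨x, hx, h⟩ := hpt i hi
    exact ⟨_, (hmem hx hi).2 h⟩
  · obtain ⟨i, hi, rfl⟩ := (hP y).1 hy
    obtain ⟨j, hj, rfl⟩ := (hP z).1 hz
    rcases lt_trichotomy i j with h | h | h
    · exact key i j h hj
    · exact absurd (by rw [h]) hne
    · exact (key j i h hi).symm

end Sorted

/-! ### Intervals indexed by their keys -/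

/-- The intervals of a family, indexed by the sum of their counts. -/
structure KeyTable (n m : ℕ) (q s : ℕ → ℝ) (E : Finset ℕ) (X : ℕ → ℝ) (U V : ℕ → ℕ) : Prop where
  mem_s : ∀ k ∈ E, ∃ j < m, X k = s j
  U_eq : ∀ k ∈ E, U k = cntLt n q (X k)
  V_eq : ∀ k ∈ E, V k = cntLe n q (X k + 1)
  U_lt_V : ∀ k ∈ E, U k < V k
  key_eq : ∀ k ∈ E, U k + V k = k
  complete : ∀ j < m, cntLt n q (s j) < cntLe n q (s j + 1) →
    cntLt n q (s j) + cntLe n q (s j + 1) ∈ E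

/-- All gaps and all points are hit. -/
def HitsAll (n : ℕ) (U V : ℕ → ℕ) (T : Finset ℕ) : Prop :=
  (∀ g ≤ n, ∃ k ∈ T, HitG U V k g) ∧ ∀ i < n, ∃ k ∈ T, HitP U V k i

namespace KeyTable

variable {n m : ℕ} {q s : ℕ → ℝ} {E : Finset ℕ} {X : ℕ → ℝ} {U V : ℕ → ℕ}

/-- Both counts are monotone in the left endpoint, hence so is their sum. Scanning the keys upwards
therefore runs through the left endpoints in increasing order, and the intervals need not be sorted.
-/
theorem X_lt (H : KeyTable n m q s E X U V) {k k' : ℕ} (hk : k ∈ E) (hk' : k' ∈ E) (h : k < k') :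
    X k < X k' := by
  by_contra hle
  have h1 := cntLt_mono n q (not_lt.1 hle)
  have h2 := cntLe_mono n q (add_le_add_left (not_lt.1 hle) 1)
  rw [← H.U_eq k hk, ← H.U_eq k' hk'] at h1
  rw [← H.V_eq k hk, ← H.V_eq k' hk'] at h2
  have h3 := H.key_eq k hk
  have h4 := H.key_eq k' hk'
  omega

theorem lt_two_mul (H : KeyTable n m q s E X U V) {k : ℕ} (hk : k ∈ E) : k < 2 * n := by
  have h1 := H.U_lt_V k hk
  have h2 := H.key_eq k hk
  have h3 := cntLe_le n q (X k + 1)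
  rw [← H.V_eq k hk] at h3
  omega

theorem card_le (H : KeyTable n m q s E X U V) : #E ≤ 2 * n := by
  have : E ⊆ range (2 * n) := fun k hk => mem_range.2 (H.lt_two_mul hk)
  simpa using card_le_card this

theorem covers_of_hitsAll (H : KeyTable n m q s E X U V) {T : Finset ℕ}
    (hT : HitsAll n U V T) : Covers U V T E := by
  constructor
  · rintro k hk g (rfl | rfl)
    · exact hT.1 _ (by rw [H.U_eq k hk]; exact cntLt_le _ _ _)
    · exact hT.1 _ (by rw [H.V_eq k hk]; exact cntLe_le _ _ _)
  · rintro k hk i ⟨-, h2⟩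
    refine hT.2 i (h2.trans_le ?_)
    rw [H.V_eq k hk]; exact cntLe_le _ _ _

theorem hitsAll_of_covers {T : Finset ℕ} (hE : HitsAll n U V E)
    (hT : Covers U V T E) : HitsAll n U V T := by
  refine ⟨fun g hg => ?_, fun i hi => ?_⟩
  · obtain ⟨k, hk, h⟩ := hE.1 g hg
    exact hT.1 k hk g h
  · obtain ⟨k, hk, h⟩ := hE.2 i hi
    exact hT.2 k hk i h

/-- There are n + 1 gaps and every interval has two endpoints. This lower bound turns additive
errors into relative ones. -/
theorem le_two_mul_card {T : Finset ℕ} (hT : HitsAll n U V T) : n + 1 ≤ 2 * #T := by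
  have hsub : range (n + 1) ⊆ T.image U ∪ T.image V := by
    intro g hg
    obtain ⟨k, hk, h⟩ := hT.1 g (by simpa [Nat.lt_succ_iff] using hg)
    rcases h with rfl | rfl
    · exact mem_union_left _ (mem_image_of_mem _ hk)
    · exact mem_union_right _ (mem_image_of_mem _ hk)
  have h1 := card_le_card hsub
  have h2 := card_union_le (T.image U) (T.image V)
  have h3 := card_image_le (s := T) (f := U)
  have h4 := card_image_le (s := T) (f := V)
  rw [card_range] at h1
  omega

/-- Each interval is replaced by the representative with the same key. Intervals without points have
no representative in E and are dropped, which is harmless because `exists_hit_of_isDiscCode` yields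
only intervals with U < V. -/
theorem exists_hitsAll (H : KeyTable n m q s E X U V) (hq : ∀ i j, i < j → j < n → q i < q j)
    (hn : 0 < n) {P : Set ℝ} (hP : ∀ y, y ∈ P ↔ ∃ i < n, q i = y) {T : Finset (Set ℝ)}
    (hT : ∀ I ∈ T, ∃ j < m, I = unitSegment (s j)) (h : IsDiscCode P T) :
    ∃ K ⊆ E, HitsAll n U V K ∧ #K ≤ #T := by
  classical
  set f : Set ℝ → ℕ := fun I => cntLt n q (sInf I) + cntLe n q (sInf I + 1) with hf
  have hfu : ∀ x, f (unitSegment x) = cntLt n q x + cntLe n q (x + 1) := by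
    intro x
    -- The infimum recovers the left endpoint from the interval as a set.
    have : sInf (unitSegment x) = x := csInf_Icc (by linarith)
    simp only [hf, this]
  have hmem : ∀ x, unitSegment x ∈ T → cntLt n q x < cntLe n q (x + 1) →
      f (unitSegment x) ∈ T.image f ∩ E ∧ U (f (unitSegment x)) = cntLt n q x ∧
        V (f (unitSegment x)) = cntLe n q (x + 1) := by
    intro x hx hlt
    obtain ⟨j, hj, he⟩ := hT _ hx
    obtain rfl := unitSegment_injective he
    have hE := H.complete j hj hlt
    rw [← hfu] at hE
    refine ⟨mem_inter.2 ⟨mem_image_of_mem f hx, hE⟩, ?_⟩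
    have h1 := H.key_eq _ hE
    have h2 := hfu (s j)
    rw [H.U_eq _ hE, H.V_eq _ hE] at h1 ⊢
    exact cnt_eq_of_add_eq (h1.trans h2)
  obtain ⟨h1, h2⟩ := exists_hit_of_isDiscCode hq hn hP
    (fun I hI => by obtain ⟨j, -, hj⟩ := hT I hI; exact ⟨_, hj⟩) h
  refine ⟨T.image f ∩ E, inter_subset_right, ⟨fun g hg => ?_, fun i hi => ?_⟩,
    (card_le_card inter_subset_left).trans card_image_le⟩
  · obtain ⟨x, hx, hlt, hxg⟩ := h1 g hg
    obtain ⟨h3, h4, h5⟩ := hmem x hx hlt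
    exact ⟨_, h3, by rw [HitG, h4, h5]; exact hxg⟩
  · obtain ⟨x, hx, hx1, hx2⟩ := h2 i hi
    obtain ⟨h3, h4, h5⟩ := hmem x hx (by omega)
    exact ⟨_, h3, by rw [HitP, h4, h5]; exact ⟨hx1, hx2⟩⟩

theorem isDiscCode_image (H : KeyTable n m q s E X U V)
    (hq : ∀ i j, i < j → j < n → q i < q j) {P : Set ℝ}
    (hP : ∀ y, y ∈ P ↔ ∃ i < n, q i = y) {K : Finset ℕ} (hKE : K ⊆ E) (hK : HitsAll n U V K)
    {T : Finset (Set ℝ)} (hT : ∀ k ∈ K, unitSegment (X k) ∈ T) : IsDiscCode P T := by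
  refine isDiscCode_of_hit hq hP (fun g hg => ?_) fun i hi => ?_
  · obtain ⟨k, hk, h⟩ := hK.1 g hg
    have h1 := H.U_lt_V k (hKE hk)
    rw [HitG, H.U_eq k (hKE hk), H.V_eq k (hKE hk)] at h
    rw [H.U_eq k (hKE hk), H.V_eq k (hKE hk)] at h1
    exact ⟨X k, hT k hk, h1, h⟩
  · obtain ⟨k, hk, h⟩ := hK.2 i hi
    rw [HitP, H.U_eq k (hKE hk), H.V_eq k (hKE hk)] at h
    exact ⟨X k, hT k hk, h⟩

end KeyTable

theorem exists_of_mem_unitSegments {m : ℕ} {s : Fin m → ℝ} {s' : ℕ → ℝ}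
    (hs : ∀ j : Fin m, s' j = s j) {I : Set ℝ} (hI : I ∈ unitSegments s) :
    ∃ j < m, I = unitSegment (s' j) := by
  simp only [unitSegments, mem_image, mem_univ, true_and] at hI
  obtain ⟨j, rfl⟩ := hI
  exact ⟨j, j.2, by rw [hs]⟩

theorem mem_unitSegments {m : ℕ} {s : Fin m → ℝ} {s' : ℕ → ℝ}
    (hs : ∀ j : Fin m, s' j = s j) {j : ℕ} (hj : j < m) : unitSegment (s' j) ∈ unitSegments s := by
  simp only [unitSegments, mem_image, mem_univ, true_and]
  exact ⟨⟨j, hj⟩, by rw [← hs]⟩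

theorem card_unitSegments_le {m : ℕ} (s : Fin m → ℝ) : #(unitSegments s) ≤ m :=
  card_image_le.trans (by simp)

/-- The quality of a union of optimal solutions of the chunks. -/
theorem approx_of_chunks {n m : ℕ} {q s' : ℕ → ℝ} {E : Finset ℕ} {X : ℕ → ℝ} {U V w : ℕ → ℕ}
    {A : ℕ → ℝ} (H : KeyTable n m q s' E X U V) (hn : 0 < n)
    (hq : ∀ i j, i < j → j < n → q i < q j) {P : Set ℝ}
    (hP : ∀ y, y ∈ P ↔ ∃ i < n, q i = y) {s : Fin m → ℝ} (hs : ∀ j : Fin m, s' j = s j)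
    (hdisc : IsDiscCode P (unitSegments s)) (HW : Windowing n q E X U V w A) {L o : ℕ}
    (ho : o < L) (hbest : L * #{k ∈ E | w k % L = o} ≤ #E)
    (a : ℕ × ℕ → ℕ) (K : Finset ℕ) (hKE : K ⊆ E) (hKc : Covers U V K E)
    (ha : ∀ c, ∀ R ⊆ Windowing.chunk E X A w L o c, Covers U V R (Windowing.chunk E X A w L o c) → a c ≤ #R)
    {T : Finset (Set ℝ)} (hTK : ∀ I, I ∈ T ↔ ∃ k ∈ K, I = unitSegment (X k))
    (hTa : #T ≤ ∑ c ∈ E.image (Windowing.chunkId E X A w L o), a c) :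
    IsDiscreteSolution P (unitSegments s) T ∧ ∀ T', IsDiscreteSolution P (unitSegments s) T' →
      L * #T ≤ (L + 176) * #T' := by
  obtain ⟨K₀, hK₀, hK₀a, -⟩ := H.exists_hitsAll hq hn hP
    (fun I hI => exists_of_mem_unitSegments hs hI) hdisc
  have hE : HitsAll n U V E :=
    ⟨fun g hg => (hK₀a.1 g hg).imp fun k hk => ⟨hK₀ hk.1, hk.2⟩,
      fun i hi => (hK₀a.2 i hi).imp fun k hk => ⟨hK₀ hk.1, hk.2⟩⟩
  refine ⟨⟨fun I hI => ?_, ?_⟩, fun T' hT' => ?_⟩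
  · obtain ⟨k, hk, rfl⟩ := (hTK I).1 hI
    obtain ⟨j, hj, h⟩ := H.mem_s k (hKE hk)
    rw [h]; exact mem_unitSegments hs hj
  · exact H.isDiscCode_image hq hP hKE (KeyTable.hitsAll_of_covers hE hKc)
      fun k hk => (hTK _).2 ⟨k, hk, rfl⟩
  · obtain ⟨K', hK', hK'a, hc⟩ := H.exists_hitsAll hq hn hP
      (fun I hI => exists_of_mem_unitSegments hs (hT'.1 hI)) hT'.2
    have h1 := HW.sum_all_chunks_le ho hbest hK' (H.covers_of_hitsAll hK'a) a ha
    have h2 := KeyTable.le_two_mul_card hK'a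
    have h3 := H.card_le
    calc L * #T ≤ L * #K' + 44 * #E := (Nat.mul_le_mul_left L hTa).trans h1
      -- From #E ≤ 2n and n + 1 ≤ 2 #K' it follows that 44 #E ≤ 88n ≤ 176 #K'.
      _ ≤ L * #K' + 176 * #K' := by omega
      _ = (L + 176) * #K' := by ring
      _ ≤ (L + 176) * #T' := Nat.mul_le_mul_left _ hc

end DiscCode

/-! ### Sorting the points and tabulating the intervals -/

namespace RealRAM

open Finset DiscCode

/-- A cell of a real array, indexed by a variable. -/
abbrev RExp.at (a x : ℕ) : RExp := .get a (.var x)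

/-- A cell of a natural-number array, indexed by a variable. -/
abbrev CExp.at (a x : ℕ) : CExp := .get a (.var x)

/-- Sorting of the array `0` into the array `3`. -/
def sortP : Prog :=
  forX 5 (.var 0) (stR 3 (.sum 40 (.var 0) (.not (.rle (.at 0 5) (.at 0 40)))) (.at 0 5))

theorem cntLt_lt_of_lt {n : ℕ} {p : ℕ → ℝ} {i j : ℕ} (hi : i < n) (h : p i < p j) :
    cntLt n p (p i) < cntLt n p (p j) := by
  refine card_lt_card (ssubset_iff_of_subset ?_ |>.2 ⟨i, by simp [hi, h], by simp⟩)
  intro k hk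
  simp only [mem_filter] at hk ⊢
  exact ⟨hk.1, hk.2.trans h⟩

/-- A value is written at the position given by the number of smaller values. Writes to the same
position carry equal values, so distinctness of the points is needed only later, in
`isSorting_of_cntLt`. -/
theorem sortP_spec {n : ℕ} {σ : Store} (hn : σ.nvar 0 = n) (hn0 : 0 < n) :
    WP sortP (64 * n ^ 2) σ fun τ => Fr [5] [] [3] σ τ ∧
      ∀ i < n, τ.rarr 3 (cntLt n (σ.rarr 0) (σ.rarr 0 i)) = σ.rarr 0 i := by
  refine WP.forX n (30 * n + 16) (fun i τ => Fr [5] [] [3] σ τ ∧ τ.nvar 5 = i ∧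
    ∀ j < i, τ.rarr 3 (cntLt n (σ.rarr 0) (σ.rarr 0 j)) = σ.rarr 0 j) (by norm_num) (by decide)
    ⟨(Fr.refl ..).setVar (by simp) _, by simp, by simp⟩ ?_ ?_ (fun τ h => ⟨h.1, h.2.2⟩) ?_
  · rintro i τ ⟨hF, h5, -⟩
    exact ⟨h5, (hF.nvar 0 (by simp)).trans hn⟩
  · rintro i hi τ ⟨hF, h5, hI⟩
    have h0 : τ.nvar 0 = n := (hF.nvar 0 (by simp)).trans hn
    have hr : τ.rarr 0 = σ.rarr 0 := hF.rarr 0 (by simp)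
    have hev : (CExp.sum 40 (.var 0) (.not (.rle (.at 0 5) (.at 0 40)))).eval τ =
        cntLt n (σ.rarr 0) (σ.rarr 0 i) := by
      rw [cntLt, card_filter]
      simp only [CExp.eval_sum, CExp.eval_var, h0, CExp.eval_not, CExp.eval_rle, RExp.eval,
        NExp.eval, nvar_setVar, rarr_setVar, hr, CExp.one_le_ite]
      refine sum_congr rfl fun x _ => ?_
      simp only [show (5 : ℕ) ≠ 40 by norm_num, if_true, if_false, h5]
      by_cases h : σ.rarr 0 i ≤ σ.rarr 0 x
      · rw [if_pos h, if_neg (not_lt.2 h)]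
      · rw [if_neg h, if_pos (not_le.1 h)]
    refine WP.stR (by decide) (by decide) ?_ ?_
    · rw [hev]
      refine ⟨by simpa using h5, (hF.setReal (by simp) _ _).setVar (by simp) _, by simp, ?_⟩
      intro j hj
      simp only [rarr_setVar, rarr_setReal_apply, true_and, RExp.eval, NExp.eval, h5, hr]
      split_ifs with h
      · rcases lt_trichotomy (σ.rarr 0 j) (σ.rarr 0 i) with h' | h' | h'
        · exact absurd h (cntLt_lt_of_lt (by omega) h').ne
        · exact h'.symm
        · exact absurd h (cntLt_lt_of_lt hi h').ne'
      · refine hI j ?_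
        rcases Nat.lt_succ_iff_lt_or_eq.1 hj with h' | rfl
        · exact h'
        · exact absurd rfl h
    · simp only [CExp.cost, CExp.not, RExp.cost, NExp.cost, CExp.eval_var, h0, sum_const,
        card_range, smul_eq_mul]
      omega
  · simp only [NExp.cost]
    nlinarith

/-- The result of sorting. -/
structure IsSorting (n : ℕ) (p q : ℕ → ℝ) : Prop where
  strictMono : ∀ i j, i < j → j < n → q i < q j
  mem_iff : ∀ y, (∃ i < n, q i = y) ↔ ∃ i < n, p i = y

theorem isSorting_of_cntLt {n : ℕ} {p q : ℕ → ℝ} (hp : ∀ i < n, ∀ j < n, p i = p j → i = j)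
    (h : ∀ i < n, q (cntLt n p (p i)) = p i) : IsSorting n p q := by
  have hlt : ∀ i < n, cntLt n p (p i) < n := by
    intro i hi
    have : cntLt n p (p i) < #(range n) :=
      card_lt_card (ssubset_iff_of_subset (filter_subset _ _) |>.2 ⟨i, by simp [hi], by simp⟩)
    simpa using this
  have hinj : Set.InjOn (fun i => cntLt n p (p i)) (range n) := by
    intro i hi j hj hij
    simp only [coe_range, Set.mem_Iio] at hi hj
    simp only at hij
    refine hp i hi j hj ?_
    rw [← h i hi, ← h j hj, hij]
  have hsurj : ∀ j < n, ∃ i < n, cntLt n p (p i) = j := by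
    have himg : (range n).image (fun i => cntLt n p (p i)) = range n := by
      refine eq_of_subset_of_card_le (fun x hx => ?_) ?_
      · obtain ⟨i, hi, rfl⟩ := mem_image.1 hx
        exact mem_range.2 (hlt i (mem_range.1 hi))
      · rw [card_image_of_injOn hinj]
    intro j hj
    have : j ∈ (range n).image (fun i => cntLt n p (p i)) := by rw [himg]; exact mem_range.2 hj
    obtain ⟨i, hi, hij⟩ := mem_image.1 this
    exact ⟨i, mem_range.1 hi, hij⟩
  constructor
  · intro i j hij hj
    obtain ⟨a, ha, rfl⟩ := hsurj i (by omega)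
    obtain ⟨b, hb, rfl⟩ := hsurj j hj
    rw [h a ha, h b hb]
    by_contra hle
    exact absurd (cntLt_mono n p (not_lt.1 hle)) (by omega)
  · intro y
    constructor
    · rintro ⟨i, hi, rfl⟩
      obtain ⟨a, ha, rfl⟩ := hsurj i hi
      exact ⟨a, ha, (h a ha).symm⟩
    · rintro ⟨i, hi, rfl⟩
      exact ⟨_, hlt i hi, h i hi⟩

/-! ### Powers of two, binary search and the table of keys -/

/-- Tabulation of the powers of two in the array `0`, and of the number of binary digits of `n`
in the variable `4`. -/
def powP : Prog :=
  .seq (stN 0 (.lit 0) (.lit 1)) (.seq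
    (forX 5 (.var 0) (stN 0 (.add (.var 5) (.lit 1)) (.add (.at 0 5) (.at 0 5))))
    (asg 4 (.sum 40 (.add (.var 0) (.lit 1)) (.le (.at 0 40) (.var 0)))))

theorem card_pow_le {n : ℕ} (hn : 0 < n) : #{k ∈ range (n + 1) | 2 ^ k ≤ n} = Nat.log 2 n + 1 := by
  have : ({k ∈ range (n + 1) | 2 ^ k ≤ n} : Finset ℕ) = range (Nat.log 2 n + 1) := by
    ext k
    simp only [mem_filter, mem_range]
    rw [Nat.lt_succ_iff (n := Nat.log 2 n), Nat.le_log_iff_pow_le (by norm_num) hn.ne']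
    constructor
    · exact fun h => h.2
    · intro h
      have := Nat.lt_two_pow_self (n := k)
      exact ⟨by omega, h⟩
  rw [this, card_range]

theorem powP_spec {n : ℕ} {σ : Store} (hn : σ.nvar 0 = n) (hn0 : 0 < n) :
    WP powP (130 * n) σ fun τ => Fr [4, 5] [0] [] σ τ ∧ τ.nvar 4 = Nat.log 2 n + 1 ∧
      ∀ k ≤ n, τ.narr 0 k = 2 ^ k := by
  refine WP.seq_le 7 (62 * n + 55) (by omega) ?_
  refine WP.stN (by decide) (by decide) ?_ (by simp [CExp.cost])
  refine WP.seq_le (35 * n + 8) (27 * n + 47) (by omega) ?_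
  refine WP.forX n 25 (fun i τ => Fr [4, 5] [0] [] σ τ ∧ τ.nvar 5 = i ∧
    ∀ k ≤ i, τ.narr 0 k = 2 ^ k) (by norm_num) (by decide) ?_ ?_ ?_ ?_ ?_
  · refine ⟨((Fr.refl ..).setNat (by simp) _ _).setVar (by simp) _, by simp, ?_⟩
    intro k hk
    obtain rfl : k = 0 := by omega
    simp
  · rintro i τ ⟨hF, h5, -⟩
    exact ⟨h5, (hF.nvar 0 (by simp)).trans hn⟩
  · rintro i hi τ ⟨hF, h5, hI⟩
    refine WP.stN (by decide) (by decide) ?_ (by simp [CExp.cost])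
    refine ⟨by simpa using h5, (hF.setNat (by simp) _ _).setVar (by simp) _, by simp, ?_⟩
    intro k hk
    simp only [narr_setVar, narr_setNat_apply, CExp.eval_add, CExp.eval_var, h5, CExp.eval_lit,
      CExp.eval_get, true_and, hI i le_rfl]
    split_ifs with h
    · rw [h, pow_succ]; ring
    · exact hI k (by omega)
  · rintro τ ⟨hF, h5, hI⟩
    have h0 : τ.nvar 0 = n := (hF.nvar 0 (by simp)).trans hn
    refine WP.asg (by decide) ⟨hF.setVar (by simp) _, ?_, hI⟩ ?_
    · simp only [nvar_setVar, if_true]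
      rw [← card_pow_le hn0, card_filter]
      simp only [CExp.eval_sum, CExp.eval_add, CExp.eval_var, h0, CExp.eval_lit, CExp.eval_le,
        CExp.eval_get, nvar_setVar, narr_setVar, if_true]
      refine sum_congr rfl fun k hk => ?_
      rw [hI k (by have := mem_range.1 hk; omega)]
      simp
    · simp only [CExp.cost, CExp.eval_add, CExp.eval_var, h0, CExp.eval_lit, sum_const, card_range,
        smul_eq_mul]
      omega
  · simp only [NExp.cost]
    omega

/-- Binary search: the variable `d` receives the number of indices below `n` for which the
antitone test holds; the test refers to the index `d + 9 - 1`. -/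
def searchP (d : ℕ) (test : CExp) : Prog :=
  .seq (asg d (.lit 0)) (forX 8 (.var 4)
    (.seq (asg 9 (.get 0 (.sub (.sub (.var 4) (.lit 1)) (.var 8))))
      (ifX (.and (.le (.add (.var d) (.var 9)) (.var 0)) test) (asg d (.add (.var d) (.var 9)))
        .skip)))

/-- Halving a natural number is not available, so the answer c is built bit by bit from the
tabulated powers of two. After i rounds it lies in [d, d + 2 ^ (log n + 1 - i)), where d is the
current value of the result variable. -/
theorem searchP_spec {n c d tc : ℕ} {test : CExp} {σ : Store} (hd : d = 6 ∨ d = 7)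
    (hn : σ.nvar 0 = n) (hK : σ.nvar 4 = Nat.log 2 n + 1) (hn0 : 0 < n)
    (hpw : ∀ k ≤ n, σ.narr 0 k = 2 ^ k) (hc : c ≤ n) (hok : test.ok isProgVar = true)
    (htest : ∀ τ, Fr [d, 8, 9] [] [] σ τ → τ.nvar d + τ.nvar 9 - 1 < n →
      (1 ≤ test.eval τ ↔ τ.nvar d + τ.nvar 9 - 1 < c))
    (hcost : ∀ τ, test.cost τ ≤ tc) :
    WP (searchP d test) ((Nat.log 2 n + 1) * (tc + 70) + 20) σ fun τ =>
      Fr [d, 8, 9] [] [] σ τ ∧ τ.nvar d = c := by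
  have hd8 : d ≠ 8 := by omega
  have hd9 : d ≠ 9 := by omega
  have hdlt : d < 40 := by omega
  have hdV : isProgVar d = true := by simp [isProgVar, hdlt]
  have hlog : Nat.log 2 n < n := Nat.log_lt_self 2 hn0.ne'
  have hn2 : n < 2 ^ (Nat.log 2 n + 1) := Nat.lt_pow_succ_log_self (by norm_num) n
  refine WP.seq_le 4 ((Nat.log 2 n + 1) * (tc + 70) + 16) (by omega) ?_
  refine WP.asg (by decide) ?_ (by simp [CExp.cost])
  refine WP.forX (Nat.log 2 n + 1) (tc + 60) (fun i τ => Fr [d, 8, 9] [] [] σ τ ∧ τ.nvar 8 = i ∧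
    τ.nvar d ≤ c ∧ c < τ.nvar d + 2 ^ (Nat.log 2 n + 1 - i)) (by norm_num) (by decide) ?_ ?_ ?_ ?_ ?_
  · refine ⟨((Fr.refl ..).setVar (by simp) _).setVar (by simp) _, by simp, ?_⟩
    simp only [nvar_setVar, hd8, if_false, if_true, CExp.eval_lit, Nat.sub_zero]
    omega
  · rintro i τ ⟨hF, h8, -⟩
    exact ⟨h8, (hF.nvar 4 (by simp; omega)).trans hK⟩
  · rintro i hi τ ⟨hF, h8, hlo, hhi⟩
    have h4 : τ.nvar 4 = Nat.log 2 n + 1 := (hF.nvar 4 (by simp; omega)).trans hK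
    have hN : τ.narr 0 = σ.narr 0 := hF.narr 0 (by simp)
    have h0 : τ.nvar 0 = n := (hF.nvar 0 (by simp; omega)).trans hn
    refine WP.seq_le 19 (tc + 40) (by omega) ?_
    refine WP.asg (by decide) ?_ (by simp [CExp.cost])
    have hev : (CExp.get 0 (.sub (.sub (.var 4) (.lit 1)) (.var 8))).eval τ =
        2 ^ (Nat.log 2 n - i) := by
      simp only [CExp.eval_get, CExp.eval_sub, CExp.eval_var, CExp.eval_lit, h4, h8, hN]
      rw [hpw _ (by omega)]
      congr 1
    rw [hev]
    have hpow : 2 ^ (Nat.log 2 n + 1 - i) = 2 ^ (Nat.log 2 n - i) + 2 ^ (Nat.log 2 n - i) := by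
      rw [show Nat.log 2 n + 1 - i = Nat.log 2 n - i + 1 by omega, pow_succ]; ring
    have hpos : 0 < 2 ^ (Nat.log 2 n - i) := by positivity
    have hsub : Nat.log 2 n + 1 - (i + 1) = Nat.log 2 n - i := by omega
    obtain ⟨e, he⟩ : ∃ e, 2 ^ (Nat.log 2 n - i) = e := ⟨_, rfl⟩
    rw [hpow] at hhi
    rw [he] at hhi hpos ⊢
    have hF' : Fr [d, 8, 9] [] [] σ (τ.setVar 9 e) := hF.setVar (by simp) _
    have ht := htest _ hF'
    simp only [nvar_setVar, hd9, if_true, if_false] at ht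
    refine WP.ifX (u := 12) (by simp [CExp.ok, CExp.and, hdV, hok]; decide) ?_ ?_ ?_
    · intro h
      simp only [CExp.eval_and, CExp.one_le_ite_and, CExp.eval_le, CExp.eval_add, CExp.eval_var,
        nvar_setVar, hd9, if_true, if_false, show (0 : ℕ) ≠ 9 by norm_num, h0, le_refl, and_true] at h
      have h' := (ht (by omega)).1 h.2
      refine WP.asg (by simp [CExp.ok, hdV]; decide) ?_ (by simp [CExp.cost])
      refine ⟨by simp [hd8.symm, h8], (hF'.setVar (by simp) _).setVar (by simp) _, by simp, ?_⟩
      rw [hsub, he]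
      simp only [nvar_setVar, hd8, hd9, if_true, if_false, CExp.eval_add, CExp.eval_var]
      omega
    · intro h
      simp only [CExp.eval_and, CExp.one_le_ite_and, CExp.eval_le, CExp.eval_add, CExp.eval_var,
        nvar_setVar, hd9, if_true, if_false, show (0 : ℕ) ≠ 9 by norm_num, h0, le_refl, and_true] at h
      refine WP.skip ?_ (by norm_num)
      refine ⟨by simp [h8], hF'.setVar (by simp) _, by simp, ?_⟩
      rw [hsub, he]
      simp only [nvar_setVar, hd8, hd9, if_false]
      -- If the increased value exceeds n, the test is not informative, but then c ≤ n already gives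
      -- the upper bound.
      by_cases hle : τ.nvar d + e ≤ n
      · have h1 : ¬ τ.nvar d + e - 1 < c := fun hlt => h ⟨hle, (ht (by omega)).2 hlt⟩
        omega
      · omega
    · have := hcost (τ.setVar 9 e)
      simp only [CExp.cost, CExp.and]
      omega
  · rintro τ ⟨hF, h8, hlo, hhi⟩
    refine ⟨hF, ?_⟩
    simp only [Nat.sub_self, pow_zero] at hhi
    omega
  · simp only [NExp.cost]
    nlinarith

/-- Tabulation of the intervals of the array `1` by the sum of their counts. -/
def tableP : Prog :=
  forX 5 (.var 1)
    (.seq (searchP 6 (.not (.rle (.at 1 5) (.get 3 (.sub (.add (.var 6) (.var 9)) (.lit 1))))))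
    (.seq (searchP 7 (.rle (.get 3 (.sub (.add (.var 7) (.var 9)) (.lit 1)))
        (.add (.at 1 5) (.lit 1))))
    (ifX (.lt (.var 6) (.var 7))
      (.seq (stR 4 (.add (.var 6) (.var 7)) (.at 1 5))
      (.seq (stN 1 (.add (.var 6) (.var 7)) (.var 6))
        (stN 2 (.add (.var 6) (.var 7)) (.var 7))))
      .skip)))

/-- The intervals found: those keys for which an interval has been stored. -/
def keys (n : ℕ) (U V : ℕ → ℕ) : Finset ℕ := {k ∈ range (2 * n + 1) | U k < V k}

theorem tableP_spec {n m : ℕ} {σ : Store} (hn : σ.nvar 0 = n) (hm : σ.nvar 1 = m)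
    (hK : σ.nvar 4 = Nat.log 2 n + 1) (hn0 : 0 < n) (hpw : ∀ k ≤ n, σ.narr 0 k = 2 ^ k)
    (hq : ∀ i j, i < j → j < n → σ.rarr 3 i < σ.rarr 3 j)
    (hU : ∀ k, σ.narr 1 k = 0) (hV : ∀ k, σ.narr 2 k = 0) :
    WP tableP (m * (Nat.log 2 n + 1) * 500 + 8) σ fun τ => Fr [5, 6, 7, 8, 9] [1, 2] [4] σ τ ∧
      KeyTable n m (σ.rarr 3) (σ.rarr 1) (keys n (τ.narr 1) (τ.narr 2)) (τ.rarr 4) (τ.narr 1)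
        (τ.narr 2) := by
  set q := σ.rarr 3 with hqd
  set s := σ.rarr 1 with hsd
  set u : ℕ → ℕ := fun j => cntLt n q (s j) with hu
  set v : ℕ → ℕ := fun j => cntLe n q (s j + 1) with hv
  have hkey : ∀ i j, u i + v i = u j + v j → u i = u j ∧ v i = v j :=
    fun i j h => cnt_eq_of_add_eq h
  -- Every key is either untouched, with both counts still zero, or holds the data of some interval
  -- seen so far. Since stored intervals satisfy U < V, the zeros mark the free cells. Redundant
  -- intervals share a key and overwrite each other.
  refine WP.forX m ((Nat.log 2 n + 1) * 300 + 100) (fun i τ => Fr [5, 6, 7, 8, 9] [1, 2] [4] σ τ ∧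
    τ.nvar 5 = i ∧ ∀ k, (τ.narr 1 k = 0 ∧ τ.narr 2 k = 0 ∧ ∀ j < i, u j < v j → u j + v j ≠ k) ∨
      ∃ j < i, u j < v j ∧ u j + v j = k ∧ τ.rarr 4 k = s j ∧ τ.narr 1 k = u j ∧
        τ.narr 2 k = v j) (by norm_num) (by decide) ?_ ?_ ?_ ?_ ?_
  · refine ⟨(Fr.refl ..).setVar (by simp) _, by simp, fun k => .inl ⟨hU k, hV k, by simp⟩⟩
  · rintro i τ ⟨hF, h5, -⟩
    exact ⟨h5, (hF.nvar 1 (by simp)).trans hm⟩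
  · rintro i hi τ ⟨hF, h5, hI⟩
    have h0 : τ.nvar 0 = n := (hF.nvar 0 (by simp)).trans hn
    have h4 : τ.nvar 4 = Nat.log 2 n + 1 := (hF.nvar 4 (by simp)).trans hK
    have hN : τ.narr 0 = σ.narr 0 := hF.narr 0 (by simp)
    have h3 : τ.rarr 3 = q := hF.rarr 3 (by simp)
    have h1 : τ.rarr 1 = s := hF.rarr 1 (by simp)
    refine WP.seq_le ((Nat.log 2 n + 1) * (30 + 70) + 20)
      ((Nat.log 2 n + 1) * 200 + 80) (by omega) ?_
    refine (searchP_spec (c := u i) (tc := 30) (.inl rfl) h0 h4 hn0 (by rw [hN]; exact hpw)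
      (cntLt_le _ _ _) (by decide) ?_ ?_).mono le_rfl ?_
    · intro υ hυ hlt
      simp only [CExp.eval_not, CExp.eval_rle, RExp.eval, NExp.eval, hυ.rarr 1 (by simp),
        hυ.rarr 3 (by simp), h1, h3, hυ.nvar 5 (by simp), h5, CExp.one_le_ite]
      rw [← lt_iff_lt_cntLt hq hlt]
      by_cases h : s i ≤ q (υ.nvar 6 + υ.nvar 9 - 1)
      · simp [h]
      · simp [h, not_le.1 h]
    · intro υ; simp [CExp.cost, CExp.not, RExp.cost, NExp.cost]
    rintro υ ⟨hFυ, h6⟩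
    have g0 : υ.nvar 0 = n := (hFυ.nvar 0 (by simp)).trans h0
    have g4 : υ.nvar 4 = Nat.log 2 n + 1 := (hFυ.nvar 4 (by simp)).trans h4
    have g5 : υ.nvar 5 = i := (hFυ.nvar 5 (by simp)).trans h5
    have gN : υ.narr 0 = σ.narr 0 := (hFυ.narr 0 (by simp)).trans hN
    have g3 : υ.rarr 3 = q := (hFυ.rarr 3 (by simp)).trans h3
    have g1 : υ.rarr 1 = s := (hFυ.rarr 1 (by simp)).trans h1
    refine WP.seq_le ((Nat.log 2 n + 1) * (30 + 70) + 20)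
      ((Nat.log 2 n + 1) * 100 + 60) (by omega) ?_
    refine (searchP_spec (c := v i) (tc := 30) (.inr rfl) g0 g4 hn0 (by rw [gN]; exact hpw)
      (cntLe_le _ _ _) (by decide) ?_ ?_).mono le_rfl ?_
    · intro ω hω hlt
      simp only [CExp.eval_rle, RExp.eval, NExp.eval, hω.rarr 1 (by simp),
        hω.rarr 3 (by simp), g1, g3, hω.nvar 5 (by simp), g5, CExp.one_le_ite]
      rw [← le_iff_lt_cntLe hq hlt]
      simp
    · intro ω; simp [CExp.cost, RExp.cost, NExp.cost]
    rintro ω ⟨hFω, h7⟩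
    have k5 : ω.nvar 5 = i := (hFω.nvar 5 (by simp)).trans g5
    have k6 : ω.nvar 6 = u i := (hFω.nvar 6 (by simp)).trans h6
    have k1 : ω.rarr 1 = s := (hFω.rarr 1 (by simp)).trans g1
    have kU : ω.narr 1 = τ.narr 1 := (hFω.narr 1 (by simp)).trans (hFυ.narr 1 (by simp))
    have kV : ω.narr 2 = τ.narr 2 := (hFω.narr 2 (by simp)).trans (hFυ.narr 2 (by simp))
    have kX : ω.rarr 4 = τ.rarr 4 := (hFω.rarr 4 (by simp)).trans (hFυ.rarr 4 (by simp))
    have hF' : Fr [5, 6, 7, 8, 9] [1, 2] [4] σ ω :=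
      (hF.trans (hFυ.mono (by simp) (by simp) (by simp))).trans
        (hFω.mono (by simp) (by simp) (by simp))
    rw [← kU, ← kV, ← kX] at hI
    refine WP.ifX (u := 60) (by decide) ?_ ?_ (by simp [CExp.cost, CExp.lt]; omega)
    · intro hlt
      simp only [CExp.eval_lt, CExp.eval_var, k6, h7, CExp.one_le_ite] at hlt
      refine WP.seq_le 20 40 (by norm_num) ?_
      refine WP.stR (by decide) (by decide) ?_ (by simp [CExp.cost, RExp.cost, NExp.cost])
      refine WP.seq_le 20 20 (by norm_num) ?_
      refine WP.stN (by decide) (by decide) ?_ (by simp [CExp.cost])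
      refine WP.stN (by decide) (by decide) ?_ (by simp [CExp.cost])
      refine ⟨by simpa using k5, (((hF'.setReal (by simp) _ _).setNat (by simp) _ _).setNat
        (by simp) _ _).setVar (by simp) _, by simp, fun k => ?_⟩
      simp only [narr_setVar, rarr_setVar, narr_setNat_apply, rarr_setNat, rarr_setReal_apply,
        CExp.eval_add, CExp.eval_var, nvar_setNat, nvar_setReal, narr_setReal, k6, h7, true_and,
        RExp.eval, NExp.eval, k5, k1, show (1 : ℕ) ≠ 2 by norm_num, false_and, if_false,
        show (2 : ℕ) ≠ 1 by norm_num]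
      by_cases hk : k = u i + v i
      · right
        exact ⟨i, by omega, hlt, hk.symm, by simp [hk], by simp [hk], by simp [hk]⟩
      · simp only [hk, if_false]
        rcases hI k with ⟨a1, a2, a3⟩ | ⟨j, hj, hj'⟩
        · refine .inl ⟨a1, a2, fun j hj hjv => ?_⟩
          rcases Nat.lt_succ_iff_lt_or_eq.1 hj with h' | rfl
          · exact a3 j h' hjv
          · exact Ne.symm hk
        · exact .inr ⟨j, by omega, hj'⟩
    · intro hlt
      simp only [CExp.eval_lt, CExp.eval_var, k6, h7, CExp.one_le_ite] at hlt
      refine WP.skip ⟨k5, hF'.setVar (by simp) _, by simp, fun k => ?_⟩ (by norm_num)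
      rcases hI k with ⟨a1, a2, a3⟩ | ⟨j, hj, hj'⟩
      · refine .inl ⟨a1, a2, fun j hj hjv => ?_⟩
        rcases Nat.lt_succ_iff_lt_or_eq.1 hj with h' | rfl
        · exact a3 j h' hjv
        · exact absurd hjv hlt
      · exact .inr ⟨j, by omega, hj'⟩
  · rintro τ ⟨hF, -, hI⟩
    have hE : ∀ k ∈ keys n (τ.narr 1) (τ.narr 2), ∃ j < m, u j < v j ∧ u j + v j = k ∧
        τ.rarr 4 k = s j ∧ τ.narr 1 k = u j ∧ τ.narr 2 k = v j := by
      intro k hk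
      have hk' := (mem_filter.1 hk).2
      rcases hI k with ⟨a1, a2, -⟩ | h
      · omega
      · exact h
    refine ⟨hF, ⟨?_, ?_, ?_, ?_, ?_, ?_⟩⟩
    · intro k hk
      obtain ⟨j, hj, -, -, h, -⟩ := hE k hk
      exact ⟨j, hj, h⟩
    · intro k hk
      obtain ⟨j, hj, -, -, h, h', -⟩ := hE k hk
      rw [h, h']
    · intro k hk
      obtain ⟨j, hj, -, -, h, -, h'⟩ := hE k hk
      rw [h, h']
    · intro k hk
      exact (mem_filter.1 hk).2
    · intro k hk
      obtain ⟨j, hj, -, hk', -, h, h'⟩ := hE k hk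
      omega
    · intro j hj hlt
      rcases hI (u j + v j) with ⟨-, -, h⟩ | ⟨j', hj', h1, h2, h3, h4, h5⟩
      · exact absurd rfl (h j hj hlt)
      · have h6 := cntLt_le n q (s j)
        have h7 := cntLe_le n q (s j + 1)
        refine mem_filter.2 ⟨mem_range.2 (by omega), ?_⟩
        show τ.narr 1 (u j + v j) < τ.narr 2 (u j + v j)
        omega
  · simp only [NExp.cost]
    nlinarith [Nat.zero_le (m * Nat.log 2 n)]

end RealRAM

/-! ### Windows, pieces and chunks -/

namespace RealRAM

open Finset DiscCode

/-- Grouping of the intervals into windows: the array `3` receives the numbers of the windows,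
the real arrays `5` and `6` their left endpoints and the residues. -/
def windowP : Prog :=
  .seq (asg 3 (.add (.add (.var 0) (.var 0)) (.lit 1)))
  (.seq (asg 10 (.lit 0))
  (.seq (stR 5 (.lit 0) (.sub (.get 3 (.lit 0)) (.lit 3)))
  (forX 5 (.var 3)
    (ifX (.lt (.at 1 5) (.at 2 5))
      (.seq
        (ifX (.rle (.add (.at 5 10) (.lit 1)) (.at 4 5))
          (.seq
            (ifX (.rle (.add (.at 5 10) (.lit 2)) (.at 4 5))
              (stR 5 (.add (.var 10) (.lit 1)) (.at 4 5))
              (stR 5 (.add (.var 10) (.lit 1)) (.add (.at 5 10) (.lit 1))))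
            (asg 10 (.add (.var 10) (.lit 1))))
          .skip)
      (.seq (stN 3 (.var 5) (.var 10))
        (stR 6 (.var 5) (.sub (.at 4 5) (.at 5 10)))))
      .skip))))

/-- The windows found for the intervals with keys less than `i`. -/
structure WindowInv (E : Finset ℕ) (X : ℕ → ℝ) (q0 : ℝ) (i : ℕ) (W : ℕ → ℕ) (A R : ℕ → ℝ)
    (ω : ℕ) : Prop where
  le : ∀ k ∈ E, k < i → W k ≤ ω ∧ A (W k) ≤ X k ∧ X k < A (W k) + 1 ∧ R k = X k - A (W k)
  step : ∀ b < ω, A (b + 1) = A b + 1 ∨ A b + 2 ≤ A (b + 1)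
  surj : ∀ b, 1 ≤ b → b ≤ ω → ∃ k ∈ E, k < i ∧ W k = b
  zero : ω = 0 → A 0 = q0 - 3
  bound : ω ≤ i

/-- Consecutive windows advance by at least one, so windows that are not consecutive differ by at
least two. Contiguity concerns only windows with a nonempty predecessor, hence numbers at least 1,
and `surj` supplies an interval for each of these. -/
theorem WindowInv.windowing {n m N : ℕ} {q s X : ℕ → ℝ} {U V W : ℕ → ℕ} {E : Finset ℕ}
    {A R : ℕ → ℝ} {ω : ℕ} {q0 : ℝ} (I : WindowInv E X q0 N W A R ω) (hE : ∀ k ∈ E, k < N)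
    (H : KeyTable n m q s E X U V) (hq : ∀ i j, i < j → j < n → q i < q j) :
    Windowing n q E X U V W A := by
  have hle1 : ∀ b c, b + c ≤ ω → A b + c ≤ A (b + c) := by
    intro b c
    induction c with
    | zero => intro _; simp
    | succ c ih =>
      intro h
      have h1 := ih (by omega)
      push_cast
      rw [← add_assoc b c 1]
      rcases I.step (b + c) (by omega) with h2 | h2 <;> linarith
  refine ⟨cntLe_le_cntLt_succ hq, H.U_eq, H.V_eq, fun k hk => (I.le k hk (hE k hk)).2.1,
    fun k hk => (I.le k hk (hE k hk)).2.2.1, fun k _ k' hk' h => ?_, ?_⟩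
  · have hω := (I.le k' hk' (hE k' hk')).1
    obtain ⟨c, hc⟩ := Nat.exists_eq_add_of_lt h
    rcases Nat.eq_zero_or_pos c with rfl | hpos
    · rw [hc]
      exact I.step (W k) (by omega)
    · right
      have h1 := hle1 (W k) (c + 1) (by omega)
      rw [show W k + (c + 1) = W k' by omega] at h1
      have : (1 : ℝ) ≤ c := by exact_mod_cast hpos
      push_cast at h1
      linarith
  · rintro b ⟨k, hk, hkb⟩ ⟨k', hk', hbk'⟩
    have hω := (I.le k' hk' (hE k' hk')).1
    obtain ⟨k₀, hk₀, -, h⟩ := I.surj b (by omega) (by omega)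
    exact ⟨k₀, hk₀, h⟩

theorem windowP_spec {n m : ℕ} {σ : Store} {s : ℕ → ℝ} (hn : σ.nvar 0 = n) (hn0 : 0 < n)
    (hq : ∀ i j, i < j → j < n → σ.rarr 3 i < σ.rarr 3 j)
    (H : KeyTable n m (σ.rarr 3) s (keys n (σ.narr 1) (σ.narr 2)) (σ.rarr 4) (σ.narr 1)
      (σ.narr 2)) :
    WP windowP (900 * n) σ fun τ => Fr [3, 5, 10] [3] [5, 6] σ τ ∧ τ.nvar 3 = 2 * n + 1 ∧
      Windowing n (σ.rarr 3) (keys n (σ.narr 1) (σ.narr 2)) (σ.rarr 4) (σ.narr 1) (σ.narr 2)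
        (τ.narr 3) (τ.rarr 5) ∧
      ∀ k ∈ keys n (σ.narr 1) (σ.narr 2), τ.narr 3 k ≤ 2 * n + 1 ∧
        τ.rarr 6 k = Windowing.residue (σ.rarr 4) (τ.rarr 5) (τ.narr 3) k := by
  set E := keys n (σ.narr 1) (σ.narr 2) with hE
  set X := σ.rarr 4 with hX
  set q := σ.rarr 3 with hqd
  have hEN : ∀ k ∈ E, k < 2 * n + 1 := fun k hk => mem_range.1 (mem_filter.1 hk).1
  -- An interval containing a point ends no earlier than the first point. So the initial window at q
  -- 0 - 3 is an empty sentinel: the first interval is at least two to its right and opens a new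
  -- window.
  have hXq : ∀ k ∈ E, q 0 - 1 ≤ X k := by
    intro k hk
    have h1 := H.U_lt_V k hk
    rw [H.V_eq k hk] at h1
    have := (le_iff_lt_cntLe hq hn0 (X k + 1)).2 (by omega)
    linarith
  refine WP.seq_le 20 (900 * n - 20) (by omega) ?_
  refine WP.asg (by decide) ?_ (by simp [CExp.cost])
  refine WP.seq_le 5 (900 * n - 25) (by omega) ?_
  refine WP.asg (by decide) ?_ (by simp [CExp.cost])
  refine WP.seq_le 15 (900 * n - 40) (by omega) ?_
  refine WP.stR (by decide) (by decide) ?_ (by simp [CExp.cost, RExp.cost, NExp.cost])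
  refine WP.forX (2 * n + 1) 200 (fun i τ => Fr [3, 5, 10] [3] [5, 6] σ τ ∧
    τ.nvar 3 = 2 * n + 1 ∧ τ.nvar 5 = i ∧
    WindowInv E X (q 0) i (τ.narr 3) (τ.rarr 5) (τ.rarr 6) (τ.nvar 10)) (by norm_num)
    (by decide) ?_ ?_ ?_ ?_ (by simp only [NExp.cost]; omega)
  · refine ⟨((((Fr.refl ..).setVar (by simp) _).setVar (by simp) _).setReal (by simp) _ _).setVar
      (by simp) _, ?_, by simp, ?_⟩
    · simp [hn]; ring
    · constructor
      · intro k _ hk; omega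
      · intro b hb; simp at hb
      · intro b hb hb'; simp at hb'; omega
      · intro _; simp [RExp.eval, NExp.eval, hqd]
      · simp
  · rintro i τ ⟨hF, h3, h5, -⟩
    exact ⟨h5, h3⟩
  · rintro i hi τ ⟨hF, h3, h5, hI⟩
    have hU : τ.narr 1 = σ.narr 1 := hF.narr 1 (by simp)
    have hV : τ.narr 2 = σ.narr 2 := hF.narr 2 (by simp)
    have hX4 : τ.rarr 4 = X := hF.rarr 4 (by simp)
    refine WP.ifX (u := 170) (by decide) ?_ ?_ (by simp [CExp.cost, CExp.lt])
    · intro hlt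
      simp only [CExp.eval_lt, CExp.eval_get, CExp.eval_var, h5, hU, hV, CExp.one_le_ite] at hlt
      have hiE : i ∈ E := mem_filter.2 ⟨mem_range.2 hi, hlt⟩
      have hAX : τ.rarr 5 (τ.nvar 10) ≤ X i := by
        rcases Nat.eq_zero_or_pos (τ.nvar 10) with h0 | h0
        · rw [h0, hI.zero h0]; linarith [hXq i hiE]
        · obtain ⟨k, hk, hki, hkb⟩ := hI.surj _ h0 le_rfl
          have := (hI.le k hk hki).2.1
          rw [hkb] at this
          exact this.trans (H.X_lt hk hiE hki).le
      -- Both ways to open a window are completed by the same steps. Here z is its left end: one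
      -- after the old left end if the interval starts before old + 2, and the left endpoint of the
      -- interval itself otherwise.
      have hnew : ∀ (υ : Store) (z : ℝ), υ = (τ.setReal 5 (τ.nvar 10 + 1) z).setVar 10
          (τ.nvar 10 + 1) → (z = τ.rarr 5 (τ.nvar 10) + 1 ∨ τ.rarr 5 (τ.nvar 10) + 2 ≤ z) →
          z ≤ X i → X i < z + 1 →
          WP (.seq (stN 3 (.var 5) (.var 10)) (stR 6 (.var 5) (.sub (.at 4 5) (.at 5 10)))) 40 υ
            fun τ' => τ'.nvar 5 = i ∧ Fr [3, 5, 10] [3] [5, 6] σ (τ'.setVar 5 (i + 1)) ∧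
              (τ'.setVar 5 (i + 1)).nvar 3 = 2 * n + 1 ∧ (τ'.setVar 5 (i + 1)).nvar 5 = i + 1 ∧
              WindowInv E X (q 0) (i + 1) ((τ'.setVar 5 (i + 1)).narr 3)
                ((τ'.setVar 5 (i + 1)).rarr 5) ((τ'.setVar 5 (i + 1)).rarr 6)
                ((τ'.setVar 5 (i + 1)).nvar 10) := by
        rintro υ z rfl hz hzX hXz
        refine WP.seq_le 10 30 (by norm_num) ?_
        refine WP.stN (by decide) (by decide) ?_ (by simp [CExp.cost])
        refine WP.stR (by decide) (by decide) ?_ (by simp [CExp.cost, RExp.cost, NExp.cost])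
        refine ⟨by simpa using h5, ((((hF.setReal (by simp) _ _).setVar (by simp) _).setNat
          (by simp) _ _).setReal (by simp) _ _).setVar (by simp) _, by simpa using h3,
          by simp, ?_⟩
        constructor
        · intro k hk hki
          simp only [narr_setVar, narr_setReal, narr_setNat_apply, rarr_setVar, rarr_setReal_apply,
            rarr_setNat, nvar_setVar, nvar_setReal, nvar_setNat, CExp.eval_var, RExp.eval,
            NExp.eval, h5, hX4, true_and]
          norm_num
          by_cases hke : k = i
          · subst hke
            simp [hzX, hXz]
          · obtain ⟨h1, h2, h3, h4⟩ := hI.le k hk (by omega)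
            have h5 : τ.narr 3 k ≠ τ.nvar 10 + 1 := by omega
            simp only [hke, if_false, h5]
            exact ⟨by omega, h2, h3, h4⟩
        · intro b hb
          simp at hb ⊢
          by_cases hbe : b = τ.nvar 10
          · subst hbe; simpa using hz
          · rw [if_neg hbe, if_neg (by omega)]
            exact hI.step b (by omega)
        · intro b hb hb'
          simp at hb' ⊢
          by_cases hbe : b = τ.nvar 10 + 1
          · exact ⟨i, hiE, by omega, by simp [h5, hbe]⟩
          · obtain ⟨k, hk, hki, hkb⟩ := hI.surj b hb (by omega)
            refine ⟨k, hk, by omega, ?_⟩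
            rw [if_neg (by omega), hkb]
        · intro h; simp at h
        · have := hI.bound
          simp; omega
      refine WP.seq_le 100 40 (by norm_num) ?_
      refine WP.ifX (u := 60) (by decide) ?_ ?_ (by simp [CExp.cost, RExp.cost, NExp.cost])
      · intro h
        simp only [CExp.eval_rle, RExp.eval, NExp.eval, h5, hX4, CExp.one_le_ite] at h
        refine WP.seq_le 45 15 (by norm_num) ?_
        refine WP.ifX (u := 20) (by decide) ?_ ?_ (by simp [CExp.cost, RExp.cost, NExp.cost])
        · intro h'
          simp only [CExp.eval_rle, RExp.eval, NExp.eval, h5, hX4, CExp.one_le_ite] at h'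
          refine WP.stR (by decide) (by decide) ?_ (by simp [CExp.cost, RExp.cost, NExp.cost])
          refine WP.asg (by decide) ?_ (by simp [CExp.cost])
          refine hnew _ (X i) (by simp [RExp.eval, NExp.eval, h5, hX4]) (.inr ?_) le_rfl
            (by linarith)
          push_cast at h'; exact h'
        · intro h'
          simp only [CExp.eval_rle, RExp.eval, NExp.eval, h5, hX4, CExp.one_le_ite] at h'
          refine WP.stR (by decide) (by decide) ?_ (by simp [CExp.cost, RExp.cost, NExp.cost])
          refine WP.asg (by decide) ?_ (by simp [CExp.cost])
          push_cast at h h'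
          exact hnew _ (τ.rarr 5 (τ.nvar 10) + 1) (by simp [RExp.eval, NExp.eval]) (.inl rfl) h
            (by linarith)
      · intro h
        simp only [CExp.eval_rle, RExp.eval, NExp.eval, h5, hX4, CExp.one_le_ite] at h
        push_cast at h
        refine WP.skip ?_ (by norm_num)
        refine WP.seq_le 10 30 (by norm_num) ?_
        refine WP.stN (by decide) (by decide) ?_ (by simp [CExp.cost])
        refine WP.stR (by decide) (by decide) ?_ (by simp [CExp.cost, RExp.cost, NExp.cost])
        refine ⟨by simpa using h5, ((hF.setNat (by simp) _ _).setReal (by simp) _ _).setVar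
          (by simp) _, by simpa using h3, by simp, ?_⟩
        constructor
        · intro k hk hki
          simp only [narr_setVar, narr_setReal, narr_setNat_apply, rarr_setVar, rarr_setReal_apply,
            rarr_setNat, nvar_setVar, nvar_setReal, nvar_setNat, CExp.eval_var, RExp.eval,
            NExp.eval, h5, hX4, true_and]
          norm_num
          by_cases hke : k = i
          · subst hke
            simp [hAX, not_le.1 h]
          · obtain ⟨h1, h2, h3, h4⟩ := hI.le k hk (by omega)
            simp only [hke, if_false]
            exact ⟨h1, h2, h3, h4⟩
        · intro b hb
          simp at hb ⊢
          exact hI.step b hb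
        · intro b hb hb'
          simp at hb' ⊢
          obtain ⟨k, hk, hki, hkb⟩ := hI.surj b hb hb'
          refine ⟨k, hk, by omega, ?_⟩
          rw [if_neg (by omega), hkb]
        · intro h; simp at h ⊢; exact hI.zero h
        · have := hI.bound
          simp; omega
    · intro hlt
      simp only [CExp.eval_lt, CExp.eval_get, CExp.eval_var, h5, hU, hV, CExp.one_le_ite] at hlt
      have hiE : ∀ k ∈ E, k < i + 1 → k < i := by
        intro k hk hki
        have h1 := (mem_filter.1 hk).2
        have : k ≠ i := by rintro rfl; exact hlt h1
        omega
      refine WP.skip ⟨h5, hF.setVar (by simp) _, by simpa using h3, by simp, ?_⟩ (by norm_num)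
      constructor
      · intro k hk hki; simpa using hI.le k hk (hiE k hk hki)
      · simpa using hI.step
      · intro b hb hb'
        simp at hb' ⊢
        obtain ⟨k, hk, hki, hkb⟩ := hI.surj b hb hb'
        exact ⟨k, hk, by omega, hkb⟩
      · simpa using hI.zero
      · have := hI.bound
        simp; omega
  · rintro τ ⟨hF, h3, -, hI⟩
    refine ⟨hF, h3, hI.windowing hEN H hq, fun k hk => ?_⟩
    obtain ⟨h1, -, -, h2⟩ := hI.le k hk (hEN k hk)
    exact ⟨h1.trans hI.bound, h2⟩

end RealRAM

/-! ### Division by counting, the best offset, and the numbers of the chunks -/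

namespace RealRAM

open Finset DiscCode

/-- The quotient of the value of `e` by the number `L`. -/
def divX (L : ℕ) (e : CExp) : CExp :=
  .sum 41 (.add (.var 3) (.lit 2)) (.le (.sum 42 (.lit L) (.add (.var 41) (.lit 1))) e)

theorem card_mul_succ_le {L : ℕ} (hL : 0 < L) (x M : ℕ) :
    #{j ∈ range M | L * (j + 1) ≤ x} = min (x / L) M := by
  have : ({j ∈ range M | L * (j + 1) ≤ x} : Finset ℕ) = range (min (x / L) M) := by
    ext j
    simp only [mem_filter, mem_range, lt_min_iff]
    have := Nat.le_div_iff_mul_le hL (x := j + 1) (y := x)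
    rw [mul_comm] at this
    rw [← this, Nat.succ_le_iff, and_comm]
  rw [this, card_range]

/-- The quotient is the number of j with L * (j + 1) ≤ x, where the product is a sum of L terms. The
search is cut off at N + 2, and callers verify that their quotients stay below. -/
theorem divX_eval {L x N : ℕ} {e : CExp} {τ : Store} (hL : 0 < L) (hN : τ.nvar 3 = N)
    (he : ∀ i, e.eval (τ.setVar 41 i) = x) :
    (divX L e).eval τ = min (x / L) (N + 2) := by
  rw [← card_mul_succ_le hL, card_filter]
  simp only [divX, CExp.eval_sum, CExp.eval_add, CExp.eval_var, CExp.eval_lit, CExp.eval_le, he,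
    nvar_setVar, show (41 : ℕ) ≠ 42 by norm_num, if_true, if_false, sum_const, card_range,
    smul_eq_mul, hN]

theorem divX_cost {L N ce : ℕ} {e : CExp} {τ : Store} (hN : τ.nvar 3 = N)
    (he : ∀ i, e.cost (τ.setVar 41 i) ≤ ce) :
    (divX L e).cost τ ≤ (N + 2) * (22 * L + ce + 32) + 18 := by
  have : ∀ i, CExp.cost (.le (.sum 42 (.lit L) (.add (.var 41) (.lit 1))) e) (τ.setVar 41 i) + 14
      ≤ 22 * L + ce + 32 := by
    intro i
    have := he i
    simp only [CExp.cost, CExp.eval_lit, sum_const, card_range, smul_eq_mul]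
    omega
  have h2 := sum_le_card_nsmul (range (N + 2)) _ _ fun i _ => this i
  rw [card_range, smul_eq_mul] at h2
  simp only [divX]
  rw [CExp.cost]
  simp only [CExp.eval_add, CExp.eval_var, CExp.eval_lit, hN]
  have h3 : CExp.cost (.add (.var 3) (.lit 2)) τ = 8 := by simp [CExp.cost]
  omega

/-- The test that an interval is stored at the key `x`. -/
def validX (x : ℕ) : CExp := .lt (.at 1 x) (.at 2 x)

/-- Determination of the offset that leaves the fewest intervals in the first windows of the
pieces; it is stored in the variable `12`. -/
def offsetP (L : ℕ) : Prog :=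
  .seq (forX 5 (.var 3) (stN 9 (.var 5) (divX L (.at 3 5))))
  (.seq (asg 11 (.add (.var 3) (.lit 1)))
  (.seq (asg 12 (.lit 0))
  (forX 6 (.lit L)
    (.seq (asg 13 (.sum 40 (.var 3) (.and (validX 40)
        (.eq (.at 3 40) (.add (.sum 43 (.lit L) (.at 9 40)) (.var 6))))))
      (ifX (.lt (.var 13) (.var 11)) (.seq (asg 11 (.var 13)) (asg 12 (.var 6))) .skip)))))

theorem mod_eq_iff_eq_mul_div_add {w L i : ℕ} (hi : i < L) : w % L = i ↔ w = L * (w / L) + i := by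
  constructor
  · rintro rfl; exact (Nat.div_add_mod w L).symm
  · intro h; rw [h, Nat.mul_add_mod, Nat.mod_eq_of_lt hi]

theorem sum_card_mod_eq (E : Finset ℕ) (w : ℕ → ℕ) {L : ℕ} (hL : 0 < L) :
    ∑ i ∈ range L, #{k ∈ E | w k % L = i} = #E :=
  (card_eq_sum_card_fiberwise fun k _ => by simpa using Nat.mod_lt (w k) hL).symm

theorem offsetP_spec {n L : ℕ} {σ : Store} (hn0 : 0 < n) (hL : 0 < L)
    (h3 : σ.nvar 3 = 2 * n + 1)
    (hW : ∀ k ∈ keys n (σ.narr 1) (σ.narr 2), σ.narr 3 k ≤ 2 * n + 1) :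
    WP (offsetP L) (2000 * L ^ 2 * n ^ 2) σ fun τ =>
      Fr [5, 6, 11, 12, 13] [9] [] σ τ ∧ τ.nvar 12 < L ∧
        L * #{k ∈ keys n (σ.narr 1) (σ.narr 2) | σ.narr 3 k % L = τ.nvar 12} ≤
          #(keys n (σ.narr 1) (σ.narr 2)) := by
  set E := keys n (σ.narr 1) (σ.narr 2) with hE
  set w := σ.narr 3 with hw
  set N := 2 * n + 1 with hNdef
  have hEN : #E ≤ N := (card_filter_le _ _).trans (by simp [hNdef])
  have hbudget : N * ((N + 2) * (22 * L + 37) + 33) + 8 + (10 + (4 +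
      (L * (N * (38 * L + 106) + 64) + 8))) ≤ 2000 * L ^ 2 * n ^ 2 := by
    -- After shifting n and L to start from zero, both sides are polynomials with nonnegative
    -- coefficients, and the inequality follows by comparing monomials.
    obtain ⟨a, rfl⟩ : ∃ a, n = a + 1 := ⟨n - 1, by omega⟩
    obtain ⟨b, rfl⟩ : ∃ b, L = b + 1 := ⟨L - 1, by omega⟩
    rw [hNdef]
    ring_nf
    omega
  refine WP.seq_le _ _ hbudget ?_
  apply WP.mapN N ((N + 2) * (22 * L + 37) + 18) (fun k => min (w k / L) (N + 2)) (by norm_num)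
    (by decide) (by simp [divX, CExp.ok]; decide)
  · intro τ hF; exact (hF.nvar 3 (by simp)).trans h3
  · intro τ hF k hk h5
    have hN : τ.nvar 3 = N := (hF.nvar 3 (by simp)).trans h3
    have hwτ : τ.narr 3 = w := hF.narr 3 (by simp)
    exact ⟨divX_eval hL hN fun i => by simp [h5, hwτ], divX_cost hN fun i => by simp [CExp.cost]⟩
  swap
  · simp only [NExp.cost]; linarith
  intro τ hF hD
  refine WP.seq_le 10 _ le_rfl ?_
  refine WP.asg (by decide) ?_ (by simp [CExp.cost])
  refine WP.seq_le 4 _ le_rfl ?_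
  refine WP.asg (by decide) ?_ (by simp [CExp.cost])
  have h3τ : τ.nvar 3 = N := (hF.nvar 3 (by simp)).trans h3
  -- The best count starts at N + 1, above every possible count, so that the first residue class is
  -- always accepted.
  apply WP.forX L (N * (38 * L + 106) + 54) (fun i υ => Fr [5, 6, 11, 12, 13] [] [] τ υ ∧
    υ.nvar 6 = i ∧ (i = 0 → υ.nvar 11 = N + 1) ∧
    (0 < i → υ.nvar 12 < i ∧ υ.nvar 11 = #{k ∈ E | w k % L = υ.nvar 12}) ∧
    ∀ j < i, υ.nvar 11 ≤ #{k ∈ E | w k % L = j}) (by norm_num) rfl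
  · refine ⟨(((Fr.refl ..).setVar (by simp) _).setVar (by simp) _).setVar (by simp) _, by simp,
      by simp [h3τ], by simp, by simp⟩
  · rintro i υ ⟨-, h6, -⟩
    exact ⟨h6, rfl⟩
  · rintro i hi υ ⟨hFυ, h6, hz, hb, hm⟩
    have h3υ : υ.nvar 3 = N := (hFυ.nvar 3 (by simp)).trans h3τ
    have hU : υ.narr 1 = σ.narr 1 := (hFυ.narr 1 (by simp)).trans (hF.narr 1 (by simp))
    have hV : υ.narr 2 = σ.narr 2 := (hFυ.narr 2 (by simp)).trans (hF.narr 2 (by simp))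
    have hw3 : υ.narr 3 = w := (hFυ.narr 3 (by simp)).trans (hF.narr 3 (by simp))
    have h12 : υ.nvar 11 ≤ N + 1 ∧ (υ.nvar 11 = N + 1 ∨ 0 < i) := by
      rcases Nat.eq_zero_or_pos i with h | h
      · exact ⟨(hz h).le, .inl (hz h)⟩
      · refine ⟨?_, .inr h⟩
        rw [(hb h).2]
        exact (card_filter_le _ _).trans (by omega)
    have hcnt : (CExp.sum 40 (.var 3) (.and (validX 40)
        (.eq (.at 3 40) (.add (.sum 43 (.lit L) (.at 9 40)) (.var 6))))).eval υ =
        #{k ∈ E | w k % L = i} := by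
      rw [hE, keys, filter_filter, card_filter]
      simp only [CExp.eval_sum, CExp.eval_var, h3υ, CExp.eval_and, validX, CExp.eval_lt,
        CExp.eval_get, CExp.eval_eq, CExp.eval_add, CExp.eval_lit, nvar_setVar, narr_setVar,
        if_true, show (6 : ℕ) ≠ 40 by norm_num, show (40 : ℕ) ≠ 43 by norm_num, if_false,
        sum_const, card_range, smul_eq_mul, hU, hV, hw3, h6, CExp.one_le_ite]
      refine sum_congr rfl fun k hk => ?_
      by_cases hv : σ.narr 1 k < σ.narr 2 k
      · have hkE : k ∈ E := mem_filter.2 ⟨hk, hv⟩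
        have hDk : υ.narr 9 k = w k / L := by
          rw [hFυ.narr 9 (by simp), hD k (mem_range.1 hk)]
          have := Nat.div_le_self (w k) L
          have := hW k hkE
          exact min_eq_left (by omega)
        simp only [hv, if_true, true_and, hDk]
        have := mod_eq_iff_eq_mul_div_add (w := w k) hi
        by_cases h : w k % L = i
        · rw [if_pos h, if_pos (this.1 h)]
        · rw [if_neg h, if_neg fun h' => h (this.2 h')]
      · simp [hv]
    refine WP.seq_le (N * (38 * L + 106) + 14) 40 (by omega) ?_
    refine WP.asg (by simp [validX, CExp.ok, CExp.and, CExp.eq, CExp.lt, isProgVar]) ?_ ?_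
    swap
    · simp only [validX, CExp.cost, CExp.and, CExp.eq, CExp.lt, CExp.eval_var, CExp.eval_lit,
        sum_const, card_range, smul_eq_mul, h3υ]
      ring_nf
      omega
    rw [hcnt]
    refine WP.ifX (u := 12) (by decide) ?_ ?_ (by simp [CExp.cost, CExp.lt])
    · intro hlt
      simp only [CExp.eval_lt, CExp.eval_var, nvar_setVar, if_true, show (11 : ℕ) ≠ 13 by norm_num,
        if_false, CExp.one_le_ite] at hlt
      refine WP.seq_le 4 4 (by norm_num) ?_
      refine WP.asg (by decide) ?_ (by simp [CExp.cost])
      refine WP.asg (by decide) ?_ (by simp [CExp.cost])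
      refine ⟨by simp [h6], (((hFυ.setVar (by simp) _).setVar (by simp) _).setVar
        (by simp) _).setVar (by simp) _, by simp, by simp, fun _ => by simp [h6], fun j hj => ?_⟩
      simp
      rcases Nat.lt_succ_iff_lt_or_eq.1 hj with h | rfl
      · exact hlt.le.trans (hm j h)
      · exact le_rfl
    · intro hlt
      simp only [CExp.eval_lt, CExp.eval_var, nvar_setVar, if_true, show (11 : ℕ) ≠ 13 by norm_num,
        if_false, CExp.one_le_ite] at hlt
      have hcN : #{k ∈ E | w k % L = i} ≤ #E := card_filter_le _ _
      have hi0 : 0 < i := by omega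
      obtain ⟨hb1, hb2⟩ := hb hi0
      refine WP.skip ⟨by simp [h6], (hFυ.setVar (by simp) _).setVar (by simp) _, by simp, by simp,
        fun _ => ?_, fun j hj => ?_⟩ (by norm_num)
      · simp
        exact ⟨by omega, hb2⟩
      · simp
        rcases Nat.lt_succ_iff_lt_or_eq.1 hj with h | rfl
        · exact hm j h
        · omega
  · rintro υ ⟨hFυ, -, -, hb, hm⟩
    obtain ⟨hb1, hb2⟩ := hb hL
    refine ⟨(hF.mono (by simp) (by simp) (by simp)).trans
      (hFυ.mono (by simp) (by simp) (by simp)), hb1, ?_⟩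
    -- The residue classes partition E, so the smallest of the L classes has at most the average
    -- size.
    rw [← hb2, ← sum_card_mod_eq E w hL]
    have := card_nsmul_le_sum (range L) (fun i => #{k ∈ E | w k % L = i}) (υ.nvar 11)
      fun i hi => hm i (mem_range.1 hi)
    simpa using this
  · simp only [NExp.cost]; linarith

/-- Computation of the pieces (array `4`), the ranks (array `10`) and the chunks (array `5`). -/
def chunkP (L : ℕ) : Prog :=
  .seq (forX 5 (.var 3) (stN 4 (.var 5) (divX L (.add (.at 3 5) (.sub (.lit L) (.var 12))))))
  (.seq (forX 5 (.var 3) (stN 10 (.var 5) (.sum 40 (.var 3) (.and (validX 40)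
      (.and (.eq (.at 4 40) (.at 4 5))
        (.ite (.rle (.at 6 5) (.at 6 40)) (.and (.rle (.at 6 40) (.at 6 5)) (.lt (.var 40) (.var 5)))
          (.lit 1)))))))
  (forX 5 (.var 3) (stN 5 (.var 5) (divX (L ^ 2) (.at 10 5)))))

theorem chunkP_spec {n L o : ℕ} {σ : Store} {X A : ℕ → ℝ} (hn0 : 0 < n) (ho : o < L)
    (h3 : σ.nvar 3 = 2 * n + 1) (h12 : σ.nvar 12 = o)
    (hW : ∀ k ∈ keys n (σ.narr 1) (σ.narr 2), σ.narr 3 k ≤ 2 * n + 1 ∧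
      σ.rarr 6 k = Windowing.residue X A (σ.narr 3) k) :
    WP (chunkP L) (4000 * L ^ 2 * n ^ 2) σ fun τ => Fr [5] [4, 5, 10] [] σ τ ∧
      ∀ k ∈ keys n (σ.narr 1) (σ.narr 2), (τ.narr 4 k, τ.narr 5 k) =
        Windowing.chunkId (keys n (σ.narr 1) (σ.narr 2)) X A (σ.narr 3) L o k := by
  set E := keys n (σ.narr 1) (σ.narr 2) with hE
  set w := σ.narr 3 with hw
  set N := 2 * n + 1 with hNdef
  have hL : 0 < L := by omega
  have hL2 : 0 < L ^ 2 := by positivity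
  have hEN : #E ≤ N := (card_filter_le _ _).trans (by simp [hNdef])
  have hlt : ∀ k ∈ E, k < N := fun k hk => mem_range.1 (mem_filter.1 hk).1
  have hbudget : N * ((N + 2) * (22 * L + 49) + 33) + 8 + (N * (N * 130 + 60) + 8 +
      (N * ((N + 2) * (22 * L ^ 2 + 37) + 33) + 8)) ≤ 4000 * L ^ 2 * n ^ 2 := by
    obtain ⟨a, rfl⟩ : ∃ a, n = a + 1 := ⟨n - 1, by omega⟩
    obtain ⟨b, rfl⟩ : ∃ b, L = b + 1 := ⟨L - 1, by omega⟩
    rw [hNdef]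
    ring_nf
    omega
  refine WP.seq_le _ _ hbudget ?_
  apply WP.mapN N ((N + 2) * (22 * L + 49) + 18) (fun k => min ((w k + (L - o)) / L) (N + 2))
    (by norm_num) (by decide) (by simp [divX, CExp.ok]; decide)
  · intro τ hF; exact (hF.nvar 3 (by simp)).trans h3
  · intro τ hF k hk h5
    have hN : τ.nvar 3 = N := (hF.nvar 3 (by simp)).trans h3
    have hwτ : τ.narr 3 = w := hF.narr 3 (by simp)
    have ho' : τ.nvar 12 = o := (hF.nvar 12 (by simp)).trans h12
    refine ⟨divX_eval hL hN fun i => by simp [h5, hwτ, ho'], ?_⟩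
    refine (divX_cost (ce := 17) hN fun i => by simp [CExp.cost]).trans ?_
    exact le_of_eq (by ring)
  swap
  · simp only [NExp.cost]; linarith
  intro τ hF hP
  have h3τ : τ.nvar 3 = N := (hF.nvar 3 (by simp)).trans h3
  have hUτ : τ.narr 1 = σ.narr 1 := hF.narr 1 (by simp)
  have hVτ : τ.narr 2 = σ.narr 2 := hF.narr 2 (by simp)
  have hpc : ∀ k ∈ E, τ.narr 4 k = Windowing.piece w L o k := by
    intro k hk
    rw [hP k (hlt k hk)]
    -- The piece number is at most w k / L + 1 and the window number at most N, so the cutoff N + 2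
    -- has no effect.
    refine min_eq_left ?_
    have h1 : (w k + (L - o)) / L ≤ (w k + L) / L := Nat.div_le_div_right (by omega)
    rw [Nat.add_div_right _ hL] at h1
    have h2 := Nat.div_le_self (w k) L
    have h3 := (hW k hk).1
    omega
  set ρ := Windowing.residue X A w with hρ
  refine WP.seq_le _ _ le_rfl ?_
  apply WP.mapN N (N * 130 + 12) (fun k => #{k' ∈ E | τ.narr 4 k' = τ.narr 4 k ∧
    (σ.rarr 6 k' < σ.rarr 6 k ∨ σ.rarr 6 k' ≤ σ.rarr 6 k ∧ k' < k)})
    (by norm_num) (by decide) (by decide)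
  · intro υ hFυ; exact (hFυ.nvar 3 (by simp)).trans h3τ
  · intro υ hFυ k hk h5
    have h3υ : υ.nvar 3 = N := (hFυ.nvar 3 (by simp)).trans h3τ
    have hU : υ.narr 1 = σ.narr 1 := (hFυ.narr 1 (by simp)).trans hUτ
    have hV : υ.narr 2 = σ.narr 2 := (hFυ.narr 2 (by simp)).trans hVτ
    have hR : υ.rarr 6 = σ.rarr 6 := (hFυ.rarr 6 (by simp)).trans (hF.rarr 6 (by simp))
    have h4 : υ.narr 4 = τ.narr 4 := hFυ.narr 4 (by simp)
    constructor
    · rw [hE, keys, filter_filter, card_filter]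
      simp only [CExp.eval_sum, CExp.eval_var, h3υ, CExp.eval_and, validX, CExp.eval_lt,
        CExp.eval_get, CExp.eval_eq, CExp.eval_lit, CExp.eval_ite, CExp.eval_rle, RExp.eval,
        NExp.eval, nvar_setVar, narr_setVar, rarr_setVar, if_true,
        show (5 : ℕ) ≠ 40 by norm_num, if_false, hU, hV, hR, h4, h5, CExp.one_le_ite]
      refine sum_congr rfl fun k' _ => ?_
      by_cases hv : σ.narr 1 k' < σ.narr 2 k'
      · by_cases hp : τ.narr 4 k' = τ.narr 4 k
        · by_cases hr : σ.rarr 6 k ≤ σ.rarr 6 k'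
          · simp [hv, hp, hr, not_lt.2 hr, ite_and]
          · simp [hv, hp, hr, not_le.1 hr]
        · simp [hp]
      · simp [hv]
    · simp only [validX, CExp.cost, CExp.and, CExp.eq, CExp.lt, CExp.eval_var, RExp.cost,
        NExp.cost, sum_const, card_range, smul_eq_mul, h3υ]
      ring_nf
      omega
  swap
  · simp only [NExp.cost]; linarith
  intro υ hFυ hRk
  have h3υ : υ.nvar 3 = N := (hFυ.nvar 3 (by simp)).trans h3τ
  have h4υ : υ.narr 4 = τ.narr 4 := hFυ.narr 4 (by simp)
  have hrk : ∀ k ∈ E, υ.narr 10 k =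
      Windowing.rank {k' ∈ E | Windowing.piece w L o k' = Windowing.piece w L o k} ρ k := by
    intro k hk
    rw [hRk k (hlt k hk), Windowing.rank, filter_filter]
    refine congrArg card (filter_congr fun k' hk' => ?_)
    rw [hpc k hk, hpc k' hk', (hW k hk).2, (hW k' hk').2]
  apply WP.mapN N ((N + 2) * (22 * L ^ 2 + 37) + 18) (fun k => min (υ.narr 10 k / L ^ 2) (N + 2))
    (by norm_num) (by decide) (by simp [divX, CExp.ok]; decide)
  · intro ω hFω; exact (hFω.nvar 3 (by simp)).trans h3υ
  · intro ω hFω k hk h5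
    have hN : ω.nvar 3 = N := (hFω.nvar 3 (by simp)).trans h3υ
    have h10 : ω.narr 10 = υ.narr 10 := hFω.narr 10 (by simp)
    exact ⟨divX_eval hL2 hN fun i => by simp [h5, h10], divX_cost hN fun i => by simp [CExp.cost]⟩
  swap
  · simp only [NExp.cost]; linarith
  intro ω hFω hC
  refine ⟨((hF.mono (by simp) (by simp) (by simp)).trans
    (hFυ.mono (by simp) (by simp) (by simp))).trans
    (hFω.mono (by simp) (by simp) (by simp)), fun k hk => ?_⟩
  rw [Windowing.chunkId, hC k (hlt k hk), hrk k hk, hFω.narr 4 (by simp), h4υ, hpc k hk]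
  refine Prod.ext rfl (min_eq_left ?_)
  refine (Nat.div_le_self _ _).trans ((card_filter_le _ _).trans ((card_filter_le _ _).trans ?_))
  omega

end RealRAM

/-! ### Optimal solutions of the chunks -/

namespace RealRAM

open Finset DiscCode

/-- The intervals of the list `C` of length `h` that are selected by the mask `β`. -/
def selected (C : ℕ → ℕ) (h : ℕ) (β : ℕ → ℕ) : Finset ℕ := {i ∈ range h | 1 ≤ β i}.image C

theorem mem_selected {C : ℕ → ℕ} {h : ℕ} {β : ℕ → ℕ} {k : ℕ} :
    k ∈ selected C h β ↔ ∃ i < h, 1 ≤ β i ∧ C i = k := by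
  simp only [selected, mem_image, mem_filter, mem_range, and_assoc]

/-- The gap with number `x` is hit by the interval with number `y` in the list. -/
def hitGX (y x : ℕ) : CExp :=
  .add (.eq (.get 1 (.at 6 y)) (.var x)) (.eq (.get 2 (.at 6 y)) (.var x))

/-- The point with number `x` is hit by the interval with number `y` in the list. -/
def hitPX (y x : ℕ) : CExp :=
  .and (.le (.get 1 (.at 6 y)) (.var x)) (.lt (.var x) (.get 2 (.at 6 y)))

/-- The number of objects `x` below `M` that are hit by the list, but not by its selected part. -/
def missedX (M hit : CExp) : CExp :=
  .sum 41 M (.ite (.sum 40 (.var 14) (.and (.at 7 40) hit)) (.lit 0) (.sum 40 (.var 14) hit))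

/-- A summand vanishes exactly if the selected part hits the object or the whole list does not. -/
theorem missedX_eval {M hit : CExp} {τ : Store} {h N : ℕ} {P : ℕ → ℕ → Prop}
    (hM : M.eval τ = N) (hh : τ.nvar 14 = h)
    (hhit : ∀ i g, 1 ≤ hit.eval ((τ.setVar 41 g).setVar 40 i) ↔ P i g) :
    (missedX M hit).eval τ = 0 ↔
      ∀ g < N, (∃ i < h, P i g) → ∃ i < h, 1 ≤ τ.narr 7 i ∧ P i g := by
  have hpos : ∀ f : ℕ → ℕ, 1 ≤ ∑ i ∈ range h, f i ↔ ∃ i < h, 1 ≤ f i := by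
    intro f
    rw [Nat.one_le_iff_ne_zero, Ne, sum_eq_zero_iff]
    push Not
    simp only [mem_range, Nat.one_le_iff_ne_zero]
  simp only [missedX, CExp.eval_sum, hM, sum_eq_zero_iff, mem_range]
  refine forall₂_congr fun g _ => ?_
  have h14 : (τ.setVar 41 g).nvar 14 = h := by simpa using hh
  have h1 : 1 ≤ (CExp.sum 40 (.var 14) (.and (.at 7 40) hit)).eval (τ.setVar 41 g) ↔
      ∃ i < h, 1 ≤ τ.narr 7 i ∧ P i g := by
    rw [CExp.eval_sum, CExp.eval_var, h14, hpos]
    refine exists_congr fun i => and_congr_right fun _ => ?_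
    rw [CExp.eval_and, CExp.one_le_ite_and, hhit]
    simp
  have h2 : 1 ≤ (CExp.sum 40 (.var 14) hit).eval (τ.setVar 41 g) ↔ ∃ i < h, P i g := by
    rw [CExp.eval_sum, CExp.eval_var, h14, hpos]
    simp only [hhit]
  rw [CExp.eval_ite, CExp.eval_lit, ← h1, ← h2]
  split_ifs with h3
  · exact ⟨fun _ _ => h3, fun _ => rfl⟩
  · omega

/-- Comparison of the selected part of the list with the best one found so far. -/
def leafP : Prog :=
  .seq (asg 17 (.sum 40 (.var 14) (.at 7 40)))
  (.seq (asg 18 (.add (missedX (.add (.var 0) (.lit 1)) (hitGX 40 41))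
    (missedX (.var 0) (hitPX 40 41))))
  (ifX (.and (.lt (.var 17) (.var 16)) (.not (.var 18)))
    (.seq (asg 16 (.var 17)) (forX 15 (.var 14) (stN 8 (.var 15) (.at 7 15))))
    .skip))

/-- The setting of the search: the list `C` of length `h` enumerates `B`. -/
structure SearchCtx (n h : ℕ) (B : Finset ℕ) (τ : Store) : Prop where
  n_eq : τ.nvar 0 = n
  h_eq : τ.nvar 14 = h
  mem : ∀ i < h, τ.narr 6 i ∈ B
  surj : ∀ k ∈ B, ∃ i < h, τ.narr 6 i = k
  U_le : ∀ k ∈ B, τ.narr 1 k ≤ n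
  V_le : ∀ k ∈ B, τ.narr 2 k ≤ n

/-- The mask selects a part of the list that hits everything. -/
def Feas (B : Finset ℕ) (τ : Store) (β : ℕ → ℕ) : Prop :=
  Covers (τ.narr 1) (τ.narr 2) (selected (τ.narr 6) (τ.nvar 14) β) B

/-- The array `8` contains a feasible mask of the size recorded in the variable `16`. -/
def Good (B : Finset ℕ) (τ : Store) : Prop :=
  Feas B τ (τ.narr 8) ∧ τ.nvar 16 = ∑ i ∈ range (τ.nvar 14), τ.narr 8 i

theorem selected_congr {C : ℕ → ℕ} {h : ℕ} {β γ : ℕ → ℕ} (hb : ∀ i < h, β i = γ i) :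
    selected C h β = selected C h γ := by
  rw [selected, selected]
  congr 1
  exact filter_congr fun i hi => by rw [hb i (mem_range.1 hi)]

theorem SearchCtx.of_fr {n h : ℕ} {B : Finset ℕ} {σ τ : Store} (H : SearchCtx n h B σ)
    (hF : Fr [15, 16, 17, 18] [7, 8] [] σ τ) : SearchCtx n h B τ := by
  refine ⟨(hF.nvar 0 (by simp)).trans H.n_eq, (hF.nvar 14 (by simp)).trans H.h_eq, ?_, ?_, ?_, ?_⟩
  · rw [hF.narr 6 (by simp)]; exact H.mem
  · rw [hF.narr 6 (by simp)]; exact H.surj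
  · rw [hF.narr 1 (by simp)]; exact H.U_le
  · rw [hF.narr 2 (by simp)]; exact H.V_le

theorem feas_iff_of_fr {B : Finset ℕ} {σ τ : Store} (hF : Fr [15, 16, 17, 18] [7, 8] [] σ τ)
    (β : ℕ → ℕ) : Feas B τ β ↔ Feas B σ β := by
  rw [Feas, Feas, hF.narr 6 (by simp), hF.narr 1 (by simp), hF.narr 2 (by simp),
    hF.nvar 14 (by simp)]

/-- Gaps beyond n and points from n on are hit by nobody, because the counts are at most n. So
covering is a finite condition that `leafP` can test. -/
theorem feas_iff {n h : ℕ} {B : Finset ℕ} {τ : Store} (H : SearchCtx n h B τ) (β : ℕ → ℕ) :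
    Feas B τ β ↔
      (∀ g < n + 1, (∃ i < h, HitG (τ.narr 1) (τ.narr 2) (τ.narr 6 i) g) →
        ∃ i < h, 1 ≤ β i ∧ HitG (τ.narr 1) (τ.narr 2) (τ.narr 6 i) g) ∧
      (∀ g < n, (∃ i < h, HitP (τ.narr 1) (τ.narr 2) (τ.narr 6 i) g) →
        ∃ i < h, 1 ≤ β i ∧ HitP (τ.narr 1) (τ.narr 2) (τ.narr 6 i) g) := by
  rw [Feas, Covers, H.h_eq]
  refine and_congr ⟨fun hc g _ => ?_, fun hc k hk g hg => ?_⟩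
    ⟨fun hc g _ => ?_, fun hc k hk g hg => ?_⟩
  · rintro ⟨i, hi, hg⟩
    obtain ⟨k, hk, h⟩ := hc _ (H.mem i hi) g hg
    obtain ⟨j, hj, hb, rfl⟩ := mem_selected.1 hk
    exact ⟨j, hj, hb, h⟩
  · obtain ⟨i, hi, rfl⟩ := H.surj k hk
    have hgn : g < n + 1 := by
      rcases hg with h | h
      · have := H.U_le _ hk; omega
      · have := H.V_le _ hk; omega
    obtain ⟨j, hj, hb, h⟩ := hc g hgn ⟨i, hi, hg⟩
    exact ⟨_, mem_selected.2 ⟨j, hj, hb, rfl⟩, h⟩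
  · rintro ⟨i, hi, hg⟩
    obtain ⟨k, hk, h⟩ := hc _ (H.mem i hi) g hg
    obtain ⟨j, hj, hb, rfl⟩ := mem_selected.1 hk
    exact ⟨j, hj, hb, h⟩
  · obtain ⟨i, hi, rfl⟩ := H.surj k hk
    have hgn : g < n := hg.2.trans_le (H.V_le _ hk)
    obtain ⟨j, hj, hb, h⟩ := hc g hgn ⟨i, hi, hg⟩
    exact ⟨_, mem_selected.2 ⟨j, hj, hb, rfl⟩, h⟩

theorem leafP_spec {n h W : ℕ} {B : Finset ℕ} {σ : Store} (hn : 0 < n) (hW : 0 < W) (hhW : h ≤ W)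
    (H : SearchCtx n h B σ) (hG : Good B σ) :
    WP leafP (1200 * n * W) σ fun τ => Fr [15, 16, 17, 18] [8] [] σ τ ∧ Good B τ ∧
      τ.nvar 16 ≤ σ.nvar 16 ∧
      (Feas B σ (σ.narr 7) → τ.nvar 16 ≤ ∑ i ∈ range h, σ.narr 7 i) := by
  have hbudget : 19 * h + 20 + ((n + 1) * (199 * h + 60) + (n * (127 * h + 60) + 60) +
      (60 * h + 80)) ≤ 1200 * n * W := by
    have h1 : (n + 1) * (199 * h + 60) ≤ 2 * n * (259 * W) :=
      Nat.mul_le_mul (by omega) (by omega)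
    have h2 : n * (127 * h + 60) ≤ n * (187 * W) := Nat.mul_le_mul_left _ (by omega)
    have h3 : W ≤ n * W := Nat.le_mul_of_pos_left _ hn
    have h4 : 2 * n * (259 * W) = 518 * (n * W) := by ring
    have h5 : n * (187 * W) = 187 * (n * W) := by ring
    rw [mul_assoc]
    omega
  refine WP.seq_le _ _ hbudget ?_
  refine WP.asg (by decide) ?_ ?_
  swap
  · simp only [CExp.cost, CExp.eval_var, H.h_eq, sum_const, card_range, smul_eq_mul]
    omega
  have hsz : (CExp.sum 40 (.var 14) (.at 7 40)).eval σ = ∑ i ∈ range h, σ.narr 7 i := by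
    simp [H.h_eq]
  rw [hsz]
  set τ := σ.setVar 17 (∑ i ∈ range h, σ.narr 7 i) with hτ
  have hFτ : Fr [15, 16, 17, 18] [8] [] σ τ := (Fr.refl ..).setVar (by simp) _
  have hFτ' : Fr [15, 16, 17, 18] [7, 8] [] σ τ := hFτ.mono (by simp) (by simp) (by simp)
  have Hτ := H.of_fr hFτ'
  refine WP.seq_le _ _ le_rfl ?_
  refine WP.asg (by decide) ?_ ?_
  swap
  · simp only [missedX, hitGX, hitPX, CExp.cost, CExp.and, CExp.eq, CExp.lt, CExp.eval_add,
      CExp.eval_lit, CExp.eval_var, Hτ.h_eq, Hτ.n_eq, nvar_setVar, show (14 : ℕ) ≠ 41 by norm_num,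
      if_false, sum_const, card_range, smul_eq_mul]
    ring_nf
    omega
  have hbad : (CExp.add (missedX (.add (.var 0) (.lit 1)) (hitGX 40 41))
      (missedX (.var 0) (hitPX 40 41))).eval τ = 0 ↔ Feas B σ (σ.narr 7) := by
    rw [← feas_iff_of_fr hFτ', feas_iff Hτ, CExp.eval_add, Nat.add_eq_zero_iff]
    refine and_congr ?_ ?_
    · refine missedX_eval (by simp [Hτ.n_eq]) Hτ.h_eq fun i g => ?_
      simp only [hitGX, CExp.eval_add, CExp.eval_eq, CExp.eval_get, CExp.eval_var, nvar_setVar,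
        narr_setVar, if_true, show (41 : ℕ) ≠ 40 by norm_num, if_false, HitG]
      by_cases h1 : τ.narr 1 (τ.narr 6 i) = g <;> by_cases h2 : τ.narr 2 (τ.narr 6 i) = g <;>
        simp [h1, h2]
    · refine missedX_eval (by simp [Hτ.n_eq]) Hτ.h_eq fun i g => ?_
      simp only [hitPX, CExp.eval_and, CExp.eval_le, CExp.eval_lt, CExp.eval_get, CExp.eval_var,
        nvar_setVar, narr_setVar, if_true, show (41 : ℕ) ≠ 40 by norm_num, if_false, HitP]
      by_cases h1 : τ.narr 1 (τ.narr 6 i) ≤ g <;> by_cases h2 : g < τ.narr 2 (τ.narr 6 i) <;>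
        simp [h1, h2]
  set bad := (CExp.add (missedX (.add (.var 0) (.lit 1)) (hitGX 40 41))
      (missedX (.var 0) (hitPX 40 41))).eval τ with hbd
  have hcond : 1 ≤ (CExp.and (.lt (.var 17) (.var 16)) (.not (.var 18))).eval (τ.setVar 18 bad) ↔
      ∑ i ∈ range h, σ.narr 7 i < σ.nvar 16 ∧ bad = 0 := by
    rw [CExp.eval_and, CExp.one_le_ite_and, CExp.eval_lt, CExp.one_le_ite, CExp.eval_not]
    simp [hτ]
    intro _
    split_ifs <;> omega
  refine WP.ifX (u := 60 * h + 20) (by decide) ?_ ?_ ?_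
  · intro hc
    rw [hcond] at hc
    have hfe : Feas B σ (σ.narr 7) := hbad.1 hc.2
    refine WP.seq_le 4 (60 * h + 16) (by omega) ?_
    refine WP.asg (by decide) ?_ (by simp [CExp.cost])
    refine WP.forX h 50 (fun i υ => Fr [15, 16, 17, 18] [8] [] σ υ ∧ υ.nvar 15 = i ∧
      υ.nvar 16 = (∑ i ∈ range h, σ.narr 7 i) ∧ ∀ j < i, υ.narr 8 j = σ.narr 7 j)
      (by norm_num) (by decide) ?_ ?_ ?_ ?_ ?_
    · exact ⟨((hFτ.setVar (by simp) _).setVar (by simp) _).setVar (by simp) _, by simp,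
        by simp [hτ], by simp⟩
    · rintro i υ ⟨hF, h15, -⟩
      exact ⟨h15, (hF.nvar 14 (by simp)).trans H.h_eq⟩
    · rintro i hi υ ⟨hF, h15, h16, hI⟩
      refine WP.stN (by decide) (by decide) ?_ (by simp [CExp.cost])
      refine ⟨by simpa using h15, (hF.setNat (by simp) _ _).setVar (by simp) _, by simp,
        by simpa using h16, fun j hj => ?_⟩
      simp only [CExp.eval_var, CExp.eval_get, narr_setVar, narr_setNat_apply, true_and, h15,
        hF.narr 7 (by simp)]
      split_ifs with h
      · rw [h]
      · exact hI j (by omega)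
    · rintro υ ⟨hF, -, h16, hI⟩
      have hF' : Fr [15, 16, 17, 18] [7, 8] [] σ υ := hF.mono (by simp) (by simp) (by simp)
      refine ⟨hF, ⟨?_, ?_⟩, ?_, fun _ => h16.le⟩
      · rw [feas_iff_of_fr hF']
        rw [Feas, H.h_eq] at hfe ⊢
        rw [selected_congr hI]
        exact hfe
      · rw [h16, hF.nvar 14 (by simp), H.h_eq]
        exact sum_congr rfl fun j hj => (hI j (mem_range.1 hj)).symm
      · rw [h16]; exact hc.1.le
    · simp only [NExp.cost]; omega
  · intro hc
    rw [hcond] at hc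
    refine WP.skip ⟨hFτ.setVar (by simp) _, hG, by simp [hτ], fun hf => ?_⟩ (by omega)
    have := hbad.2 hf
    by_contra hlt
    exact hc ⟨by simpa [hτ] using hlt, this⟩
  · simp only [CExp.cost, CExp.and, CExp.lt, CExp.not]
    omega

/-- Exhaustive search over the masks of length `k`. -/
def enumP : ℕ → Prog
  | 0 => leafP
  | k + 1 => .seq (stN 7 (.lit k) (.lit 0)) (.seq (enumP k)
      (.seq (stN 7 (.lit k) (.lit 1)) (enumP k)))

/-- Bits from k on are fixed by the current mask, and the lower ones run through all values. The
length of the program text doubles with k, which is allowed because k will be a constant depending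
on ε only. The bound solves T (k + 1) = 2 T k + 14, with 7 steps for each store. -/
theorem enumP_spec {n h W : ℕ} {B : Finset ℕ} (hn : 0 < n) (hW : 0 < W) (hhW : h ≤ W) (k : ℕ) :
    ∀ σ : Store, SearchCtx n h B σ → Good B σ →
    WP (enumP k) (2 ^ k * (1200 * n * W + 14) - 14) σ fun τ =>
      Fr [15, 16, 17, 18] [7, 8] [] σ τ ∧ (∀ i ≥ k, τ.narr 7 i = σ.narr 7 i) ∧ Good B τ ∧
      τ.nvar 16 ≤ σ.nvar 16 ∧
      ∀ β : ℕ → ℕ, (∀ i < k, β i = 0 ∨ β i = 1) → (∀ i ≥ k, β i = σ.narr 7 i) → Feas B σ β →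
        τ.nvar 16 ≤ ∑ i ∈ range h, β i := by
  induction k with
  | zero =>
    intro σ H hG
    refine (leafP_spec hn hW hhW H hG).mono (by simp) ?_
    rintro τ ⟨hF, hG', hle, hopt⟩
    refine ⟨hF.mono (by simp) (by simp) (by simp), fun i _ => by rw [hF.narr 7 (by simp)], hG',
      hle, fun β _ hβ hf => ?_⟩
    have : β = σ.narr 7 := funext fun i => hβ i (Nat.zero_le i)
    rw [this] at hf ⊢
    exact hopt hf
  | succ k ih =>
    intro σ H hG
    have hT : 14 ≤ 2 ^ k * (1200 * n * W + 14) :=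
      le_trans (by omega) (Nat.le_mul_of_pos_left _ (Nat.two_pow_pos k))
    have hT2 : 2 ^ (k + 1) * (1200 * n * W + 14) = 2 * (2 ^ k * (1200 * n * W + 14)) := by ring
    have hset : ∀ v σ', SearchCtx n h B σ' → Good B σ' →
        Fr [15, 16, 17, 18] [7, 8] [] σ' (σ'.setNat 7 k v) ∧
        SearchCtx n h B (σ'.setNat 7 k v) ∧ Good B (σ'.setNat 7 k v) := by
      intro v σ' H' hG'
      have hF : Fr [15, 16, 17, 18] [7, 8] [] σ' (σ'.setNat 7 k v) :=
        (Fr.refl ..).setNat (by simp) _ _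
      have h8 : (σ'.setNat 7 k v).narr 8 = σ'.narr 8 := by simp [narr_setNat]
      refine ⟨hF, H'.of_fr hF, ?_, ?_⟩
      · rw [feas_iff_of_fr hF, h8]; exact hG'.1
      · rw [h8]; exact hG'.2
    refine WP.seq_le 7 ((2 ^ k * (1200 * n * W + 14) - 14) + (7 +
      (2 ^ k * (1200 * n * W + 14) - 14))) ?_ ?_
    · omega
    refine WP.stN rfl rfl ?_ (by simp [CExp.cost])
    obtain ⟨hF₁, H₁, hG₁⟩ := hset 0 σ H hG
    refine WP.seq ((ih _ H₁ hG₁).mono le_rfl ?_)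
    rintro τ ⟨hF₂, hk₂, hG₂, hle₂, hopt₂⟩
    have H₂ := H₁.of_fr hF₂
    refine WP.seq (WP.stN rfl rfl ?_ (by simp [CExp.cost]))
    obtain ⟨hF₃, H₃, hG₃⟩ := hset 1 τ H₂ hG₂
    refine (ih _ H₃ hG₃).mono le_rfl ?_
    rintro υ ⟨hF₄, hk₄, hG₄, hle₄, hopt₄⟩
    have hF₁₃ := (hF₁.trans hF₂).trans hF₃
    refine ⟨hF₁₃.trans hF₄, fun i hi => ?_, hG₄, hle₄.trans hle₂, fun β hb hβ hf => ?_⟩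
    · rw [hk₄ i (by omega)]
      simp only [narr_setNat_apply, true_and]
      rw [if_neg (by omega), hk₂ i (by omega)]
      simp only [narr_setNat_apply, true_and]
      rw [if_neg (by omega)]
    · rcases hb k (by omega) with h0 | h1
      · refine hle₄.trans (hopt₂ β (fun i hi => hb i (by omega)) (fun i hi => ?_) ?_)
        · simp only [narr_setNat_apply, true_and]
          split_ifs with hik
          · rw [hik, h0]
          · exact hβ i (by omega)
        · exact (feas_iff_of_fr hF₁ β).2 hf
      · refine hopt₄ β (fun i hi => hb i (by omega)) (fun i hi => ?_) ?_
        · simp only [narr_setNat_apply, true_and]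
          split_ifs with hik
          · rw [hik, h1]
          · rw [hk₂ i hi]
            simp only [narr_setNat_apply, true_and, hik, if_false]
            exact hβ i (by omega)
        · exact (feas_iff_of_fr hF₁₃ β).2 hf

end RealRAM

/-! ### Listing, solving and printing a single chunk -/

namespace RealRAM

open Finset DiscCode

/-- The test that the intervals with the numbers `x` and `y` are in the same chunk. -/
def sameX (x y : ℕ) : CExp :=
  .and (validX x) (.and (.eq (.at 4 x) (.at 4 y)) (.eq (.at 5 x) (.at 5 y)))

theorem one_le_sameX {x y : ℕ} {τ : Store} :
    1 ≤ (sameX x y).eval τ ↔ τ.narr 1 (τ.nvar x) < τ.narr 2 (τ.nvar x) ∧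
      (τ.narr 4 (τ.nvar x), τ.narr 5 (τ.nvar x)) =
        (τ.narr 4 (τ.nvar y), τ.narr 5 (τ.nvar y)) := by
  rw [sameX, validX, CExp.eval_and, CExp.one_le_ite_and, CExp.eval_lt, CExp.one_le_ite,
    CExp.eval_and, CExp.one_le_ite_and, CExp.eval_eq, CExp.one_le_ite, CExp.eval_eq,
    CExp.one_le_ite, Prod.mk.injEq]
  rfl

theorem sameX_cost (x y : ℕ) (τ : Store) : (sameX x y).cost τ = 110 := by
  simp [sameX, validX, CExp.cost, CExp.and, CExp.eq, CExp.lt]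

/-- Enumeration of the chunk of the interval with number `5` in the array `6`. -/
def collectP : Prog :=
  .seq (asg 14 (.lit 0))
  (forX 15 (.var 3) (ifX (sameX 15 5)
    (.seq (stN 6 (.var 14) (.var 15)) (asg 14 (.add (.var 14) (.lit 1)))) .skip))

theorem collectP_spec {n : ℕ} {B : Finset ℕ} {σ : Store} (hn : 0 < n) (h3 : σ.nvar 3 = 2 * n + 1)
    (hB : ∀ k, k ∈ B ↔ k < 2 * n + 1 ∧ σ.narr 1 k < σ.narr 2 k ∧
      (σ.narr 4 k, σ.narr 5 k) = (σ.narr 4 (σ.nvar 5), σ.narr 5 (σ.nvar 5))) :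
    WP collectP (435 * n) σ fun τ => Fr [14, 15] [6] [] σ τ ∧ τ.nvar 14 = #B ∧
      (∀ i < #B, τ.narr 6 i ∈ B) ∧ (∀ k ∈ B, ∃ i < #B, τ.narr 6 i = k) ∧
      ∀ i < #B, ∀ j < #B, τ.narr 6 i = τ.narr 6 j → i = j := by
  refine WP.seq_le 4 ((2 * n + 1) * 141 + 8) (by omega) ?_
  refine WP.asg (by decide) ?_ (by simp [CExp.cost])
  apply WP.forX (2 * n + 1) 131 (fun i τ => Fr [14, 15] [6] [] σ τ ∧ τ.nvar 15 = i ∧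
    τ.nvar 14 = #{k ∈ B | k < i} ∧ (∀ j < τ.nvar 14, τ.narr 6 j ∈ B ∧ τ.narr 6 j < i) ∧
    (∀ k ∈ B, k < i → ∃ j < τ.nvar 14, τ.narr 6 j = k) ∧
    ∀ j < τ.nvar 14, ∀ j' < τ.nvar 14, τ.narr 6 j = τ.narr 6 j' → j = j') (by norm_num) (by decide)
  · exact ⟨((Fr.refl ..).setVar (by simp) _).setVar (by simp) _, by simp, by simp, by simp,
      by simp, by simp⟩
  · rintro i τ ⟨hF, h15, -⟩
    exact ⟨h15, (hF.nvar 3 (by simp)).trans h3⟩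
  · rintro i hi τ ⟨hF, h15, h14, hm, hs, hj⟩
    have hsame : 1 ≤ (sameX 15 5).eval τ ↔ i ∈ B := by
      rw [one_le_sameX, hB, h15, hF.nvar 5 (by simp), hF.narr 1 (by simp), hF.narr 2 (by simp),
        hF.narr 4 (by simp), hF.narr 5 (by simp)]
      exact ⟨fun h => ⟨hi, h⟩, fun h => h.2⟩
    refine WP.ifX (u := 17) (by decide) (fun h => ?_) (fun h => ?_) (by rw [sameX_cost])
    · have hiB := hsame.1 h
      refine WP.seq_le 7 10 le_rfl ?_
      refine WP.stN (by decide) (by decide) ?_ (by simp [CExp.cost])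
      refine WP.asg (by decide) ?_ (by simp [CExp.cost])
      have hcard : #{k ∈ B | k < i + 1} = τ.nvar 14 + 1 := by
        have : ({k ∈ B | k < i + 1} : Finset ℕ) = insert i {k ∈ B | k < i} := by
          ext k
          simp only [mem_filter, mem_insert]
          constructor
          · rintro ⟨h1, h2⟩
            by_cases hk : k = i
            · exact .inl hk
            · exact .inr ⟨h1, by omega⟩
          · rintro (rfl | ⟨h1, h2⟩)
            · exact ⟨hiB, by omega⟩
            · exact ⟨h1, by omega⟩
        rw [this, card_insert_of_notMem (by simp), h14]
      have hnarr : ∀ j, (((τ.setNat 6 (τ.nvar 14) (τ.nvar 15)).setVar 14 (τ.nvar 14 + 1)).setVar 15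
          (i + 1)).narr 6 j = if j = τ.nvar 14 then i else τ.narr 6 j := by
        intro j; simp [h15]
      refine ⟨by simpa using h15, ((hF.setNat (by simp) _ _).setVar (by simp) _).setVar
        (by simp) _, by simp, ?_, fun j hj' => ?_, fun k hk hki => ?_,
        fun j hj1 j' hj2 he => ?_⟩
      · rw [hcard]; simp
      · have hj2 : j < τ.nvar 14 + 1 := by simpa using hj'
        have := hnarr j
        simp only [CExp.eval_var, CExp.eval_add, CExp.eval_lit, nvar_setNat] at this ⊢
        rw [this]
        split_ifs with he
        · exact ⟨hiB, by omega⟩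
        · have := hm j (by omega); exact ⟨this.1, by omega⟩
      · simp only [CExp.eval_var, CExp.eval_add, CExp.eval_lit, nvar_setNat]
        by_cases hk' : k = i
        · refine ⟨τ.nvar 14, by simp, ?_⟩
          rw [hnarr, if_pos rfl, hk']
        · obtain ⟨j, hj1, hj2⟩ := hs k hk (by omega)
          refine ⟨j, by simp; omega, ?_⟩
          rw [hnarr, if_neg (by omega), hj2]
      · simp only [CExp.eval_var, CExp.eval_add, CExp.eval_lit, nvar_setNat, hnarr] at he
        have hj1' : j < τ.nvar 14 + 1 := by simpa using hj1
        have hj2' : j' < τ.nvar 14 + 1 := by simpa using hj2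
        split_ifs at he with e1 e2 e2
        · omega
        · have := (hm j' (by omega)).2; omega
        · have := (hm j (by omega)).2; omega
        · exact hj j (by omega) j' (by omega) he
    · have hiB : i ∉ B := fun h' => h (hsame.2 h')
      have hfil : ({k ∈ B | k < i + 1} : Finset ℕ) = {k ∈ B | k < i} := by
        refine filter_congr fun k hk => ?_
        have : k ≠ i := by rintro rfl; exact hiB hk
        omega
      refine WP.skip ⟨h15, hF.setVar (by simp) _, by simp, ?_, ?_, ?_, ?_⟩ (by norm_num)
      · rw [hfil, ← h14]; simp
      · intro j hj'
        have := hm j (by simpa using hj')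
        exact ⟨this.1, by have := this.2; simp; omega⟩
      · intro k hk hki
        have : k ≠ i := by rintro rfl; exact hiB hk
        simpa using hs k hk (by omega)
      · simpa using hj
  · rintro τ ⟨hF, -, h14, hm, hs, hj⟩
    have hlt : ∀ k ∈ B, k < 2 * n + 1 := fun k hk => ((hB k).1 hk).1
    have hfil : ({k ∈ B | k < 2 * n + 1} : Finset ℕ) = B := filter_true_of_mem hlt
    rw [hfil] at h14
    rw [h14] at hm hs hj
    exact ⟨hF, h14, fun i hi => (hm i hi).1, fun k hk => hs k hk (hlt k hk), hj⟩
  · simp only [NExp.cost]; omega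

/-- Initialization of the best mask. -/
def initP : Prog :=
  .seq (asg 16 (.var 14)) (forX 15 (.var 14) (stN 8 (.var 15) (.lit 1)))

/-- The full mask is feasible, so the search never lacks a solution to report. -/
theorem initP_spec {h W : ℕ} {B : Finset ℕ} {σ : Store} {n : ℕ} (hhW : h ≤ W)
    (H : SearchCtx n h B σ) :
    WP initP (20 * W + 12) σ fun τ => Fr [15, 16, 17, 18] [7, 8] [] σ τ ∧ Good B τ := by
  refine WP.seq_le 4 (20 * W + 8) (by omega) ?_
  refine WP.asg (by decide) ?_ (by simp [CExp.cost])
  apply WP.mapN h 2 (fun _ => 1) (by norm_num) (by decide) (by decide)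
  · intro τ hF
    simpa [NExp.eval, hF.nvar 14 (by simp)] using H.h_eq
  · intro τ hF k hk h15
    exact ⟨rfl, le_rfl⟩
  · intro τ hF h8
    have hF' : Fr [15, 16, 17, 18] [7, 8] [] σ τ :=
      ((Fr.refl ..).setVar (by simp) _).trans (hF.mono (by simp) (by simp) (by simp))
    have h14 : τ.nvar 14 = h := (hF'.nvar 14 (by simp)).trans H.h_eq
    refine ⟨hF', ?_, ?_⟩
    · have : selected (τ.narr 6) (τ.nvar 14) (τ.narr 8) = B := by
        ext k
        rw [mem_selected, h14, hF'.narr 6 (by simp)]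
        constructor
        · rintro ⟨i, hi, -, rfl⟩
          exact H.mem i hi
        · intro hk
          obtain ⟨i, hi, rfl⟩ := H.surj k hk
          exact ⟨i, hi, by rw [h8 i hi], rfl⟩
      rw [Feas, this]
      exact Covers.refl ..
    · rw [hF.nvar 16 (by simp), h14, sum_congr rfl fun i hi => h8 i (mem_range.1 hi)]
      simp [H.h_eq]
  · simp only [NExp.cost]; omega

/-- Output of the intervals that are selected by the best mask. -/
def outP : Prog :=
  forX 15 (.var 14) (ifX (.at 8 15)
    (.seq (stR 2 (.var 2) (.get 4 (.get 6 (.var 15)))) (asg 2 (.add (.var 2) (.lit 1)))) .skip)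

theorem outP_spec {h W : ℕ} {σ : Store} (hhW : h ≤ W) (h14 : σ.nvar 14 = h) :
    WP outP (40 * W + 8) σ fun τ => Fr [2, 15] [] [2] σ τ ∧
      τ.nvar 2 = σ.nvar 2 + #{i ∈ range h | 1 ≤ σ.narr 8 i} ∧
      ∀ y, (∃ j < τ.nvar 2, τ.rarr 2 j = y) ↔ (∃ j < σ.nvar 2, σ.rarr 2 j = y) ∨
        ∃ k ∈ selected (σ.narr 6) h (σ.narr 8), σ.rarr 4 k = y := by
  apply WP.forX h 30 (fun i τ => Fr [2, 15] [] [2] σ τ ∧ τ.nvar 15 = i ∧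
    τ.nvar 2 = σ.nvar 2 + #{i ∈ range i | 1 ≤ σ.narr 8 i} ∧
    ∀ y, (∃ j < τ.nvar 2, τ.rarr 2 j = y) ↔ (∃ j < σ.nvar 2, σ.rarr 2 j = y) ∨
      ∃ k ∈ selected (σ.narr 6) i (σ.narr 8), σ.rarr 4 k = y) (by norm_num) (by decide)
  · refine ⟨(Fr.refl ..).setVar (by simp) _, by simp, by simp, by simp [selected]⟩
  · rintro i τ ⟨hF, h15, -⟩
    exact ⟨h15, (hF.nvar 14 (by simp)).trans h14⟩
  · rintro i hi τ ⟨hF, h15, h2, hy⟩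
    have h8 : (CExp.at 8 15).eval τ = σ.narr 8 i := by
      rw [CExp.eval_get, CExp.eval_var, h15, hF.narr 8 (by simp)]
    refine WP.ifX (u := 19) (by decide) (fun h => ?_) (fun h => ?_) (by simp [CExp.cost])
    · rw [h8] at h
      refine WP.seq_le 9 10 le_rfl ?_
      refine WP.stR (by decide) (by decide) ?_ (by simp [CExp.cost, RExp.cost, NExp.cost])
      refine WP.asg (by decide) ?_ (by simp [CExp.cost])
      refine ⟨by simpa using h15, ((hF.setReal (by simp) _ _).setVar (by simp) _).setVar
        (by simp) _, by simp, ?_, fun y => ?_⟩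
      · rw [range_add_one, filter_insert, if_pos h, card_insert_of_notMem (by simp)]
        simp [h2]; omega
      · have hsel : (∃ k ∈ selected (σ.narr 6) (i + 1) (σ.narr 8), σ.rarr 4 k = y) ↔
            (∃ k ∈ selected (σ.narr 6) i (σ.narr 8), σ.rarr 4 k = y) ∨
              σ.rarr 4 (σ.narr 6 i) = y := by
          rw [selected, range_add_one, filter_insert, if_pos h, image_insert]
          simp only [mem_insert, exists_eq_or_imp, selected]
          exact or_comm
        rw [hsel, ← or_assoc, ← hy]
        have hv : (RExp.get 4 (.get 6 (.var 15))).eval τ = σ.rarr 4 (σ.narr 6 i) := by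
          simp only [RExp.eval, NExp.eval, h15, hF.narr 6 (by simp), hF.rarr 4 (by simp)]
        simp only [hv, nvar_setVar, rarr_setVar, nvar_setReal, CExp.eval_var, CExp.eval_add,
          CExp.eval_lit, rarr_setReal_apply, true_and, show (2 : ℕ) ≠ 15 by norm_num, if_true,
          if_false]
        constructor
        · rintro ⟨j, hj, rfl⟩
          split_ifs with he
          · exact .inr rfl
          · exact .inl ⟨j, by omega, rfl⟩
        · rintro (⟨j, hj, rfl⟩ | rfl)
          · exact ⟨j, by omega, if_neg (by omega)⟩
          · exact ⟨_, Nat.lt_succ_self _, if_pos rfl⟩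
    · rw [h8] at h
      refine WP.skip ⟨h15, hF.setVar (by simp) _, by simp, ?_, fun y => ?_⟩ (by norm_num)
      · rw [range_add_one, filter_insert, if_neg h]
        simpa using h2
      · rw [selected, range_add_one, filter_insert, if_neg h]
        simpa [selected] using hy y
  · rintro τ ⟨hF, -, h2, hy⟩
    exact ⟨hF, h2, hy⟩
  · simp only [NExp.cost]; omega

/-- Output of an optimal solution of the chunk of the interval with number `5`. -/
def solveP (W : ℕ) : Prog := .seq collectP (.seq initP (.seq (enumP W) outP))

theorem solveP_spec {n W : ℕ} {B : Finset ℕ} {σ : Store} (hn : 0 < n) (hW : 0 < W)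
    (hBW : #B ≤ W) (h0 : σ.nvar 0 = n) (h3 : σ.nvar 3 = 2 * n + 1)
    (hB : ∀ k, k ∈ B ↔ k < 2 * n + 1 ∧ σ.narr 1 k < σ.narr 2 k ∧
      (σ.narr 4 k, σ.narr 5 k) = (σ.narr 4 (σ.nvar 5), σ.narr 5 (σ.nvar 5)))
    (hU : ∀ k ∈ B, σ.narr 1 k ≤ n) (hV : ∀ k ∈ B, σ.narr 2 k ≤ n) :
    WP (solveP W) (2000 * 2 ^ W * W * n) σ fun τ =>
      Fr [2, 14, 15, 16, 17, 18] [6, 7, 8] [2] σ τ ∧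
      ∃ R ⊆ B, Covers (σ.narr 1) (σ.narr 2) R B ∧ τ.nvar 2 ≤ σ.nvar 2 + #R ∧
        (∀ R' ⊆ B, Covers (σ.narr 1) (σ.narr 2) R' B → #R ≤ #R') ∧
        ∀ y, (∃ j < τ.nvar 2, τ.rarr 2 j = y) ↔ (∃ j < σ.nvar 2, σ.rarr 2 j = y) ∨
          ∃ k ∈ R, σ.rarr 4 k = y := by
  have hbudget : 435 * n + ((20 * W + 12) + ((2 ^ W * (1200 * n * W + 14) - 14) +
      (40 * W + 8))) ≤ 2000 * 2 ^ W * W * n := by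
    have h1 : 2 ≤ 2 ^ W := le_self_pow₀ (a := 2) (by norm_num) hW.ne'
    have h2 : n ≤ W * n := Nat.le_mul_of_pos_left _ hW
    have h3 : W ≤ W * n := Nat.le_mul_of_pos_right _ hn
    have h4 : 1 ≤ W * n := Nat.mul_pos hW hn
    have h5 : 2 * (W * n) ≤ 2 ^ W * (W * n) := Nat.mul_le_mul_right _ h1
    have h6 : 2 ^ W ≤ 2 ^ W * (W * n) := Nat.le_mul_of_pos_right _ h4
    have h7 : 2 ^ W * (1200 * n * W + 14) = 1200 * (2 ^ W * (W * n)) + 14 * 2 ^ W := by ring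
    have h8 : 2000 * 2 ^ W * W * n = 2000 * (2 ^ W * (W * n)) := by ring
    rw [h7, h8]
    omega
  refine WP.seq_le _ _ hbudget ?_
  refine (collectP_spec hn h3 hB).mono le_rfl ?_
  rintro τ ⟨hF, h14, hm, hs, hinj⟩
  have H : SearchCtx n #B B τ := by
    refine ⟨(hF.nvar 0 (by simp)).trans h0, h14, hm, hs, ?_, ?_⟩
    · rw [hF.narr 1 (by simp)]; exact hU
    · rw [hF.narr 2 (by simp)]; exact hV
  refine WP.seq ((initP_spec hBW H).mono le_rfl ?_)
  rintro υ ⟨hF₂, hG₂⟩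
  have H₂ := H.of_fr hF₂
  refine WP.seq ((enumP_spec hn hW hBW W υ H₂ hG₂).mono le_rfl ?_)
  rintro ω ⟨hF₃, -, hG₃, -, hopt⟩
  have H₃ := H₂.of_fr hF₃
  have hF₂₃ := hF₂.trans hF₃
  refine (outP_spec hBW H₃.h_eq).mono le_rfl ?_
  rintro ξ ⟨hF₄, h2, hy⟩
  have hF₁₃ : Fr [14, 15, 16, 17, 18] [6, 7, 8] [] σ ω :=
    (hF.mono (by simp) (by simp) (by simp)).trans (hF₂₃.mono (by simp) (by simp) (by simp))
  have h6 : ω.narr 6 = τ.narr 6 := hF₂₃.narr 6 (by simp)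
  have hcard : ∀ s : Finset ℕ, s ⊆ range #B → #(s.image (τ.narr 6)) = #s := fun s hs' =>
    card_image_of_injOn fun i hi j hj he =>
      hinj i (mem_range.1 (hs' hi)) j (mem_range.1 (hs' hj)) he
  have hRcard : #(selected (ω.narr 6) #B (ω.narr 8)) = #{i ∈ range #B | 1 ≤ ω.narr 8 i} := by
    rw [selected, h6, hcard _ (filter_subset _ _)]
  refine ⟨(hF₁₃.mono (by simp) (by simp) (by simp)).trans (hF₄.mono (by simp) (by simp) (by simp)),
    selected (ω.narr 6) #B (ω.narr 8), fun k hk => ?_, ?_, ?_, fun R' hR' hcov => ?_, fun y => ?_⟩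
  · obtain ⟨i, hi, -, rfl⟩ := mem_selected.1 hk
    exact H₃.mem i hi
  · have := hG₃.1
    rwa [Feas, H₃.h_eq, hF₁₃.narr 1 (by simp), hF₁₃.narr 2 (by simp)] at this
  · rw [h2, hRcard, hF₁₃.nvar 2 (by simp)]
  -- The mask of an arbitrary competitor R'. Bits between #B and W are enumerated too but
  -- irrelevant; beyond W the mask must agree with the memory before the search.
  · set β : ℕ → ℕ := fun i => if i < W then (if τ.narr 6 i ∈ R' then 1 else 0) else υ.narr 7 i
      with hβ
    have hβh : ∀ i < #B, β i = if τ.narr 6 i ∈ R' then 1 else 0 := fun i hi => by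
      rw [hβ]; exact if_pos (by omega)
    have hsel : selected (τ.narr 6) #B β = R' := by
      ext k
      rw [mem_selected]
      constructor
      · rintro ⟨i, hi, hb, rfl⟩
        rw [hβh i hi] at hb
        by_contra hk
        rw [if_neg hk] at hb
        omega
      · intro hk
        obtain ⟨i, hi, rfl⟩ := hs k (hR' hk)
        exact ⟨i, hi, by rw [hβh i hi, if_pos hk], rfl⟩
    have hfeas : Feas B υ β := by
      rw [feas_iff_of_fr hF₂, Feas, h14, hsel, hF.narr 1 (by simp), hF.narr 2 (by simp)]
      exact hcov
    have hle := hopt β (fun i hi => by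
      rw [hβ]; simp only [hi, if_true]; split_ifs <;> simp) (fun i hi => by
      rw [hβ]; exact if_neg (by omega)) hfeas
    have h16 := hG₃.2
    rw [H₃.h_eq] at h16
    -- The recorded size is the sum of the mask entries, which bounds the number of selected
    -- intervals from above. The list has no repetitions, so for the mask of R' the sum counts
    -- members of R'.
    calc #(selected (ω.narr 6) #B (ω.narr 8)) = ∑ i ∈ range #B, if 1 ≤ ω.narr 8 i then 1 else 0 := by
          rw [hRcard, card_filter]
      _ ≤ ∑ i ∈ range #B, ω.narr 8 i := sum_le_sum fun i _ => by split_ifs <;> omega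
      _ ≤ ∑ i ∈ range #B, β i := h16 ▸ hle
      _ = #{i ∈ range #B | τ.narr 6 i ∈ R'} := by
          rw [card_filter]; exact sum_congr rfl fun i hi => hβh i (mem_range.1 hi)
      _ = #({i ∈ range #B | τ.narr 6 i ∈ R'}.image (τ.narr 6)) := (hcard _ (filter_subset _ _)).symm
      _ ≤ #R' := card_le_card fun k hk => by
          obtain ⟨i, hi, rfl⟩ := mem_image.1 hk
          exact (mem_filter.1 hi).2
  · rw [hy y, hF₁₃.nvar 2 (by simp), hF₁₃.rarr 4 (by simp), hF₁₃.rarr 2 (by simp)]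

end RealRAM

/-! ### Running through all chunks -/

namespace RealRAM

open Finset DiscCode

/-- The least size of a part of `B` that covers `B`. -/
noncomputable def coverNumber (U V : ℕ → ℕ) (B : Finset ℕ) : ℕ :=
  sInf {r | ∃ R ⊆ B, Covers U V R B ∧ #R = r}

theorem coverNumber_le {U V : ℕ → ℕ} {R B : Finset ℕ} (hR : R ⊆ B) (h : Covers U V R B) :
    coverNumber U V B ≤ #R := Nat.sInf_le ⟨R, hR, h, rfl⟩

theorem le_coverNumber {U V : ℕ → ℕ} {B : Finset ℕ} {r : ℕ}
    (h : ∀ R ⊆ B, Covers U V R B → r ≤ #R) : r ≤ coverNumber U V B := by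
  refine le_csInf ⟨_, B, Subset.rfl, Covers.refl .., rfl⟩ ?_
  rintro _ ⟨R, hR, hc, rfl⟩
  exact h R hR hc

/-- Output of optimal solutions of all chunks. -/
def bruteP (W : ℕ) : Prog :=
  forX 5 (.var 3) (ifX (.and (validX 5) (.not (.sum 40 (.var 5) (sameX 40 5)))) (solveP W) .skip)

/-- A chunk is solved when its least key is reached, hence once. At most 2n + 1 keys with O(2 ^ W *
W * n) steps each give the quadratic bound. Covering is preserved under union, so solving the chunks
separately solves E. -/
theorem bruteP_spec {n W : ℕ} {σ : Store} (hn : 0 < n) (hW : 0 < W)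
    (h0 : σ.nvar 0 = n) (h2 : σ.nvar 2 = 0) (h3 : σ.nvar 3 = 2 * n + 1) (E : Finset ℕ)
    (hE : E = keys n (σ.narr 1) (σ.narr 2))
    (hU : ∀ k ∈ E, σ.narr 1 k ≤ n) (hV : ∀ k ∈ E, σ.narr 2 k ≤ n) (id : ℕ → ℕ × ℕ)
    (hid : ∀ k ∈ E, (σ.narr 4 k, σ.narr 5 k) = id k) (hcW : ∀ c, #{k ∈ E | id k = c} ≤ W) :
    WP (bruteP W) (10000 * 2 ^ W * W * n ^ 2) σ fun τ =>
      ∃ K ⊆ E, Covers (σ.narr 1) (σ.narr 2) K E ∧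
        (∀ y, (∃ j < τ.nvar 2, τ.rarr 2 j = y) ↔ ∃ k ∈ K, σ.rarr 4 k = y) ∧
        τ.nvar 2 ≤ ∑ c ∈ E.image id, coverNumber (σ.narr 1) (σ.narr 2) {k ∈ E | id k = c} := by
  set U := σ.narr 1 with hUd
  set V := σ.narr 2 with hVd
  have hmemE : ∀ k, k ∈ E ↔ k < 2 * n + 1 ∧ U k < V k := by
    intro k; rw [hE, keys, mem_filter, mem_range]
  set a : ℕ × ℕ → ℕ := fun c => coverNumber U V {k ∈ E | id k = c} with ha
  have hlast : ∀ i, i ∈ E → ({k ∈ E | k < i + 1} : Finset ℕ) = insert i {k ∈ E | k < i} := by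
    intro i hi
    ext k
    simp only [mem_filter, mem_insert]
    constructor
    · rintro ⟨h1, h2⟩
      by_cases hk : k = i
      · exact .inl hk
      · exact .inr ⟨h1, by omega⟩
    · rintro (rfl | ⟨h1, h2⟩)
      · exact ⟨hi, by omega⟩
      · exact ⟨h1, by omega⟩
  have hlast' : ∀ i, i ∉ E → ({k ∈ E | k < i + 1} : Finset ℕ) = {k ∈ E | k < i} := by
    intro i hi
    refine filter_congr fun k hk => ?_
    have : k ≠ i := by rintro rfl; exact hi hk
    omega
  have hbudget : (2 * n + 1) * ((2000 * 2 ^ W * W * n + 124 * (2 * n + 1) + 60) + 1 + 9) + 1 + 7 ≤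
      10000 * 2 ^ W * W * n ^ 2 := by
    have h1 : 2 ≤ 2 ^ W := le_self_pow₀ (a := 2) (by norm_num) hW.ne'
    set Z := 2 ^ W * W with hZ
    have hZ2 : 2 ≤ Z := h1.trans (Nat.le_mul_of_pos_right _ hW)
    have e1 : 2000 * 2 ^ W * W * n = 2000 * (Z * n) := by rw [hZ]; ring
    have e2 : 10000 * 2 ^ W * W * n ^ 2 = 10000 * (Z * n * n) := by rw [hZ]; ring
    rw [e1, e2]
    have h4 : 2 * n ≤ Z * n := Nat.mul_le_mul_right _ hZ2
    have h5 : 2000 * (Z * n) + 124 * (2 * n + 1) + 60 + 1 + 9 ≤ 2221 * (Z * n) + 0 := by omega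
    have h6 := Nat.mul_le_mul (show 2 * n + 1 ≤ 3 * n by omega) h5
    have h7 : 3 * n * (2221 * (Z * n) + 0) = 6663 * (Z * n * n) := by ring
    have h8 : 1 ≤ Z * n * n := Nat.mul_pos (Nat.mul_pos (by omega) hn) hn
    omega
  apply WP.forX (2 * n + 1) (2000 * 2 ^ W * W * n + 124 * (2 * n + 1) + 60) (fun i τ =>
    Fr [2, 5, 14, 15, 16, 17, 18] [6, 7, 8] [2] σ τ ∧ τ.nvar 5 = i ∧
    ∃ K ⊆ E, (∀ k ∈ E, k < i → Covers U V K {k' ∈ E | id k' = id k}) ∧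
      (∀ y, (∃ j < τ.nvar 2, τ.rarr 2 j = y) ↔ ∃ k ∈ K, σ.rarr 4 k = y) ∧
      τ.nvar 2 ≤ ∑ c ∈ ({k ∈ E | k < i} : Finset ℕ).image id, a c) (by norm_num) (by decide)
  · exact ⟨(Fr.refl ..).setVar (by simp) _, by simp, ∅, by simp, by simp, by simp [h2],
      by simp [h2]⟩
  · rintro i τ ⟨hF, h5, -⟩
    exact ⟨h5, (hF.nvar 3 (by simp)).trans h3⟩
  · rintro i hi τ ⟨hF, h5, K, hKE, hKc, hKy, hKa⟩
    have t1 : τ.narr 1 = U := hF.narr 1 (by simp)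
    have t2 : τ.narr 2 = V := hF.narr 2 (by simp)
    have t4 : τ.narr 4 = σ.narr 4 := hF.narr 4 (by simp)
    have t5 : τ.narr 5 = σ.narr 5 := hF.narr 5 (by simp)
    have hcond : 1 ≤ (CExp.and (validX 5) (.not (.sum 40 (.var 5) (sameX 40 5)))).eval τ ↔
        i ∈ E ∧ ∀ k ∈ E, k < i → id k ≠ id i := by
      rw [CExp.eval_and, CExp.one_le_ite_and, validX, CExp.eval_lt, CExp.one_le_ite]
      have hv : (CExp.at 1 5).eval τ < (CExp.at 2 5).eval τ ↔ i ∈ E := by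
        rw [CExp.eval_get, CExp.eval_get, CExp.eval_var, h5, t1, t2, hmemE]
        exact ⟨fun h => ⟨hi, h⟩, fun h => h.2⟩
      rw [hv]
      refine and_congr_right fun hiE => ?_
      have hs : (CExp.sum 40 (.var 5) (sameX 40 5)).eval τ = 0 ↔
          ∀ k ∈ E, k < i → id k ≠ id i := by
        rw [CExp.eval_sum, CExp.eval_var, h5, sum_eq_zero_iff]
        refine forall_congr' fun k => ?_
        have hk : 1 ≤ (sameX 40 5).eval (τ.setVar 40 k) ↔ U k < V k ∧
            (σ.narr 4 k, σ.narr 5 k) = (σ.narr 4 i, σ.narr 5 i) := by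
          rw [one_le_sameX]
          simp [t1, t2, t4, t5, h5]
        rw [mem_range]
        constructor
        · intro h hkE hki he
          have h0 := h hki
          have := hk.2 ⟨((hmemE k).1 hkE).2, by rw [hid k hkE, hid i hiE, he]⟩
          omega
        · intro h hki
          by_contra hne
          obtain ⟨h1, h2⟩ := hk.1 (Nat.one_le_iff_ne_zero.2 hne)
          have hkE : k ∈ E := (hmemE k).2 ⟨by omega, h1⟩
          refine h hkE hki ?_
          rw [← hid k hkE, ← hid i hiE, h2]
      rw [← hs, CExp.eval_not]
      split_ifs <;> omega
    refine WP.ifX (u := 2000 * 2 ^ W * W * n + 1) (by decide) (fun h => ?_) (fun h => ?_) ?_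
    · obtain ⟨hiE, hnew⟩ := hcond.1 h
      set B : Finset ℕ := {k ∈ E | id k = id i} with hB
      refine (solveP_spec (n := n) (W := W) (B := B) hn hW (hcW _)
        ((hF.nvar 0 (by simp)).trans h0) ((hF.nvar 3 (by simp)).trans h3) ?_ ?_ ?_).mono
        (Nat.le_succ _) ?_
      · intro k
        rw [hB, mem_filter, h5, t1, t2, t4, t5, hid i hiE]
        constructor
        · rintro ⟨hk, he⟩
          obtain ⟨h1, h2⟩ := (hmemE k).1 hk
          exact ⟨h1, h2, by rw [hid k hk, he]⟩
        · rintro ⟨h1, h2, he⟩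
          have hk := (hmemE k).2 ⟨h1, h2⟩
          exact ⟨hk, by rw [← hid k hk, he]⟩
      · intro k hk; rw [t1]; exact hU k (mem_filter.1 hk).1
      · intro k hk; rw [t2]; exact hV k (mem_filter.1 hk).1
      · rintro υ ⟨hF₂, R, hRB, hRc, hR2, hRopt, hRy⟩
        rw [t1, t2] at hRc
        rw [t1, t2] at hRopt
        refine ⟨(hF₂.nvar 5 (by simp)).trans h5, ((hF.trans (hF₂.mono (by simp) (by simp)
          (by simp))).setVar (by simp) _), by simp, K ∪ R,
          union_subset hKE (hRB.trans (filter_subset _ _)), fun k hk hki => ?_, fun y => ?_, ?_⟩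
        · by_cases hki' : k < i
          · obtain ⟨c1, c2⟩ := hKc k hk hki'
            refine ⟨fun x hx g hg => ?_, fun x hx g hg => ?_⟩
            · obtain ⟨z, hz, hzg⟩ := c1 x hx g hg
              exact ⟨z, mem_union_left _ hz, hzg⟩
            · obtain ⟨z, hz, hzg⟩ := c2 x hx g hg
              exact ⟨z, mem_union_left _ hz, hzg⟩
          · obtain rfl : k = i := by omega
            refine ⟨fun x hx g hg => ?_, fun x hx g hg => ?_⟩
            · obtain ⟨z, hz, hzg⟩ := hRc.1 x hx g hg
              exact ⟨z, mem_union_right _ hz, hzg⟩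
            · obtain ⟨z, hz, hzg⟩ := hRc.2 x hx g hg
              exact ⟨z, mem_union_right _ hz, hzg⟩
        · simp only [nvar_setVar, rarr_setVar, show (2 : ℕ) ≠ 5 by norm_num, if_false]
          rw [hRy y, hKy y, hF.rarr 4 (by simp)]
          simp only [mem_union, or_and_right, exists_or]
        · simp only [nvar_setVar, show (2 : ℕ) ≠ 5 by norm_num, if_false]
          -- A new chunk adds its own covering number to the sum, since its identifier has not
          -- occurred before.
          rw [hlast i hiE, image_insert, sum_insert]
          · have := le_coverNumber hRopt
            have h9 : a (id i) = coverNumber U V B := rfl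
            omega
          · intro hmem
            obtain ⟨k, hk, he⟩ := mem_image.1 hmem
            exact hnew k (mem_filter.1 hk).1 (mem_filter.1 hk).2 he
    · refine WP.skip ⟨h5, hF.setVar (by simp) _, by simp, K, hKE, fun k hk hki => ?_, by simpa using hKy, ?_⟩
        (by omega)
      · by_cases hki' : k < i
        · exact hKc k hk hki'
        · obtain rfl : k = i := by omega
          have hex : ∃ k' ∈ E, k' < k ∧ id k' = id k := by
            by_contra hcon
            push Not at hcon
            exact h (hcond.2 ⟨hk, hcon⟩)
          obtain ⟨k', hk', hlt, he⟩ := hex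
          rw [← he]
          exact hKc k' hk' hlt
      · simp only [nvar_setVar, show (2 : ℕ) ≠ 5 by norm_num, if_false]
        by_cases hiE : i ∈ E
        · rw [hlast i hiE, image_insert]
          exact hKa.trans (sum_le_sum_of_subset (subset_insert _ _))
        · rwa [hlast' i hiE]
    · have hc : (CExp.sum 40 (.var 5) (sameX 40 5)).cost τ ≤ 124 * (2 * n + 1) + 12 := by
        simp only [CExp.cost, sameX_cost, CExp.eval_var, h5, sum_const, card_range, smul_eq_mul]
        omega
      have hc2 : (validX 5).cost τ = 22 := by simp [validX, CExp.cost, CExp.lt]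
      have hc3 : (CExp.and (validX 5) (.not (.sum 40 (.var 5) (sameX 40 5)))).cost τ =
          22 + ((CExp.sum 40 (.var 5) (sameX 40 5)).cost τ + 2 + 6) + 2 + 4 := by
        rw [← hc2]; rfl
      omega
  · rintro τ ⟨hF, -, K, hKE, hKc, hKy, hKa⟩
    have hlt : ∀ k ∈ E, k < 2 * n + 1 := fun k hk => ((hmemE k).1 hk).1
    rw [filter_true_of_mem hlt] at hKa
    refine ⟨K, hKE, ⟨fun k hk g hg => ?_, fun k hk g hg => ?_⟩, hKy, hKa⟩
    · exact (hKc k hk (hlt k hk)).1 k (mem_filter.2 ⟨hk, rfl⟩) g hg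
    · exact (hKc k hk (hlt k hk)).2 k (mem_filter.2 ⟨hk, rfl⟩) g hg
  · exact hbudget

end RealRAM

namespace DiscCode

open Finset

/-- Distinct intervals of a reduced instance have distinct keys, because equal keys mean equal
traces; keys are at most 2n. -/
theorem card_le_of_isReduced {n m : ℕ} {q : ℕ → ℝ} (hq : ∀ i j, i < j → j < n → q i < q j)
    {P : Set ℝ} (hP : ∀ y, y ∈ P ↔ ∃ i < n, q i = y) {s : Fin m → ℝ}
    (hs : Function.Injective s) (h : IsReduced P (unitSegments s)) : m ≤ 2 * n + 1 := by
  have hinj : Set.InjOn (fun j => cntLt n q (s j) + cntLe n q (s j + 1))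
      (univ : Finset (Fin m)) := by
    intro i _ j _ hij
    obtain ⟨h1, h2⟩ := cnt_eq_of_add_eq hij
    refine hs (unitSegment_injective (h.2 _ ?_ _ ?_ fun y hy => ?_))
    · exact mem_image_of_mem _ (mem_univ _)
    · exact mem_image_of_mem _ (mem_univ _)
    · obtain ⟨k, hk, rfl⟩ := (hP y).1 hy
      rw [mem_unitSegment_iff hq hk, mem_unitSegment_iff hq hk, h1, h2]
  have := card_le_card_of_injOn (t := range (2 * n + 1)) _ (fun j _ => by
    have h1 := cntLt_le n q (s j)
    have h2 := cntLe_le n q (s j + 1)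
    simp only [coe_range, Set.mem_Iio]
    omega) hinj
  simpa using this

end DiscCode

/-! ### The algorithm for the discrete problem -/

namespace RealRAM

open Finset DiscCode

/-- The approximation algorithm for the discrete problem. -/
def approxP (L : ℕ) : Prog :=
  .seq sortP (.seq powP (.seq tableP (.seq windowP (.seq (offsetP L) (.seq (chunkP L)
    (bruteP (L ^ 2)))))))

/-- The two bounds relating n and m serve the running time: the first permits replacing log n by log
m, and the second makes the term m log n quadratic in n for reduced instances. -/
theorem approxP_spec {n m L : ℕ} {p : Fin n → ℝ} {s : Fin m → ℝ} {σ : Store} (hn : 0 < n)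
    (hL : 0 < L) (h0 : σ.nvar 0 = n) (h1 : σ.nvar 1 = m) (h2 : σ.nvar 2 = 0)
    (hp : ∀ i : Fin n, σ.rarr 0 i = p i) (hs : ∀ j : Fin m, σ.rarr 1 j = s j)
    (hU : ∀ k, σ.narr 1 k = 0) (hV : ∀ k, σ.narr 2 k = 0) (hinj : Function.Injective p)
    (hdisc : IsDiscCode (Set.range p) (unitSegments s)) :
    WP (approxP L) (17000 * 4 ^ L ^ 2 * n ^ 2 + m * (Nat.log 2 n + 1) * 500) σ fun τ =>
      (IsDiscreteSolution (Set.range p) (unitSegments s) (output τ) ∧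
        ∀ T', IsDiscreteSolution (Set.range p) (unitSegments s) T' →
          L * #(output τ) ≤ (L + 176) * #T') ∧ n + 1 ≤ 2 * m ∧
      (Function.Injective s → IsReduced (Set.range p) (unitSegments s) → m ≤ 2 * n + 1) := by
  set W := L ^ 2 with hW
  have hW0 : 0 < W := by positivity
  have hbudget : 64 * n ^ 2 + (130 * n + ((m * (Nat.log 2 n + 1) * 500 + 8) + (900 * n +
      (2000 * W * n ^ 2 + (4000 * W * n ^ 2 + 10000 * 2 ^ W * W * n ^ 2))))) ≤
      17000 * 4 ^ W * n ^ 2 + m * (Nat.log 2 n + 1) * 500 := by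
    have e1 : n ≤ n ^ 2 := Nat.le_self_pow (by norm_num) n
    have e2 : 0 < n ^ 2 := by positivity
    have e3 : W < 2 ^ W := Nat.lt_two_pow_self
    have e4 : 1 ≤ 2 ^ W := Nat.one_le_two_pow
    have e5 : (4 : ℕ) ^ W = 2 ^ W * 2 ^ W := by norm_num [← mul_pow]
    -- The polynomial factors in W are absorbed by passing from 2 ^ W to 4 ^ W.
    have e6 : 2 ^ W * W ≤ 4 ^ W := e5 ▸ Nat.mul_le_mul_left _ e3.le
    have e7 : W ≤ 4 ^ W := (Nat.le_mul_of_pos_left _ e4).trans e6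
    have e8 : 4 ≤ 4 ^ W := le_self_pow₀ (a := 4) (by norm_num) hW0.ne'
    have f1 := Nat.mul_le_mul_right (n ^ 2) e6
    have f2 := Nat.mul_le_mul_right (n ^ 2) e7
    have f3 := Nat.mul_le_mul_right (n ^ 2) e8
    have g1 : 2000 * W * n ^ 2 = 2000 * (W * n ^ 2) := by ring
    have g2 : 4000 * W * n ^ 2 = 4000 * (W * n ^ 2) := by ring
    have g3 : 10000 * 2 ^ W * W * n ^ 2 = 10000 * (2 ^ W * W * n ^ 2) := by ring
    have g4 : 17000 * 4 ^ W * n ^ 2 = 17000 * (4 ^ W * n ^ 2) := by ring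
    rw [g1, g2, g3, g4]
    omega
  have hpn : ∀ i, ∀ hi : i < n, σ.rarr 0 i = p ⟨i, hi⟩ := fun i hi => hp ⟨i, hi⟩
  refine WP.seq_le _ _ hbudget ?_
  refine (sortP_spec h0 hn).mono le_rfl ?_
  rintro τ₁ ⟨F₁, hsort⟩
  have hS := isSorting_of_cntLt (fun i hi j hj he => by
    rw [hpn i hi, hpn j hj] at he
    exact congrArg Fin.val (hinj he)) hsort
  have hq := hS.strictMono
  have hP : ∀ y, y ∈ Set.range p ↔ ∃ i < n, τ₁.rarr 3 i = y := by
    intro y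
    rw [hS.mem_iff]
    constructor
    · rintro ⟨i, rfl⟩
      exact ⟨i, i.2, hp i⟩
    · rintro ⟨i, hi, rfl⟩
      exact ⟨⟨i, hi⟩, (hpn i hi).symm⟩
  refine WP.seq ((powP_spec ((F₁.nvar 0 (by simp)).trans h0) hn).mono le_rfl ?_)
  rintro τ₂ ⟨F₂, hlog, hpw⟩
  have F12 : Fr [4, 5] [0] [3] σ τ₂ :=
    (F₁.mono (by simp) (by simp) (by simp)).trans (F₂.mono (by simp) (by simp) (by simp))
  have r23 : τ₂.rarr 3 = τ₁.rarr 3 := F₂.rarr 3 (by simp)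
  refine WP.seq ((tableP_spec ((F12.nvar 0 (by simp)).trans h0) ((F12.nvar 1 (by simp)).trans h1)
    hlog hn hpw (r23 ▸ hq) (by rw [F12.narr 1 (by simp)]; exact hU)
    (by rw [F12.narr 2 (by simp)]; exact hV)).mono le_rfl ?_)
  rintro τ₃ ⟨F₃, hT⟩
  have r33 : τ₃.rarr 3 = τ₁.rarr 3 := (F₃.rarr 3 (by simp)).trans r23
  have F13 : Fr [4, 5, 6, 7, 8, 9] [0, 1, 2] [3, 4] σ τ₃ :=
    (F12.mono (by simp) (by simp) (by simp)).trans (F₃.mono (by simp) (by simp) (by simp))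
  rw [r23, F12.rarr 1 (by simp)] at hT
  refine WP.seq ((windowP_spec ((F13.nvar 0 (by simp)).trans h0) hn (r33 ▸ hq)
    (r33 ▸ hT)).mono le_rfl ?_)
  rintro τ₄ ⟨F₄, h3, hWin, hres⟩
  rw [r33] at hWin
  set U := τ₃.narr 1 with hUd
  set V := τ₃.narr 2 with hVd
  set E := keys n U V with hE
  set X := τ₃.rarr 4 with hX
  set w := τ₄.narr 3 with hw
  set A := τ₄.rarr 5 with hA
  have u4 : τ₄.narr 1 = U := F₄.narr 1 (by simp)
  have v4 : τ₄.narr 2 = V := F₄.narr 2 (by simp)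
  refine WP.seq ((offsetP_spec hn hL h3 (by
    rw [u4, v4]; exact fun k hk => (hres k hk).1)).mono le_rfl ?_)
  rintro τ₅ ⟨F₅, ho, hbest⟩
  rw [u4, v4] at hbest
  have u5 : τ₅.narr 1 = U := (F₅.narr 1 (by simp)).trans u4
  have v5 : τ₅.narr 2 = V := (F₅.narr 2 (by simp)).trans v4
  have w5 : τ₅.narr 3 = w := F₅.narr 3 (by simp)
  refine WP.seq ((chunkP_spec (X := X) (A := A) hn ho ((F₅.nvar 3 (by simp)).trans h3) rfl (by
    rw [u5, v5, w5, F₅.rarr 6 (by simp)]; exact hres)).mono le_rfl ?_)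
  rintro τ₆ ⟨F₆, hid⟩
  rw [u5, v5, w5] at hid
  have u6 : τ₆.narr 1 = U := (F₆.narr 1 (by simp)).trans u5
  have v6 : τ₆.narr 2 = V := (F₆.narr 2 (by simp)).trans v5
  have F46 : Fr [5, 6, 11, 12, 13] [4, 5, 9, 10] [] τ₄ τ₆ :=
    (F₅.mono (by simp) (by simp) (by simp)).trans (F₆.mono (by simp) (by simp) (by simp))
  have F16 : Fr [3, 4, 5, 6, 7, 8, 9, 10, 11, 12, 13] [0, 1, 2, 3, 4, 5, 9, 10] [3, 4, 5, 6]
      σ τ₆ :=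
    ((F13.mono (by simp) (by simp) (by simp)).trans (F₄.mono (by simp) (by simp) (by simp))).trans
      (F46.mono (by simp) (by simp) (by simp))
  have x6 : τ₆.rarr 4 = X := (F46.rarr 4 (by simp)).trans (F₄.rarr 4 (by simp))
  refine (bruteP_spec hn hW0 ((F16.nvar 0 (by simp)).trans h0) ((F16.nvar 2 (by simp)).trans h2)
    ((F46.nvar 3 (by simp)).trans h3) E (by rw [u6, v6])
    (fun k hk => by rw [u6, hT.U_eq k hk]; exact cntLt_le _ _ _)
    (fun k hk => by rw [v6, hT.V_eq k hk]; exact cntLe_le _ _ _)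
    (Windowing.chunkId E X A w L (τ₅.nvar 12)) hid
    (fun c => Windowing.card_chunk_le_sq hL _ c)).mono le_rfl ?_
  rintro τ ⟨K, hKE, hKc, hKy, hKa⟩
  rw [u6, v6] at hKc hKa
  rw [x6] at hKy
  have hmem : ∀ I, I ∈ output τ ↔ ∃ k ∈ K, I = unitSegment (X k) := by
    intro I
    simp only [output, unitSegments, mem_image, mem_univ, true_and]
    constructor
    · rintro ⟨j, rfl⟩
      obtain ⟨k, hk, he⟩ := (hKy _).1 ⟨j, j.2, rfl⟩
      exact ⟨k, hk, by rw [he]⟩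
    · rintro ⟨k, hk, rfl⟩
      obtain ⟨j, hj, he⟩ := (hKy _).2 ⟨k, hk, rfl⟩
      exact ⟨⟨j, hj⟩, by rw [he]⟩
  refine ⟨approx_of_chunks hT hn hq hP hs hdisc hWin ho hbest
    (fun c => coverNumber U V (Windowing.chunk E X A w L (τ₅.nvar 12) c)) K hKE hKc
    (fun c R hR hc => coverNumber_le hR hc) hmem ((card_unitSegments_le _).trans hKa), ?_,
    fun hsi hred => card_le_of_isReduced hq hP hsi hred⟩
  obtain ⟨K', -, hK', hc⟩ := hT.exists_hitsAll hq hn hP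
    (fun I hI => exists_of_mem_unitSegments hs hI) hdisc
  have e1 := KeyTable.le_two_mul_card hK'
  have e2 := card_unitSegments_le s
  omega

end RealRAM

/-! ### The continuous problem: finitely many positions suffice -/

namespace DiscCode

open Finset

/-- Replacing the members of a discriminating code by objects with the same points. -/
theorem exists_isDiscreteSolution_of_trace {α : Type*} {P : Set α} {S T : Finset (Set α)}
    (h : IsDiscCode P T)
    (hS : ∀ I ∈ T, (∃ p ∈ P, p ∈ I) → ∃ J ∈ S, ∀ p ∈ P, p ∈ J ↔ p ∈ I) :
    ∃ T', IsDiscreteSolution P S T' ∧ #T' ≤ #T := by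
  classical
  choose! f hf using hS
  set T₀ : Finset (Set α) := {I ∈ T | ∃ p ∈ P, p ∈ I} with hT₀
  have hmem : ∀ p ∈ P, ∀ I ∈ T, p ∈ I → f I ∈ code (T₀.image f) p := by
    intro p hp I hI hpI
    have hex : ∃ p ∈ P, p ∈ I := ⟨p, hp, hpI⟩
    exact ⟨mem_image_of_mem f (mem_filter.2 ⟨hI, hex⟩), ((hf I hI hex).2 p hp).2 hpI⟩
  have hsub : ∀ p ∈ P, ∀ q ∈ P, code (T₀.image f) p = code (T₀.image f) q →
      code T p ⊆ code T q := by
    rintro p hp q hq he I ⟨hI, hpI⟩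
    have h1 := hmem p hp I hI hpI
    rw [he] at h1
    exact ⟨hI, ((hf I hI ⟨p, hp, hpI⟩).2 q hq).1 h1.2⟩
  refine ⟨T₀.image f, ⟨fun J hJ => ?_, fun p hp => ?_, fun p hp q hq hne he => ?_⟩,
    card_image_le.trans (card_filter_le _ _)⟩
  · obtain ⟨I, hI, rfl⟩ := mem_image.1 hJ
    obtain ⟨hIT, hex⟩ := mem_filter.1 hI
    exact (hf I hIT hex).1
  · obtain ⟨I, hI, hpI⟩ := h.1 p hp
    exact ⟨f I, hmem p hp I hI hpI⟩
  · exact h.2 p hp q hq hne ((hsub p hp q hq he).antisymm (hsub q hq p hp he.symm))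

/-- The interval starting at the larger of two points misses the smaller one. This makes the
candidate family a legitimate discrete instance. -/
theorem isDiscCode_of_unitSegment_mem {P : Set ℝ} {T : Finset (Set ℝ)}
    (h : ∀ p ∈ P, unitSegment p ∈ T) : IsDiscCode P T := by
  have hself : ∀ p : ℝ, p ∈ unitSegment p := fun p => ⟨le_rfl, by linarith⟩
  have key : ∀ p ∈ P, ∀ q ∈ P, p < q → code T p ≠ code T q := by
    intro p _ q hq hlt he
    have h1 : unitSegment q ∈ code T q := ⟨h q hq, hself q⟩
    rw [← he] at h1
    exact absurd h1.2.1 (not_le.2 hlt)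
  refine ⟨fun p hp => ⟨_, h p hp, hself p⟩, fun p hp q hq hne => ?_⟩
  rcases lt_or_gt_of_ne hne with hlt | hlt
  · exact key p hp q hq hlt
  · exact (key q hq p hp hlt).symm

/-- The positions at which the set of points in a unit interval changes, together with a position
right after each of them, represent all unit intervals that contain a point. -/
theorem exists_candidate {n : ℕ} {p : Fin n → ℝ} {s : ℕ → ℝ}
    (h1 : ∀ i : Fin n, s i = p i) (h2 : ∀ i : Fin n, s (n + i) = p i - 1)
    (h3 : ∀ e < 2 * n, s e < s (2 * n + e) ∧ ∀ e' < 2 * n, s e < s e' → s (2 * n + e) < s e')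
    {x : ℝ} (hx : ∃ i, p i ∈ unitSegment x) :
    ∃ j < 4 * n, ∀ i, p i ∈ unitSegment (s j) ↔ p i ∈ unitSegment x := by
  by_cases hev : ∃ e < 2 * n, s e = x
  · obtain ⟨e, he, rfl⟩ := hev
    exact ⟨e, by omega, fun i => Iff.rfl⟩
  push Not at hev
  obtain ⟨i₀, hi₀⟩ := hx
  -- An interval containing p i₀ starts at or after the position p i₀ - 1, so some position precedes
  -- x; the last such position is chosen.
  have hne : ({e ∈ range (2 * n) | s e < x} : Finset ℕ).Nonempty := by
    refine ⟨n + i₀, mem_filter.2 ⟨mem_range.2 (by omega), lt_of_le_of_ne ?_ (hev _ (by omega))⟩⟩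
    rw [h2]
    linarith [hi₀.2]
  obtain ⟨e, he, hmax⟩ := exists_max_image _ s hne
  obtain ⟨he1, he2⟩ := mem_filter.1 he
  have he3 := mem_range.1 he1
  obtain ⟨hlt, hnext⟩ := h3 e he3
  -- The trace of [x, x+1] is determined by comparing x with all p i and p i - 1. The position right
  -- after the last one before x lies in the same open gap between these positions as x.
  have key : ∀ v < 2 * n, (s v ≤ s (2 * n + e) ↔ s v ≤ x) ∧ (s (2 * n + e) ≤ s v ↔ x ≤ s v) := by
    intro v hv
    rcases le_or_gt (s v) (s e) with hle | hgt
    · have a1 := hle.trans_lt hlt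
      have a2 := hle.trans_lt he2
      exact ⟨⟨fun _ => a2.le, fun _ => a1.le⟩, ⟨fun h => absurd h (not_le.2 a1),
        fun h => absurd h (not_le.2 a2)⟩⟩
    · have a1 := hnext v hv hgt
      have a2 : x < s v := by
        by_contra hcon
        have := hmax v (mem_filter.2 ⟨mem_range.2 hv,
          lt_of_le_of_ne (not_lt.1 hcon) (hev v hv)⟩)
        linarith
      exact ⟨⟨fun h => absurd h (not_le.2 a1), fun h => absurd h (not_le.2 a2)⟩,
        ⟨fun _ => a2.le, fun _ => a1.le⟩⟩
  refine ⟨2 * n + e, by omega, fun i => ?_⟩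
  have k1 := (key i (by omega)).2
  have k2 := (key (n + i) (by omega)).1
  rw [h1] at k1
  rw [h2] at k2
  rw [unitSegment, unitSegment, Set.mem_Icc, Set.mem_Icc, k1, ← sub_le_iff_le_add, k2,
    sub_le_iff_le_add]

end DiscCode

/-! ### Computing the candidate positions -/

namespace RealRAM

open Finset DiscCode

/-- Computation of a position right after the position with number `5`. -/
def nextP : Prog :=
  .seq (stR 8 (.lit 0) (.add (.at 1 5) (.lit 1)))
  (.seq (forX 6 (.var 3) (ifX (.and (.not (.rle (.at 1 6) (.at 1 5)))
      (.rle (.at 1 6) (.get 8 (.lit 0)))) (stR 8 (.lit 0) (.at 1 6)) .skip))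
  (stR 1 (.add (.var 3) (.var 5)) (.div (.add (.at 1 5) (.get 8 (.lit 0))) (.lit 2))))

/-- The auxiliary cell decreases from s e + 1 to a value above s e that no larger position
undercuts; its midpoint with s e is then strictly between. The initial value serves positions
without a successor. -/
theorem nextP_spec {e N : ℕ} {σ : Store} (h3 : σ.nvar 3 = N) (h5 : σ.nvar 5 = e) :
    WP nextP (57 * N + 50) σ fun τ => Fr [6] [] [1, 8] σ τ ∧
      (∀ j, j ≠ N + e → τ.rarr 1 j = σ.rarr 1 j) ∧ σ.rarr 1 e < τ.rarr 1 (N + e) ∧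
      ∀ e' < N, σ.rarr 1 e < σ.rarr 1 e' → τ.rarr 1 (N + e) < σ.rarr 1 e' := by
  set s := σ.rarr 1 with hs
  refine WP.seq_le 10 (57 * N + 40) (by omega) ?_
  refine WP.stR (by decide) (by decide) ?_ (by simp [CExp.cost, RExp.cost, NExp.cost])
  refine WP.seq_le (57 * N + 8) 24 (by omega) ?_
  apply WP.forX N 47 (fun i τ => Fr [6] [] [8] σ τ ∧ τ.nvar 6 = i ∧ s e < τ.rarr 8 0 ∧
    ∀ e' < i, s e < s e' → τ.rarr 8 0 ≤ s e') (by norm_num) (by decide)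
  · refine ⟨((Fr.refl ..).setReal (by simp) _ _).setVar (by simp) _, by simp, ?_, by simp⟩
    simp [RExp.eval, NExp.eval, h5, hs]
  · rintro i τ ⟨hF, h6, -⟩
    exact ⟨h6, (hF.nvar 3 (by simp)).trans h3⟩
  · rintro i hi τ ⟨hF, h6, hlt, hle⟩
    have hsτ : τ.rarr 1 = s := hF.rarr 1 (by simp)
    have h5τ : τ.nvar 5 = e := (hF.nvar 5 (by simp)).trans h5
    have hcond : 1 ≤ (CExp.and (.not (.rle (.at 1 6) (.at 1 5)))
        (.rle (.at 1 6) (.get 8 (.lit 0)))).eval τ ↔ s e < s i ∧ s i ≤ τ.rarr 8 0 := by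
      rw [CExp.eval_and, CExp.one_le_ite_and, CExp.eval_rle, CExp.one_le_ite, CExp.eval_not,
        CExp.eval_rle]
      simp only [RExp.eval, NExp.eval, h6, h5τ, hsτ]
      refine and_congr_left fun _ => ?_
      by_cases h : s i ≤ s e
      · simp [h]
      · simp [h, not_le.1 h]
    refine WP.ifX (u := 9) (by decide) (fun h => ?_) (fun h => ?_)
      (by simp [CExp.cost, CExp.and, CExp.not, RExp.cost, NExp.cost])
    · obtain ⟨c1, c2⟩ := hcond.1 h
      refine WP.stR (by decide) (by decide) ?_ (by simp [CExp.cost, RExp.cost, NExp.cost])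
      refine ⟨by simpa using h6, (hF.setReal (by simp) _ _).setVar (by simp) _, by simp, ?_,
        fun e' he' hlt' => ?_⟩
      · simpa [RExp.eval, NExp.eval, h6, hsτ] using c1
      · have : s i ≤ s e' := by
          by_cases hei : e' = i
          · rw [hei]
          · exact c2.trans (hle e' (by omega) hlt')
        simpa [RExp.eval, NExp.eval, h6, hsτ] using this
    · refine WP.skip ⟨h6, hF.setVar (by simp) _, by simp, by simpa using hlt,
        fun e' he' hlt' => ?_⟩ (by norm_num)
      simp only [rarr_setVar]
      by_cases hei : e' = i
      · subst hei
        by_contra hcon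
        exact h (hcond.2 ⟨hlt', (not_le.1 hcon).le⟩)
      · exact hle e' (by omega) hlt'
  · rintro τ ⟨hF, -, hlt, hle⟩
    have hsτ : τ.rarr 1 = s := hF.rarr 1 (by simp)
    have h5τ : τ.nvar 5 = e := (hF.nvar 5 (by simp)).trans h5
    have h3τ : τ.nvar 3 = N := (hF.nvar 3 (by simp)).trans h3
    refine WP.stR (by decide) (by decide) ?_ (by simp [CExp.cost, RExp.cost, NExp.cost])
    have hval : ∀ j, (τ.setReal 1 ((CExp.add (.var 3) (.var 5)).eval τ)
        ((RExp.div (.add (.at 1 5) (.get 8 (.lit 0))) (.lit 2)).eval τ)).rarr 1 j =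
        if j = N + e then (s e + τ.rarr 8 0) / 2 else s j := by
      intro j
      simp [RExp.eval, NExp.eval, h5τ, h3τ, hsτ]
    refine ⟨(hF.mono (by simp) (by simp) (by simp)).setReal (by simp) _ _, fun j hj => ?_, ?_,
      fun e' he' hlt' => ?_⟩
    · rw [hval, if_neg hj]
    · rw [hval, if_pos rfl]; linarith
    · rw [hval, if_pos rfl]
      have := hle e' he' hlt'
      linarith
  · simp only [NExp.cost]; omega

/-- Computation of finitely many intervals that suffice for the continuous problem. -/
def candP : Prog :=
  .seq (forX 5 (.var 0) (.seq (stR 1 (.var 5) (.at 0 5))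
    (stR 1 (.add (.var 0) (.var 5)) (.sub (.at 0 5) (.lit 1)))))
  (.seq (asg 3 (.add (.var 0) (.var 0)))
  (.seq (forX 5 (.var 3) nextP) (asg 1 (.add (.var 3) (.var 3)))))

/-- The new positions are stored from the index 2n on, while `nextP` compares only with the first 2n
entries, so earlier results do not disturb later ones. -/
theorem candP_spec {n : ℕ} {σ : Store} (hn : 0 < n) (h0 : σ.nvar 0 = n) :
    WP candP (600 * n ^ 2) σ fun τ => Fr [1, 3, 5, 6] [] [1, 8] σ τ ∧ τ.nvar 1 = 4 * n ∧
      (∀ i < n, τ.rarr 1 i = σ.rarr 0 i) ∧ (∀ i < n, τ.rarr 1 (n + i) = σ.rarr 0 i - 1) ∧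
      ∀ e < 2 * n, τ.rarr 1 e < τ.rarr 1 (2 * n + e) ∧
        ∀ e' < 2 * n, τ.rarr 1 e < τ.rarr 1 e' → τ.rarr 1 (2 * n + e) < τ.rarr 1 e' := by
  have hbudget : (34 * n + 8) + (10 + ((2 * n * (57 * (2 * n) + 60) + 8) + 10)) ≤ 600 * n ^ 2 := by
    obtain ⟨a, rfl⟩ : ∃ a, n = a + 1 := ⟨n - 1, by omega⟩
    ring_nf
    omega
  refine WP.seq_le _ _ hbudget ?_
  apply WP.forX n 24 (fun i τ => Fr [5] [] [1] σ τ ∧ τ.nvar 5 = i ∧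
    ∀ j < i, τ.rarr 1 j = σ.rarr 0 j ∧ τ.rarr 1 (n + j) = σ.rarr 0 j - 1)
    (by norm_num) (by decide)
  · exact ⟨(Fr.refl ..).setVar (by simp) _, by simp, by simp⟩
  · rintro i τ ⟨hF, h5, -⟩
    exact ⟨h5, (hF.nvar 0 (by simp)).trans h0⟩
  · rintro i hi τ ⟨hF, h5, hI⟩
    have h0τ : τ.nvar 0 = n := (hF.nvar 0 (by simp)).trans h0
    have hr : τ.rarr 0 = σ.rarr 0 := hF.rarr 0 (by simp)
    refine WP.seq_le 9 15 le_rfl ?_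
    refine WP.stR (by decide) (by decide) ?_ (by simp [CExp.cost, RExp.cost, NExp.cost])
    refine WP.stR (by decide) (by decide) ?_ (by simp [CExp.cost, RExp.cost, NExp.cost])
    refine ⟨by simpa using h5, ((hF.setReal (by simp) _ _).setReal (by simp) _ _).setVar
      (by simp) _, by simp, fun j hj => ?_⟩
    have hI' := hI j
    constructor
    · simp [RExp.eval, NExp.eval, h5, h0τ, hr]
      rw [if_neg (by omega)]
      split_ifs with h
      · rw [h]
      · exact (hI' (by omega)).1
    · simp [RExp.eval, NExp.eval, h5, h0τ, hr]
      split_ifs with h h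
      · rw [h]
      · omega
      · exact (hI' (by omega)).2
  swap
  · simp only [NExp.cost]; omega
  rintro τ ⟨hF, -, hI⟩
  refine WP.seq_le 10 _ le_rfl ?_
  refine WP.asg (by decide) ?_ (by simp [CExp.cost])
  have h0τ : τ.nvar 0 = n := (hF.nvar 0 (by simp)).trans h0
  refine WP.seq_le (2 * n * (57 * (2 * n) + 60) + 8) 10 le_rfl ?_
  apply WP.forX (2 * n) (57 * (2 * n) + 50) (fun i υ => Fr [1, 3, 5, 6] [] [1, 8] σ υ ∧
    υ.nvar 5 = i ∧ υ.nvar 3 = 2 * n ∧ (∀ j < 2 * n, υ.rarr 1 j = τ.rarr 1 j) ∧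
    ∀ e < i, τ.rarr 1 e < υ.rarr 1 (2 * n + e) ∧
      ∀ e' < 2 * n, τ.rarr 1 e < τ.rarr 1 e' → υ.rarr 1 (2 * n + e) < τ.rarr 1 e')
    (by norm_num) (by decide)
  · refine ⟨((hF.mono (by simp) (by simp) (by simp)).setVar (by simp) _).setVar (by simp) _,
      by simp, ?_, by simp, by simp⟩
    simp [h0τ]; omega
  · rintro i υ ⟨-, h5, h3, -⟩
    exact ⟨h5, h3⟩
  · rintro i hi υ ⟨hFυ, h5, h3, hs, hI2⟩
    refine (nextP_spec h3 h5).mono le_rfl ?_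
    rintro ω ⟨hFω, hne, hlt, hnext⟩
    refine ⟨(hFω.nvar 5 (by simp)).trans h5, (hFυ.trans (hFω.mono (by simp) (by simp)
      (by simp))).setVar (by simp) _, by simp, by simpa using (hFω.nvar 3 (by simp)).trans h3,
      fun j hj => ?_, fun e he => ?_⟩
    · rw [rarr_setVar, hne j (by omega), hs j hj]
    · rw [rarr_setVar]
      by_cases hei : e = i
      · subst hei
        rw [hs e hi] at hlt hnext
        refine ⟨hlt, fun e' he' h => ?_⟩
        rw [← hs e' he'] at h ⊢
        exact hnext e' he' h
      · rw [hne _ (by omega)]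
        exact hI2 e (by omega)
  · rintro υ ⟨hFυ, -, h3, hs, hI2⟩
    refine WP.asg (by decide) ?_ (by simp [CExp.cost])
    refine ⟨hFυ.setVar (by simp) _, by simp [h3]; omega, fun i hi => ?_, fun i hi => ?_,
      fun e he => ?_⟩
    · rw [rarr_setVar, hs i (by omega), (hI i hi).1]
    · rw [rarr_setVar, hs _ (by omega), (hI i hi).2]
    · rw [rarr_setVar, hs e he]
      refine ⟨(hI2 e he).1, fun e' he' h => ?_⟩
      rw [hs e' he'] at h ⊢
      exact (hI2 e he).2 e' he' h
  · simp only [NExp.cost]; linarith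

end RealRAM


/-! ### Choice of the parameter and the final bounds -/

namespace RealRAM

open Finset DiscCode

/-- The output is read from variable 2 and a real array, both of which the agreement up to registers
and bound variables preserves. -/
theorem WP.exec {c : Prog} {t : ℕ} {σ : Store} {Q : Store → Prop} (h : WP c t σ Q) :
    ∃ t' ≤ t, ∃ τ τ', Exec c σ t' τ ∧ output τ = output τ' ∧ Q τ' := by
  obtain ⟨τ', hr, hQ⟩ := h
  obtain ⟨t', ht, τ, hx, hA⟩ := hr σ (Agree.refl _ _)
  refine ⟨t', ht, τ, τ', hx, ?_, hQ⟩
  have h2 : τ.nvar 2 = τ'.nvar 2 := hA.1 2 rfl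
  rw [output, output, h2, hA.2.2]

/-- The base of the constants in the bounds for the number of steps. -/
noncomputable def stepConst : ℝ := (2 : ℝ) ^ (62658 : ℝ)

theorem one_le_stepConst : 1 ≤ stepConst := Real.one_le_rpow (by norm_num) (by norm_num)

/-- The choice of the parameter of the algorithm. -/
theorem exists_parameter {ε : ℝ} (hε : 0 < ε) : ∃ L : ℕ, 0 < L ∧ (L : ℝ) + 176 ≤ (1 + ε) * L ∧
    (4 : ℝ) ^ L ^ 2 ≤ stepConst * (2 : ℝ) ^ (62658 / ε ^ 2) := by
  set δ := min ε 1 with hδ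
  have hδ0 : 0 < δ := lt_min hε one_pos
  have hδε : δ ≤ ε := min_le_left _ _
  have hδ1 : δ ≤ 1 := min_le_right _ _
  have hle := Nat.le_ceil (176 / δ)
  have hlt := Nat.ceil_lt_add_one (show 0 ≤ 176 / δ by positivity)
  -- Replacing ε by min ε 1 ensures that rounding up costs at most 1 / δ, so L ≤ 177 / δ. The
  -- constants are 31329 = 177 ^ 2 and 62658 = 2 * 31329, the factor 2 coming from 4 = 2 ^ 2; the
  -- summand 1 in 1 / ε ^ 2 + 1 becomes the factor `stepConst`.
  set L := ⌈176 / δ⌉₊ with hL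
  have hL0 : 0 < L := Nat.ceil_pos.2 (by positivity)
  have h176 : 176 ≤ L * δ := (div_le_iff₀ hδ0).1 hle
  have hL177 : (L : ℝ) ≤ 177 / δ := by
    have : 1 ≤ 1 / δ := (one_le_div hδ0).2 hδ1
    have h2 : 177 / δ = 176 / δ + 1 / δ := by rw [← add_div]; norm_num
    linarith
  refine ⟨L, hL0, ?_, ?_⟩
  · have : (L : ℝ) * δ ≤ L * ε := mul_le_mul_of_nonneg_left hδε (Nat.cast_nonneg _)
    linarith
  · have hsq : (L : ℝ) ^ 2 ≤ 31329 * (1 / ε ^ 2 + 1) := by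
      have h1 : (L : ℝ) ^ 2 ≤ (177 / δ) ^ 2 := pow_le_pow_left₀ (Nat.cast_nonneg _) hL177 2
      have h2 : 1 / δ ^ 2 ≤ 1 / ε ^ 2 + 1 := by
        rcases min_choice ε 1 with h | h
        · rw [hδ, h]; linarith
        · rw [hδ, h]
          have : 0 ≤ 1 / ε ^ 2 := by positivity
          rw [one_pow, div_one]
          linarith
      have h3 : (177 / δ) ^ 2 = 31329 * (1 / δ ^ 2) := by
        rw [div_pow]; ring
      linarith
    have h4 : (4 : ℝ) ^ L ^ 2 = (2 : ℝ) ^ (2 * (L : ℝ) ^ 2) := by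
      rw [Real.rpow_mul (by norm_num), ← Nat.cast_pow, Real.rpow_natCast]
      norm_num
    rw [h4, stepConst, ← Real.rpow_add (by norm_num)]
    refine Real.rpow_le_rpow_of_exponent_le (by norm_num) ?_
    have : (62658 : ℝ) / ε ^ 2 = 62658 * (1 / ε ^ 2) := by ring
    linarith

theorem log_add_one_le {n m : ℕ} (hm : 0 < m) (h : n ≤ 2 * m) :
    Nat.log 2 n + 1 ≤ 2 * (Nat.log 2 m + 1) := by
  have h1 : Nat.log 2 n ≤ Nat.log 2 (2 * m) := Nat.log_mono_right h
  rw [mul_comm, Nat.log_mul_base (by norm_num) hm.ne'] at h1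
  omega

/-- The ratio between the sizes of two solutions. -/
theorem card_le_of_mul_le {L a b : ℕ} {ε : ℝ} (hL : 0 < L) (hLε : (L : ℝ) + 176 ≤ (1 + ε) * L)
    (h : L * a ≤ (L + 176) * b) : (a : ℝ) ≤ (1 + ε) * b := by
  have hL' : (0 : ℝ) < L := by exact_mod_cast hL
  have h1 : (L : ℝ) * a ≤ (L + 176) * b := by exact_mod_cast h
  have h2 : ((L : ℝ) + 176) * b ≤ (1 + ε) * L * b :=
    mul_le_mul_of_nonneg_right hLε (Nat.cast_nonneg _)
  have h3 : (1 + ε) * L * b = L * ((1 + ε) * b) := by ring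
  exact le_of_mul_le_mul_left (by linarith) hL'

theorem approxP_input {n m : ℕ} {p : Fin n → ℝ} {s : Fin m → ℝ} {L : ℕ} (hn : 0 < n)
    (hL : 0 < L) (hinj : Function.Injective p)
    (hdisc : IsDiscCode (Set.range p) (unitSegments s)) :
    WP (approxP L) (17000 * 4 ^ L ^ 2 * n ^ 2 + m * (Nat.log 2 n + 1) * 500) (input p s)
      fun τ => (IsDiscreteSolution (Set.range p) (unitSegments s) (output τ) ∧
        ∀ T', IsDiscreteSolution (Set.range p) (unitSegments s) T' →
          L * #(output τ) ≤ (L + 176) * #T') ∧ n + 1 ≤ 2 * m ∧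
      (Function.Injective s → IsReduced (Set.range p) (unitSegments s) → m ≤ 2 * n + 1) :=
  approxP_spec hn hL rfl rfl rfl (fun i => by simp [input, load])
    (fun j => by simp [input, load]) (fun _ => rfl) (fun _ => rfl) hinj hdisc

theorem candP_approxP_input {n : ℕ} {p : Fin n → ℝ} {L : ℕ} (hn : 0 < n) (hL : 0 < L)
    (hinj : Function.Injective p) :
    WP (.seq candP (approxP L)) (20000 * 4 ^ L ^ 2 * n ^ 2) (input p ![]) fun τ =>
      IsContinuousSolution (Set.range p) (output τ) ∧
        ∀ T', IsContinuousSolution (Set.range p) T' → L * #(output τ) ≤ (L + 176) * #T' := by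
  -- The candidate instance need not be reduced, but it has only 4n intervals, so m log n is still
  -- quadratic in n.
  have hbudget : 600 * n ^ 2 + (17000 * 4 ^ L ^ 2 * n ^ 2 + 4 * n * (Nat.log 2 n + 1) * 500) ≤
      20000 * 4 ^ L ^ 2 * n ^ 2 := by
    have hlog : Nat.log 2 n + 1 ≤ n := Nat.log_lt_self 2 hn.ne'
    have h1 : 4 * n * (Nat.log 2 n + 1) * 500 ≤ 4 * n * n * 500 :=
      Nat.mul_le_mul_right _ (Nat.mul_le_mul_left _ hlog)
    have h2 : 4 * n * n * 500 = 2000 * n ^ 2 := by ring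
    have h3 : n ^ 2 ≤ 4 ^ L ^ 2 * n ^ 2 := Nat.le_mul_of_pos_left _ (by positivity)
    have h4 : 17000 * 4 ^ L ^ 2 * n ^ 2 = 17000 * (4 ^ L ^ 2 * n ^ 2) := by ring
    have h5 : 20000 * 4 ^ L ^ 2 * n ^ 2 = 20000 * (4 ^ L ^ 2 * n ^ 2) := by ring
    omega
  refine WP.seq_le _ _ hbudget ?_
  refine (candP_spec hn rfl).mono le_rfl ?_
  rintro τ ⟨hF, h1, hs1, hs2, hs3⟩
  have hp : ∀ i : Fin n, (input p ![]).rarr 0 i = p i := fun i => by simp [input, load]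
  have hs1' : ∀ i : Fin n, τ.rarr 1 i = p i := fun i => (hs1 i i.2).trans (hp i)
  have hs2' : ∀ i : Fin n, τ.rarr 1 (n + i) = p i - 1 := fun i => by rw [hs2 i i.2, hp]
  set s : Fin (4 * n) → ℝ := fun j => τ.rarr 1 j with hs
  have hmem : ∀ j < 4 * n, unitSegment (τ.rarr 1 j) ∈ unitSegments s := fun j hj =>
    mem_unitSegments (s := s) (s' := τ.rarr 1) (fun _ => rfl) hj
  have hdisc : IsDiscCode (Set.range p) (unitSegments s) := by
    refine isDiscCode_of_unitSegment_mem ?_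
    rintro _ ⟨i, rfl⟩
    rw [← hs1']
    exact hmem i (by omega)
  refine (approxP_spec hn hL (hF.nvar 0 (by simp)) h1 (hF.nvar 2 (by simp))
    (fun i => by rw [hF.rarr 0 (by simp), hp]) (fun _ => rfl)
    (fun k => by rw [hF.narr 1 (by simp)]; rfl) (fun k => by rw [hF.narr 2 (by simp)]; rfl)
    hinj hdisc).mono le_rfl ?_
  rintro υ ⟨⟨hsol, hopt⟩, -, -⟩
  refine ⟨⟨fun I hI => ?_, hsol.2⟩, fun T' hT' => ?_⟩
  · obtain ⟨j, -, h⟩ := exists_of_mem_unitSegments (s' := τ.rarr 1) (fun _ => rfl) (hsol.1 hI)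
    exact ⟨_, h⟩
  -- Any continuous solution becomes a solution of the candidate instance, of no larger size, by
  -- exchanging its useful members for candidates with the same trace.
  · obtain ⟨T'', hT'', hc⟩ := exists_isDiscreteSolution_of_trace (S := unitSegments s) hT'.2
      (fun I hI hex => by
        obtain ⟨x, rfl⟩ := hT'.1 I hI
        obtain ⟨_, ⟨i, rfl⟩, hi⟩ := hex
        obtain ⟨j, hj, hiff⟩ := exists_candidate hs1' hs2' hs3 ⟨i, hi⟩
        refine ⟨_, hmem j hj, ?_⟩
        rintro _ ⟨i', rfl⟩
        exact hiff i')
    exact (hopt T'' hT'').trans (Nat.mul_le_mul_left _ hc)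

end RealRAM

theorem mainTheorem3 :
    ∃ C c : ℝ, ∀ ε : ℝ, 0 < ε →
      -- the discrete problem
      (∃ A : RealRAM.Prog, ∀ (n m : ℕ) (p : Fin n → ℝ) (s : Fin m → ℝ),
        0 < n → Function.Injective p → Function.Injective s →
        DiscCode.IsDiscCode (Set.range p) (DiscCode.unitSegments s) →
        ∃ (t : ℕ) (τ : RealRAM.Store),
          RealRAM.Exec A (RealRAM.input p s) t τ ∧
          DiscCode.IsApproxSolution
            (DiscCode.IsDiscreteSolution (Set.range p) (DiscCode.unitSegments s))
            (1 + ε) (RealRAM.output τ) ∧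
          (t : ℝ) ≤ C * (2 : ℝ) ^ (c / ε ^ 2) * (n : ℝ) ^ 2
            + C * (m : ℝ) * ((Nat.log 2 m : ℝ) + 1) ∧
          (DiscCode.IsReduced (Set.range p) (DiscCode.unitSegments s) →
            (t : ℝ) ≤ C * (2 : ℝ) ^ (c / ε ^ 2) * (n : ℝ) ^ 2)) ∧
      -- the continuous problem
      (∃ A : RealRAM.Prog, ∀ (n : ℕ) (p : Fin n → ℝ),
        0 < n → Function.Injective p →
        ∃ (t : ℕ) (τ : RealRAM.Store),
          RealRAM.Exec A (RealRAM.input p ![]) t τ ∧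
          DiscCode.IsApproxSolution (DiscCode.IsContinuousSolution (Set.range p))
            (1 + ε) (RealRAM.output τ) ∧
          (t : ℝ) ≤ C * (2 : ℝ) ^ (c / ε ^ 2) * (n : ℝ) ^ 2) := by
  refine ⟨20000 * RealRAM.stepConst, 62658, fun ε hε => ?_⟩
  obtain ⟨L, hL, hLε, hpow⟩ := RealRAM.exists_parameter hε
  have hbound : ∀ n : ℕ, ((20000 * 4 ^ L ^ 2 * n ^ 2 : ℕ) : ℝ) ≤
      20000 * RealRAM.stepConst * (2 : ℝ) ^ (62658 / ε ^ 2) * (n : ℝ) ^ 2 := by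
    intro n
    push_cast
    rw [mul_assoc 20000 RealRAM.stepConst]
    gcongr
  refine ⟨⟨RealRAM.approxP L, fun n m p s hn hp hs hdisc => ?_⟩,
    ⟨.seq RealRAM.candP (RealRAM.approxP L), fun n p hn hp => ?_⟩⟩
  · obtain ⟨t, ht, τ, τ', hx, ho, ⟨hsol, hopt⟩, hnm, hred⟩ :=
      (RealRAM.approxP_input hn hL hp hdisc).exec
    refine ⟨t, τ, hx, ⟨ho ▸ hsol, fun T' hT' =>
      RealRAM.card_le_of_mul_le hL hLε (ho ▸ hopt T' hT')⟩, ?_, fun hr => ?_⟩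
    · have hlog := RealRAM.log_add_one_le (n := n) (m := m) (by omega) (by omega)
      have h1 : t ≤ 20000 * 4 ^ L ^ 2 * n ^ 2 + 20000 * (m * (Nat.log 2 m + 1)) := by
        have h2 : m * (Nat.log 2 n + 1) ≤ m * (2 * (Nat.log 2 m + 1)) :=
          Nat.mul_le_mul_left _ hlog
        have h3 : m * (2 * (Nat.log 2 m + 1)) = 2 * (m * (Nat.log 2 m + 1)) := by ring
        have h4 : 17000 * 4 ^ L ^ 2 * n ^ 2 ≤ 20000 * 4 ^ L ^ 2 * n ^ 2 := by gcongr; norm_num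
        omega
      have h2 : (t : ℝ) ≤ ((20000 * 4 ^ L ^ 2 * n ^ 2 : ℕ) : ℝ) +
          20000 * ((m : ℝ) * ((Nat.log 2 m : ℝ) + 1)) := by exact_mod_cast h1
      have h3 : (m : ℝ) * ((Nat.log 2 m : ℝ) + 1) ≤
          RealRAM.stepConst * ((m : ℝ) * ((Nat.log 2 m : ℝ) + 1)) :=
        le_mul_of_one_le_left (by positivity) RealRAM.one_le_stepConst
      have h4 := hbound n
      linarith
    · have hm := hred hs hr
      have hlog : Nat.log 2 n + 1 ≤ n := Nat.log_lt_self 2 hn.ne'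
      refine le_trans (Nat.cast_le.2 (ht.trans ?_)) (hbound n)
      -- For a reduced instance m ≤ 2n + 1 ≤ 3n, and the number of binary digits of n is at most n.
      have h1 : m * (Nat.log 2 n + 1) ≤ 3 * n * n := Nat.mul_le_mul (by omega) hlog
      have h2 : 3 * n * n = 3 * n ^ 2 := by ring
      have h3 : n ^ 2 ≤ 4 ^ L ^ 2 * n ^ 2 := Nat.le_mul_of_pos_left _ (by positivity)
      have h4 : 17000 * 4 ^ L ^ 2 * n ^ 2 = 17000 * (4 ^ L ^ 2 * n ^ 2) := by ring
      have h5 : 20000 * 4 ^ L ^ 2 * n ^ 2 = 20000 * (4 ^ L ^ 2 * n ^ 2) := by ring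
      omega
  · obtain ⟨t, ht, τ, τ', hx, ho, hsol, hopt⟩ := (RealRAM.candP_approxP_input hn hL hp).exec
    exact ⟨t, τ, hx, ⟨ho ▸ hsol, fun T' hT' =>
      RealRAM.card_le_of_mul_le hL hLε (ho ▸ hopt T' hT')⟩,
      le_trans (Nat.cast_le.2 ht) (hbound n)⟩
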